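/- Let $B\ge 1$ be real, and let $F$ be the class of all complex-valued multiplicative arithmetic functions $f$ (so $f(1)=1$ and $f(mn)=f(m)f(n)$ whenever $(m,n)=1$) with $|f(n)|\le B$ for all $n\ge 1$. Write $e(\alpha)=\exp(2\pi i\alpha)$ and, for a positive integer $N$ and real $\alpha$, $$S(\alpha)=\sum_{n=1}^{N} f(n)\,e(n\alpha).$$ Put $$z=8\sqrt{2\prod_{p>2}\left(1+\frac{1}{p^3-p^2-2p}\right)}\quad(\text{product over odd primes}),$$ $$a_1=1.59\,B^2,\quad a_2=\frac{\pi^2}{6}B^2z,\quad a_3=a_5=0.96\,B^2z,\quad a_4=B^2z,\quad a_6=1.32\,B^2z,$$ and, for real $E,R,q$, $$b_1(B,E)=B+9.82B^2+8.12(a_1+a_4)E+18.9a_3+3.46a_1+4.06a_4,\qquad b_2(B,E)=a_2\,\frac{\sqrt2\,E+1}{\log 2},$$ $$b_3(B,E,R,q)=B^2\,\frac{7.63}{\sqrt E}\,\frac{\log(4ER)}{(\log(ER))^{3/2}}\left(1+\frac{\log(64/E)+1}{\log q}\right)+1.48\,a_5+\frac{1.48\,a_6}{\sqrt{\log(ER)}}+\frac{a_5}{\log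 2}\,\frac{\log(2R)}{(\log(ER))^{3/2}}+\frac{a_6}{\log 2}\,\frac{1}{(\log(ER))^{3/2}}.$$ Then for all integers $N,q$ with $4\le q\le N$, all real $E\ge 4$, all integers $a$ with $(a,q)=1$, and all $f\in F$, $$\left|S\!\left(\frac aq\right)\right|\le b_1(B,E)\,\frac{N}{\log N}+b_2(B,E)\,\frac{N}{\varphi(q)^{1/2}}+b_3\!\left(B,E,\frac Nq,q\right)\sqrt{Nq}\,\left(\log\frac{EN}{q}\right)^{3/2},$$ where $\varphi$ is Euler's totient function. -/

import Mathlib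

namespace MontgomeryVaughan

noncomputable section

/-- The class `F` with parameter `B`: complex-valued multiplicative functions with
`|f(n)| ≤ B` for all `n`. -/
def BoundedMultiplicative (B : ℝ) (f : ArithmeticFunction ℂ) : Prop :=
  f.IsMultiplicative ∧ ∀ n : ℕ, ‖f n‖ ≤ B

/-- `e(α) = exp(2πiα)`. -/
def e (α : ℝ) : ℂ := Complex.exp (2 * Real.pi * Complex.I * α)

/-- `S(α) = ∑_{n=1}^N f(n) e(nα)`. -/
def S (f : ArithmeticFunction ℂ) (N : ℕ) (α : ℝ) : ℂ :=
  ∑ n ∈ Finset.Icc 1 N, f n * e (n * α)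

/-- The factor `1 + 1/(p³ - p² - 2p)`, used for primes `p > 2`. -/
def eulerFactor (p : ℕ) : ℝ := 1 + 1 / ((p : ℝ) ^ 3 - (p : ℝ) ^ 2 - 2 * (p : ℝ))

/-- The infinite product of these factors over the odd primes converges (unconditionally). -/
theorem multipliable_eulerFactor :
    Multipliable (fun p : {p : ℕ // p.Prime ∧ 2 < p} => eulerFactor p) := by
  unfold eulerFactor
  apply Real.multipliable_one_add_of_summable
  have hs : Summable (fun n : ℕ => 9 * (1 / (n : ℝ) ^ 2)) :=
    ((Real.summable_one_div_nat_pow (p := 2)).2 (by norm_num)).mul_left 9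
  have hs' : Summable (fun p : {p : ℕ // p.Prime ∧ 2 < p} => 9 * (1 / ((p : ℕ) : ℝ) ^ 2)) :=
    hs.comp_injective Subtype.val_injective
  refine Summable.of_nonneg_of_le ?_ ?_ hs'
  · rintro ⟨p, _, hp⟩
    have h3 : (3 : ℝ) ≤ p := by exact_mod_cast hp
    have : (0 : ℝ) < (p : ℝ) ^ 3 - (p : ℝ) ^ 2 - 2 * p := by
      have : (p : ℝ) ^ 3 - (p : ℝ) ^ 2 - 2 * p = p * ((p - 2) * (p + 1)) := by ring
      rw [this]
      have : (0 : ℝ) < (p : ℝ) - 2 := by linarith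
      positivity
    positivity
  · rintro ⟨p, _, hp⟩
    have h3 : (3 : ℝ) ≤ p := by exact_mod_cast hp
    have key : (p : ℝ) ^ 2 ≤ 9 * ((p : ℝ) ^ 3 - (p : ℝ) ^ 2 - 2 * p) := by
      nlinarith [mul_nonneg (sub_nonneg.2 h3) (sub_nonneg.2 h3), sq_nonneg (p : ℝ)]
    have hp2 : (0 : ℝ) < (p : ℝ) ^ 2 := by positivity
    have hd : (0 : ℝ) < (p : ℝ) ^ 3 - (p : ℝ) ^ 2 - 2 * p := by linarith
    show 1 / ((p : ℝ) ^ 3 - (p : ℝ) ^ 2 - 2 * p) ≤ 9 * (1 / (p : ℝ) ^ 2)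
    rw [mul_one_div, div_le_div_iff₀ hd hp2]
    linarith

/-- `z = 8 √(2 ∏_{p>2} (1 + 1/(p³ - p² - 2p)))`, the product being over primes. -/
def z : ℝ := 8 * Real.sqrt (2 * ∏' p : {p : ℕ // p.Prime ∧ 2 < p}, eulerFactor p)

def a₁ (B : ℝ) : ℝ := B ^ 2 * 1.59
def a₂ (B : ℝ) : ℝ := B ^ 2 * z * (Real.pi ^ 2 / 6)
def a₃ (B : ℝ) : ℝ := B ^ 2 * z * 0.96
def a₄ (B : ℝ) : ℝ := B ^ 2 * z
def a₅ (B : ℝ) : ℝ := B ^ 2 * z * 0.96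
def a₆ (B : ℝ) : ℝ := B ^ 2 * 1.32 * z

def b₁ (B E : ℝ) : ℝ :=
  B + 9.82 * B ^ 2 + 8.12 * (a₁ B + a₄ B) * E + 18.9 * a₃ B + 3.46 * a₁ B + 4.06 * a₄ B

def b₂ (B E : ℝ) : ℝ := a₂ B * ((Real.sqrt 2 * E + 1) / Real.log 2)

def b₃ (B E R q : ℝ) : ℝ :=
  B ^ 2 * (7.63 / Real.sqrt E) * (Real.log (4 * E * R) / Real.log (E * R) ^ (3 / 2 : ℝ))
      * (1 + (Real.log (64 / E) + 1) / Real.log q)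
    + a₅ B * 1.48
    + 1.48 * (a₆ B / Real.sqrt (Real.log (E * R)))
    + a₅ B / Real.log 2 * (Real.log (2 * R) / Real.log (E * R) ^ (3 / 2 : ℝ))
    + a₆ B / Real.log 2 * (1 / Real.log (E * R) ^ (3 / 2 : ℝ))

end

end MontgomeryVaughan

namespace MontgomeryVaughan

open Finset

/-! ### Sums of periodic functions -/

/-! This is the method of Montgomery and Vaughan. Weighting by `log n` and using multiplicativity
replaces `f(n) log n` by `∑_{p ∣ n} f(p) f(n/p) log p`, at the cost of proper prime powers, which
contribute `O(B² N)` in total (`norm_S_mul_log_le`). What remains is a bilinear sum over `m` and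
primes `p`, smoothed by a ramp of width `q` at the end of the range.

Primes below `2^130` and primes within a bounded factor of `N` contribute `O(B² N)` by Chebyshev's
bound. For `p` in a block `(P, 2P]` with `P = 2^j`, Cauchy–Schwarz over `m` removes `f(m)`, and
opening the square leaves kernels `∑_m w(mp) w(mp') e(m(p - p')a/q)`. Such a kernel is at most
`3N/P`, at most `1/|sin|`, and, thanks to the ramp, at most `(8P/q)/sin²` (`cosKernel_ramp_bounds`).
The pairs are grouped by `h = |p - p'|`. An upper bound sieve allows at most `201 σ₋₁(h) P / log² P`
pairs for each `h` (`card_prime_pairs_le`), and this `log² P` cancels the weights `log p log p'`.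
Since `σ₋₁(h) = ∑_{d ∣ h} 1/d`, the sum over `h` splits into sums over multiples of `d`, where the
fraction has denominator `q / gcd(d, q)`. Averaging over `d` costs only `q/φ(q)`
(`sum_sigmaInv_mul_le`).

The block is therefore at most `B²` times `N·0.9^j + N·0.9^(J-j) + N/√φ(q) + √(Nq) log(N/q)`, up to
constants (`norm_bilinearSum_dyadic_le`). The first two terms sum geometrically over the blocks. The
other two acquire a factor `log N / log 2`, which the initial weight `log N` cancels. This yields
absolute constants `685`, `50 / log 2` and `16` (`norm_S_le`), which `b₁`, `b₂`, `b₃` dominate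
because `E ≥ 4` and `z ≥ 8√2`. The third term is obtained with only the first power of `log(N/q)`.
Since `b₁ ≥ 685 B²`, the claim is trivial for `log N ≤ 685`, which is why crude ranges such as
`2^130` are affordable. -/

theorem sum_range_mul_of_periodic {a b : ℕ} (ha : 0 < a) (hb : 0 < b) (hab : a.Coprime b)
    {F G : ℕ → ℝ} (hF : ∀ n, F (n % a) = F n) (hG : ∀ n, G (n % b) = G n) :
    ∑ n ∈ range (a * b), F n * G n = (∑ n ∈ range a, F n) * ∑ n ∈ range b, G n := by
  rw [sum_mul_sum, ← sum_product']
  refine sum_nbij' (fun n => (n % a, n % b)) (fun x => (Nat.chineseRemainder hab x.1 x.2 : ℕ))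
    ?_ ?_ ?_ ?_ ?_
  · intro n _
    simp [Nat.mod_lt _ ha, Nat.mod_lt _ hb]
  · rintro ⟨x, y⟩ _
    simpa using Nat.chineseRemainder_lt_mul hab x y ha.ne' hb.ne'
  · intro n hn
    have hlt := mem_range.1 hn
    have h1 := (Nat.chineseRemainder hab (n % a) (n % b)).2
    have h2 : (Nat.chineseRemainder hab (n % a) (n % b) : ℕ) ≡ n [MOD a * b] := by
      rw [← Nat.modEq_and_modEq_iff_modEq_mul hab]
      exact ⟨h1.1.trans (Nat.mod_modEq _ _), h1.2.trans (Nat.mod_modEq _ _)⟩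
    exact Nat.ModEq.eq_of_lt_of_lt h2 (Nat.chineseRemainder_lt_mul hab _ _ ha.ne' hb.ne') hlt
  · rintro ⟨x, y⟩ hxy
    simp only [mem_product, mem_range] at hxy
    have h1 := (Nat.chineseRemainder hab x y).2
    ext
    · exact (show _ % a = x % a from h1.1).trans (Nat.mod_eq_of_lt hxy.1)
    · exact (show _ % b = y % b from h1.2).trans (Nat.mod_eq_of_lt hxy.2)
  · intro n _
    simp only [hF, hG]

theorem sum_range_prod_of_periodic (S : Finset ℕ) (hS : ∀ p ∈ S, p.Prime) {c : ℕ → ℕ → ℝ}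
    (hc : ∀ p ∈ S, ∀ n, c p (n % p) = c p n) :
    ∑ n ∈ range (∏ p ∈ S, p), ∏ p ∈ S, c p n = ∏ p ∈ S, ∑ n ∈ range p, c p n := by
  induction S using Finset.induction_on with
  | empty => simp
  | insert p S hp ih =>
    have hS' : ∀ q ∈ S, q.Prime := fun q hq => hS q (mem_insert_of_mem hq)
    have hc' : ∀ q ∈ S, ∀ n, c q (n % q) = c q n := fun q hq => hc q (mem_insert_of_mem hq)
    simp only [prod_insert hp]
    rw [← ih hS' hc']
    refine sum_range_mul_of_periodic (hS p (mem_insert_self _ _)).pos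
      (prod_pos fun q hq => (hS' q hq).pos) ?_ (hc p (mem_insert_self _ _)) ?_
    · refine Nat.Coprime.prod_right fun q hq => ?_
      rw [Nat.coprime_primes (hS p (mem_insert_self _ _)) (hS' q hq)]
      rintro rfl
      exact hp hq
    · intro n
      refine prod_congr rfl fun q hq => ?_
      rw [← hc' q hq, Nat.mod_mod_of_dvd _ (dvd_prod_of_mem _ hq), hc' q hq]

theorem sum_range_add_of_periodic {L : ℕ} {F : ℕ → ℝ} (hF : ∀ n, F (n % L) = F n) (x : ℕ) :
    ∑ n ∈ range L, F (x + n) = ∑ n ∈ range L, F n := by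
  induction x with
  | zero => simp
  | succ x ih =>
    have h1 := sum_range_succ (fun n => F (x + n)) L
    have h2 := sum_range_succ' (fun n => F (x + n)) L
    have h3 : F (x + L) = F x := by rw [← hF, Nat.add_mod_right, hF]
    have h4 : ∑ n ∈ range L, F (x + 1 + n) = ∑ n ∈ range L, F (x + (n + 1)) :=
      sum_congr rfl fun n _ => by congr 1; ring
    rw [h4]
    simp only [add_zero] at h2
    linarith

/-- Whole periods contribute exactly their mean, so the error comes from one incomplete period and
does not grow with `H`. -/
theorem sum_range_le_of_periodic {L : ℕ} (hL : 0 < L) {F : ℕ → ℝ} (hF : ∀ n, F (n % L) = F n)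
    {A μ : ℝ} (hA : ∀ n, F n ≤ A) (hA0 : 0 ≤ A) (hμ : 0 ≤ μ)
    (hmean : ∑ n ∈ range L, F n = L * μ) (H x : ℕ) :
    ∑ n ∈ range H, F (x + n) ≤ H * μ + A * L := by
  induction H using Nat.strong_induction_on generalizing x with
  | _ H ih =>
    rcases lt_or_ge H L with h | h
    · calc ∑ n ∈ range H, F (x + n) ≤ ∑ n ∈ range H, A := sum_le_sum fun n _ => hA _
        _ = A * H := by simp [mul_comm]
        _ ≤ A * L := by gcongr
        _ ≤ H * μ + A * L := by have : 0 ≤ H * μ := by positivity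
                                linarith
    · obtain ⟨k, rfl⟩ := Nat.exists_eq_add_of_le h
      rw [sum_range_add, sum_range_add_of_periodic hF, hmean]
      have := ih k (by omega) (x + L)
      simp only [add_assoc] at this ⊢
      push_cast
      linarith

/-! ### An upper bound sieve for pairs of primes -/

/-- Number of residue classes modulo `p` that `n` must avoid for `n (n + h)` to be prime to `p`. -/
noncomputable def sieveCount (h p : ℕ) : ℝ := if p ∣ h then 1 else 2

/-- Balanced indicator of the classes modulo `p` excluded by `n (n + h)`. -/
noncomputable def sieveWeight (h p n : ℕ) : ℝ :=
  if p ∣ n ∨ p ∣ n + h then -1 else sieveCount h p / (p - sieveCount h p)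

theorem sieveCount_pos (h p : ℕ) : 0 < sieveCount h p := by
  unfold sieveCount; split_ifs <;> norm_num

/-- Evenness of `h` is needed at `p = 2`: for odd `h` both classes would be excluded. -/
theorem sieveCount_lt {h p : ℕ} (hh : Even h) (hp : p.Prime) : sieveCount h p < p := by
  unfold sieveCount
  split_ifs with h1
  · exact_mod_cast hp.one_lt
  · have : p ≠ 2 := by rintro rfl; exact h1 hh.two_dvd
    have := hp.two_le
    exact_mod_cast (show 2 < p by omega)

theorem sieveWeight_mod (h p n : ℕ) : sieveWeight h p (n % p) = sieveWeight h p n := by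
  unfold sieveWeight
  have h1 : p ∣ n % p ↔ p ∣ n := (Nat.dvd_mod_iff dvd_rfl)
  have h2 : p ∣ n % p + h ↔ p ∣ n + h := by
    rw [Nat.dvd_iff_mod_eq_zero, Nat.dvd_iff_mod_eq_zero, Nat.mod_add_mod]
  simp only [h1, h2]

theorem card_excluded {h p : ℕ} (hp : p.Prime) :
    (((range p).filter fun n => p ∣ n ∨ p ∣ n + h).card : ℝ) = sieveCount h p := by
  have hp0 := hp.pos
  have h0 : ∀ n < p, p ∣ n → n = 0 := fun n hn hd => Nat.eq_zero_of_dvd_of_lt hd hn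
  unfold sieveCount
  split_ifs with hd
  · have : (range p).filter (fun n => p ∣ n ∨ p ∣ n + h) = {0} := by
      ext n
      simp only [mem_filter, mem_range, mem_singleton]
      constructor
      · rintro ⟨hn, h1 | h1⟩
        · exact h0 n hn h1
        · exact h0 n hn ((Nat.dvd_add_left hd).1 h1)
      · rintro rfl
        exact ⟨hp0, Or.inl (dvd_zero _)⟩
    rw [this]; simp
  · have hm : 0 < h % p := Nat.pos_of_ne_zero fun h1 => hd (Nat.dvd_of_mod_eq_zero h1)
    have hm' : h % p < p := Nat.mod_lt _ hp0
    have : (range p).filter (fun n => p ∣ n ∨ p ∣ n + h) = {0, p - h % p} := by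
      ext n
      simp only [mem_filter, mem_range, mem_singleton, mem_insert]
      have key : p ∣ n + h ↔ p ∣ n + h % p := by
        rw [Nat.dvd_iff_mod_eq_zero, Nat.dvd_iff_mod_eq_zero, Nat.add_mod_mod]
      constructor
      · rintro ⟨hn, h1 | h1⟩
        · exact Or.inl (h0 n hn h1)
        · right
          rw [key] at h1
          obtain ⟨k, hk⟩ := h1
          have : k = 1 := by
            have : 0 < k := by
              rcases Nat.eq_zero_or_pos k with rfl | h; · simp at hk; omega
              exact h
            have : k < 2 := by nlinarith
            omega
          subst this
          omega
      · rintro (rfl | rfl)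
        · exact ⟨hp0, Or.inl (dvd_zero _)⟩
        · refine ⟨by omega, Or.inr ?_⟩
          rw [key]
          rw [Nat.sub_add_cancel hm'.le]
    rw [this, card_pair (by omega)]
    norm_num

theorem sum_sieveWeight {h p : ℕ} (hh : Even h) (hp : p.Prime) :
    ∑ n ∈ range p, sieveWeight h p n = 0 := by
  have h1 := card_excluded (h := h) hp
  have h2 := card_filter_add_card_filter_not (s := range p) (fun n => p ∣ n ∨ p ∣ n + h)
  have hlt := sieveCount_lt hh hp
  have h3 : (p : ℝ) - sieveCount h p ≠ 0 := by linarith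
  simp only [sieveWeight]
  rw [sum_ite, sum_const, sum_const, nsmul_eq_mul, nsmul_eq_mul, h1]
  have h4 : (((range p).filter fun n => ¬ (p ∣ n ∨ p ∣ n + h)).card : ℝ) = p - sieveCount h p := by
    rw [card_range] at h2
    rw [← h1, eq_sub_iff_add_eq, add_comm]
    exact_mod_cast h2
  rw [h4]
  field_simp
  ring

theorem sum_sieveWeight_sq {h p : ℕ} (hh : Even h) (hp : p.Prime) :
    ∑ n ∈ range p, sieveWeight h p n ^ 2 = p * (sieveCount h p / (p - sieveCount h p)) := by
  have h1 := card_excluded (h := h) hp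
  have h2 := card_filter_add_card_filter_not (s := range p) (fun n => p ∣ n ∨ p ∣ n + h)
  have hlt := sieveCount_lt hh hp
  have h3 : (p : ℝ) - sieveCount h p ≠ 0 := by linarith
  simp only [sieveWeight, ite_pow]
  rw [sum_ite, sum_const, sum_const, nsmul_eq_mul, nsmul_eq_mul, h1]
  have h4 : (((range p).filter fun n => ¬ (p ∣ n ∨ p ∣ n + h)).card : ℝ) = p - sieveCount h p := by
    rw [card_range] at h2
    rw [← h1, eq_sub_iff_add_eq, add_comm]
    exact_mod_cast h2
  rw [h4]
  field_simp
  ring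

/-- The value `ρ/(p - ρ)` exceeds `1` only for `p = 3` and `ρ = 2`. At `p = 2` the evenness of `h`
forces `ρ = 1`. Hence a product over any set of primes is at most `2`, and a product of two such
products at most `4`. -/
theorem abs_sieveWeight_le {h p : ℕ} (hh : Even h) (hp : p.Prime) (n : ℕ) :
    |sieveWeight h p n| ≤ if p = 3 then 2 else 1 := by
  have hlt := sieveCount_lt hh hp
  have hc : sieveCount h p ≤ 2 := by unfold sieveCount; split_ifs <;> norm_num
  have hc0 := sieveCount_pos h p
  unfold sieveWeight
  split_ifs with h1 h3 h3
  · norm_num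
  · norm_num
  · subst h3
    rw [abs_of_nonneg (div_nonneg hc0.le (by linarith))]
    rw [div_le_iff₀ (by linarith)]
    push_cast
    linarith
  · rw [abs_of_nonneg (div_nonneg hc0.le (by linarith)), div_le_iff₀ (by linarith)]
    rcases eq_or_ne p 2 with rfl | h2
    · have : sieveCount h 2 = 1 := by simp [sieveCount, hh.two_dvd]
      rw [this]; norm_num
    · have : 4 ≤ p := by have := hp.two_le; omega
      have : (4 : ℝ) ≤ p := by exact_mod_cast this
      linarith

theorem abs_prod_sieveWeight_le {h : ℕ} (hh : Even h) {S : Finset ℕ} (hS : ∀ p ∈ S, p.Prime)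
    (n : ℕ) : |∏ p ∈ S, sieveWeight h p n| ≤ 2 := by
  rw [abs_prod]
  calc ∏ p ∈ S, |sieveWeight h p n| ≤ ∏ p ∈ S, (if p = 3 then (2 : ℝ) else 1) :=
        prod_le_prod (fun _ _ => abs_nonneg _) fun p hp => abs_sieveWeight_le hh (hS p hp) n
    _ ≤ 2 := by
        rw [prod_ite_eq']
        split_ifs <;> norm_num

/-- The multiplicative density `∏_{p ∣ d} ρ(p) / (p - ρ(p))`. -/
noncomputable def sieveDensity (h d : ℕ) : ℝ :=
  ∏ p ∈ d.primeFactors, sieveCount h p / (p - sieveCount h p)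

theorem sieveDensity_nonneg {h : ℕ} (hh : Even h) (d : ℕ) : 0 ≤ sieveDensity h d :=
  prod_nonneg fun p hp => div_nonneg (sieveCount_pos h p).le
    (sub_nonneg.2 (sieveCount_lt hh (Nat.prime_of_mem_primeFactors hp)).le)

theorem prod_primeFactors_le {d : ℕ} (hd : d ≠ 0) : ∏ p ∈ d.primeFactors, p ≤ d :=
  Nat.le_of_dvd (Nat.pos_of_ne_zero hd) (Nat.prod_primeFactors_dvd d)

/-- Orthogonality: a prime dividing exactly one of `d₁`, `d₂` contributes a factor of mean zero, and
a prime dividing both contributes the mean square of its weight. By the Chinese remainder theorem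
these local means multiply over a period of length at most `d₁ d₂`. -/
theorem sum_range_sieveWeight_mul_le {h : ℕ} (hh : Even h) {d₁ d₂ : ℕ} (h₁ : Squarefree d₁)
    (h₂ : Squarefree d₂) (H x : ℕ) :
    ∑ n ∈ range H, (∏ p ∈ d₁.primeFactors, sieveWeight h p (x + n)) *
        (∏ p ∈ d₂.primeFactors, sieveWeight h p (x + n)) ≤
      H * (if d₁ = d₂ then sieveDensity h d₁ else 0) + 4 * (d₁ * d₂ : ℕ) := by
  set S := d₁.primeFactors ∪ d₂.primeFactors with hSdef
  have hS : ∀ p ∈ S, p.Prime := by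
    intro p hp
    rcases mem_union.1 hp with hp | hp <;> exact Nat.prime_of_mem_primeFactors hp
  set c : ℕ → ℕ → ℝ := fun p n => (if p ∈ d₁.primeFactors then sieveWeight h p n else 1) *
    (if p ∈ d₂.primeFactors then sieveWeight h p n else 1) with hcdef
  have hc : ∀ p ∈ S, ∀ n, c p (n % p) = c p n := by
    intro p _ n
    simp only [hcdef, sieveWeight_mod]
  set L := ∏ p ∈ S, p with hLdef
  have hL : 0 < L := prod_pos fun p hp => (hS p hp).pos
  have hexp : ∀ n, (∏ p ∈ d₁.primeFactors, sieveWeight h p n) *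
      (∏ p ∈ d₂.primeFactors, sieveWeight h p n) = ∏ p ∈ S, c p n := by
    intro n
    simp only [hcdef, prod_mul_distrib, prod_ite_mem]
    rw [hSdef, inter_eq_right.2 subset_union_left, inter_eq_right.2 subset_union_right]
  have hLle : L ≤ d₁ * d₂ := by
    calc L ≤ (∏ p ∈ d₁.primeFactors, p) * ∏ p ∈ d₂.primeFactors, p := by
          rw [← prod_union_inter]
          exact Nat.le_mul_of_pos_right _ (prod_pos fun p hp =>
            (Nat.prime_of_mem_primeFactors (mem_inter.1 hp).1).pos)
      _ ≤ d₁ * d₂ := Nat.mul_le_mul (prod_primeFactors_le h₁.ne_zero)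
          (prod_primeFactors_le h₂.ne_zero)
  have hmean : ∑ n ∈ range L, ∏ p ∈ S, c p n =
      L * (if d₁ = d₂ then sieveDensity h d₁ else 0) := by
    rw [sum_range_prod_of_periodic S hS hc]
    split_ifs with hd
    · subst hd
      have hS1 : S = d₁.primeFactors := union_self _
      rw [hLdef, hS1, sieveDensity, Nat.cast_prod, ← prod_mul_distrib]
      refine prod_congr rfl fun p hp => ?_
      rw [← sum_sieveWeight_sq hh (Nat.prime_of_mem_primeFactors hp)]
      refine sum_congr rfl fun n _ => ?_
      simp only [hcdef, if_pos hp, sq]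
    · have hne : d₁.primeFactors ≠ d₂.primeFactors := fun heq => hd (by
        rw [← Nat.prod_primeFactors_of_squarefree h₁, heq,
          Nat.prod_primeFactors_of_squarefree h₂])
      rw [mul_zero]
      have : ∃ p ∈ S, (p ∈ d₁.primeFactors ∧ p ∉ d₂.primeFactors) ∨
          (p ∉ d₁.primeFactors ∧ p ∈ d₂.primeFactors) := by
        by_contra hcon
        push Not at hcon
        apply hne
        ext p
        constructor
        · intro hp; exact (hcon p (mem_union_left _ hp)).1 hp
        · intro hp
          by_contra h'
          exact (hcon p (mem_union_right _ hp)).2 h' hp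
      obtain ⟨p, hp, hp'⟩ := this
      refine prod_eq_zero hp ?_
      rw [← sum_sieveWeight hh (hS p hp)]
      refine sum_congr rfl fun n _ => ?_
      rcases hp' with ⟨ha, hb⟩ | ⟨ha, hb⟩ <;>
        simp only [hcdef, ha, hb, if_true, if_false, one_mul, mul_one]
  have hper : ∀ n, ∏ p ∈ S, c p (n % L) = ∏ p ∈ S, c p n := by
    intro n
    refine prod_congr rfl fun p hp => ?_
    rw [← hc p hp, Nat.mod_mod_of_dvd _ (dvd_prod_of_mem _ hp), hc p hp]
  have hA : ∀ n, ∏ p ∈ S, c p n ≤ 4 := by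
    intro n
    rw [← hexp]
    refine (le_abs_self _).trans ?_
    rw [abs_mul]
    have e1 := abs_prod_sieveWeight_le hh (fun p hp => Nat.prime_of_mem_primeFactors hp) n (S := d₁.primeFactors)
    have e2 := abs_prod_sieveWeight_le hh (fun p hp => Nat.prime_of_mem_primeFactors hp) n (S := d₂.primeFactors)
    nlinarith [abs_nonneg (∏ p ∈ d₁.primeFactors, sieveWeight h p n),
      abs_nonneg (∏ p ∈ d₂.primeFactors, sieveWeight h p n)]
  have hμ : (0 : ℝ) ≤ if d₁ = d₂ then sieveDensity h d₁ else 0 := by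
    split_ifs
    · exact sieveDensity_nonneg hh _
    · exact le_rfl
  simp only [hexp]
  refine (sum_range_le_of_periodic hL hper hA (by norm_num) hμ hmean H x).trans ?_
  have : (L : ℝ) ≤ ((d₁ * d₂ : ℕ) : ℝ) := by exact_mod_cast hLle
  linarith

/-- The sieve's main denominator. -/
noncomputable def sieveSum (h Q : ℕ) : ℝ :=
  ∑ d ∈ (Icc 1 Q).filter Squarefree, sieveDensity h d

theorem one_le_sieveSum {h Q : ℕ} (hh : Even h) (hQ : 1 ≤ Q) : 1 ≤ sieveSum h Q := by
  have : sieveDensity h 1 ≤ sieveSum h Q :=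
    single_le_sum (f := sieveDensity h) (fun d _ => sieveDensity_nonneg hh d)
      (by simp [hQ])
  simpa [sieveDensity] using this

/-- The number of `n` in an interval of length `H` such that neither `n` nor `n + h` has a prime
factor up to `Q`. -/
theorem card_sifted_le {h Q : ℕ} (hh : Even h) (hQ : 1 ≤ Q) (H x : ℕ) {Z : Finset ℕ}
    (hZ : Z ⊆ range H)
    (hsift : ∀ n ∈ Z, ∀ p : ℕ, p.Prime → p ≤ Q → ¬ p ∣ x + n ∧ ¬ p ∣ x + n + h) :
    (Z.card : ℝ) ≤ H / sieveSum h Q + 4 * (Q : ℝ) ^ 4 := by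
  set J := sieveSum h Q with hJ
  have hJ1 : 1 ≤ J := one_le_sieveSum hh hQ
  set D := (Icc 1 Q).filter Squarefree with hD
  -- At a sifted `n` every weight takes its value outside the excluded classes, so the sum over `d`
  -- is exactly `J`. Comparing with the second moment over the whole interval, where only the
  -- diagonal has a main term, gives `|Z| J² ≤ H J + 4 Q⁴`.
  have hval : ∀ n ∈ Z, ∑ d ∈ D, ∏ p ∈ d.primeFactors, sieveWeight h p (x + n) = J := by
    intro n hn
    refine sum_congr rfl fun d hd => prod_congr rfl fun p hp => ?_
    have hpp := Nat.prime_of_mem_primeFactors hp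
    have hd' := mem_filter.1 hd
    have hpQ : p ≤ Q := (Nat.le_of_mem_primeFactors hp).trans (mem_Icc.1 hd'.1).2
    obtain ⟨h1, h2⟩ := hsift n hn p hpp hpQ
    simp [sieveWeight, h1, h2]
  have hmain : (Z.card : ℝ) * J ^ 2 ≤ H * J + 4 * (Q : ℝ) ^ 4 := by
    calc (Z.card : ℝ) * J ^ 2
        = ∑ n ∈ Z, (∑ d ∈ D, ∏ p ∈ d.primeFactors, sieveWeight h p (x + n)) ^ 2 := by
          rw [sum_congr rfl fun n hn => by rw [hval n hn], sum_const, nsmul_eq_mul]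
      _ ≤ ∑ n ∈ range H, (∑ d ∈ D, ∏ p ∈ d.primeFactors, sieveWeight h p (x + n)) ^ 2 :=
          sum_le_sum_of_subset_of_nonneg hZ fun _ _ _ => sq_nonneg _
      _ = ∑ d₁ ∈ D, ∑ d₂ ∈ D, ∑ n ∈ range H,
            (∏ p ∈ d₁.primeFactors, sieveWeight h p (x + n)) *
            (∏ p ∈ d₂.primeFactors, sieveWeight h p (x + n)) := by
          simp_rw [sq, sum_mul_sum]
          rw [sum_comm]
          exact sum_congr rfl fun _ _ => sum_comm
      _ ≤ ∑ d₁ ∈ D, ∑ d₂ ∈ D, (H * (if d₁ = d₂ then sieveDensity h d₁ else 0) + 4 * (Q : ℝ) ^ 2) := by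
          refine sum_le_sum fun d₁ h₁ => sum_le_sum fun d₂ h₂ => ?_
          have h₁' := mem_filter.1 h₁
          have h₂' := mem_filter.1 h₂
          refine (sum_range_sieveWeight_mul_le hh h₁'.2 h₂'.2 H x).trans ?_
          have : d₁ * d₂ ≤ Q ^ 2 := by
            rw [sq]; exact Nat.mul_le_mul (mem_Icc.1 h₁'.1).2 (mem_Icc.1 h₂'.1).2
          have : ((d₁ * d₂ : ℕ) : ℝ) ≤ (Q : ℝ) ^ 2 := by exact_mod_cast this
          linarith
      _ = H * J + (D.card : ℝ) ^ 2 * (4 * (Q : ℝ) ^ 2) := by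
          simp_rw [sum_add_distrib, ← mul_sum]
          congr 1
          · congr 1
            refine sum_congr rfl fun d hd => ?_
            rw [sum_ite_eq, if_pos hd]
          · simp only [sum_const, nsmul_eq_mul]; ring
      _ ≤ H * J + 4 * (Q : ℝ) ^ 4 := by
          have : (D.card : ℝ) ≤ Q := by
            have := (card_filter_le (Icc 1 Q) Squarefree)
            rw [Nat.card_Icc] at this
            exact_mod_cast this.trans (by omega)
          have : (D.card : ℝ) ^ 2 ≤ (Q : ℝ) ^ 2 := by gcongr
          nlinarith [sq_nonneg (Q : ℝ)]
  have hJ0 : 0 < J := by linarith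
  have h1 : (Z.card : ℝ) ≤ (H * J + 4 * (Q : ℝ) ^ 4) / J ^ 2 := by
    rw [le_div_iff₀ (by positivity)]; exact hmain
  refine h1.trans ?_
  rw [add_div]
  have e1 : (H : ℝ) * J / J ^ 2 = H / J := by field_simp
  rw [e1]
  gcongr
  refine div_le_self (by positivity) ?_
  nlinarith

/-! ### A lower bound for the sieve's main denominator -/

/-- The completely multiplicative function with value `ρ(p) / p` at each prime `p`. -/
noncomputable def sieveHom (h : ℕ) : ℕ →* ℝ where
  toFun n := if n = 0 then 0 else n.factorization.prod fun p k => (sieveCount h p / p) ^ k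
  map_one' := by simp
  map_mul' m n := by
    rcases eq_or_ne m 0 with rfl | hm
    · simp
    rcases eq_or_ne n 0 with rfl | hn
    · simp
    rw [if_neg (mul_ne_zero hm hn), if_neg hm, if_neg hn, Nat.factorization_mul hm hn,
      Finsupp.prod_add_index' (by simp) (by intro a b c; rw [pow_add])]

theorem sieveHom_prime (h : ℕ) {p : ℕ} (hp : p.Prime) : sieveHom h p = sieveCount h p / p := by
  show (if p = 0 then (0 : ℝ) else _) = _
  rw [if_neg hp.ne_zero, hp.factorization, Finsupp.prod_single_index (by simp), pow_one]

theorem sieveHom_nonneg (h n : ℕ) : 0 ≤ sieveHom h n := by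
  show 0 ≤ (if n = 0 then (0 : ℝ) else _)
  split_ifs
  · exact le_rfl
  · exact prod_nonneg fun p _ => pow_nonneg (div_nonneg (sieveCount_pos h p).le (Nat.cast_nonneg _)) _

theorem sieveHom_lt_one {h p : ℕ} (hh : Even h) (hp : p.Prime) : sieveHom h p < 1 := by
  rw [sieveHom_prime h hp, div_lt_one (by exact_mod_cast hp.pos)]
  exact sieveCount_lt hh hp

theorem sieveHom_squarefree (h : ℕ) {d : ℕ} (hd : Squarefree d) :
    sieveHom h d = ∏ p ∈ d.primeFactors, sieveCount h p / p := by
  conv_lhs => rw [← Nat.prod_primeFactors_of_squarefree hd, map_prod]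
  exact prod_congr rfl fun p hp => sieveHom_prime h (Nat.prime_of_mem_primeFactors hp)

/-- Since `ρ/(p - ρ) = (ρ/p) / (1 - ρ/p)`, expanding geometric series writes the density at `d` as
the sum of `sieveHom` over all integers with radical `d`. A finite set of them gives at most that.
-/
theorem sum_sieveHom_le_sieveDensity {h d : ℕ} (hh : Even h) (hd : Squarefree d) (X : Finset ℕ)
    (hX : ∀ n ∈ X, n ≠ 0 ∧ ∏ p ∈ n.primeFactors, p = d) :
    ∑ n ∈ X, sieveHom h n ≤ sieveDensity h d := by
  have hnorm : ∀ {p : ℕ}, p.Prime → ‖sieveHom h p‖ < 1 := fun {p} hp => by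
    rw [Real.norm_of_nonneg (sieveHom_nonneg h p)]
    exact sieveHom_lt_one hh hp
  have hsum := (EulerProduct.summable_and_hasSum_factoredNumbers_prod_filter_prime_geometric hnorm
    d.primeFactors).2
  have hdens : sieveDensity h d =
      sieveHom h d * ∏ p ∈ d.primeFactors with p.Prime, (1 - sieveHom h p)⁻¹ := by
    rw [sieveHom_squarefree h hd, filter_true_of_mem fun p hp => Nat.prime_of_mem_primeFactors hp,
      ← prod_mul_distrib]
    refine prod_congr rfl fun p hp => ?_
    have hpp := Nat.prime_of_mem_primeFactors hp
    rw [sieveHom_prime h hpp]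
    have h1 : (p : ℝ) ≠ 0 := by exact_mod_cast hpp.ne_zero
    have h2 : (p : ℝ) - sieveCount h p ≠ 0 := by have := sieveCount_lt hh hpp; linarith
    field_simp
  have hdvd : ∀ n ∈ X, d ∣ n := fun n hn => by
    rw [← (hX n hn).2]; exact Nat.prod_primeFactors_dvd n
  have hmem : ∀ n ∈ X, n / d ∈ Nat.factoredNumbers d.primeFactors := fun n hn => by
    have hn0 := (hX n hn).1
    have hq : n / d ∣ n := Nat.div_dvd_of_dvd (hdvd n hn)
    refine Nat.mem_factoredNumbers_of_primeFactors_subset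
      (fun h0 => hn0 (Nat.eq_zero_of_zero_dvd (h0 ▸ hq))) ?_
    have : d.primeFactors = n.primeFactors := by
      rw [← (hX n hn).2, Nat.primeFactors_prod]
      intro p hp; exact Nat.prime_of_mem_primeFactors hp
    rw [this]
    exact Nat.primeFactors_mono hq hn0
  have hfin : ∑ n ∈ X, sieveHom h (n / d) ≤
      ∏ p ∈ d.primeFactors with p.Prime, (1 - sieveHom h p)⁻¹ := by
    classical
    have hinj : ∀ n ∈ X.attach, ∀ m ∈ X.attach,
        (⟨n.1 / d, hmem n.1 n.2⟩ : Nat.factoredNumbers d.primeFactors) = ⟨m.1 / d, hmem m.1 m.2⟩ →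
        n = m := by
      intro n _ m _ heq
      have heq' : n.1 / d = m.1 / d := congrArg Subtype.val heq
      exact Subtype.ext ((Nat.div_left_inj (hdvd n.1 n.2) (hdvd m.1 m.2)).1 heq')
    rw [← sum_attach]
    have := sum_le_hasSum (X.attach.image fun n =>
      (⟨n.1 / d, hmem n.1 n.2⟩ : Nat.factoredNumbers d.primeFactors))
      (fun i _ => sieveHom_nonneg h i.1) hsum
    rwa [sum_image hinj] at this
  rw [hdens]
  calc ∑ n ∈ X, sieveHom h n = sieveHom h d * ∑ n ∈ X, sieveHom h (n / d) := by
        rw [mul_sum]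
        refine sum_congr rfl fun n hn => ?_
        rw [← map_mul, Nat.mul_div_cancel' (hdvd n hn)]
    _ ≤ _ := mul_le_mul_of_nonneg_left hfin (sieveHom_nonneg h d)

/-- The integers up to `Q` are grouped by radical, which is squarefree and again at most `Q`. -/
theorem sum_sieveHom_le_sieveSum {h : ℕ} (hh : Even h) (Q : ℕ) :
    ∑ n ∈ Icc 1 Q, sieveHom h n ≤ sieveSum h Q := by
  have hmaps : ∀ n ∈ Icc 1 Q, ∏ p ∈ n.primeFactors, p ∈ (Icc 1 Q).filter Squarefree := by
    intro n hn
    have hn' := mem_Icc.1 hn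
    rw [mem_filter, mem_Icc]
    refine ⟨⟨prod_pos fun p hp => (Nat.prime_of_mem_primeFactors hp).pos,
      (prod_primeFactors_le (by omega)).trans hn'.2⟩, ?_⟩
    refine Finset.squarefree_prod_of_pairwise_isCoprime ?_
      fun p hp => (Nat.prime_of_mem_primeFactors hp).squarefree
    intro p hp q hq hpq
    exact Nat.coprime_iff_isRelPrime.1 ((Nat.coprime_primes (Nat.prime_of_mem_primeFactors hp)
      (Nat.prime_of_mem_primeFactors hq)).2 hpq)
  rw [← sum_fiberwise_of_maps_to hmaps]
  refine sum_le_sum fun d hd => sum_sieveHom_le_sieveDensity hh (mem_filter.1 hd).2 _ ?_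
  intro n hn
  have := mem_filter.1 hn
  exact ⟨by have := mem_Icc.1 this.1; omega, this.2⟩

/-- Passing from `m` to `p m` multiplies the count by at most `ρ(p)`: a new divisor either divides
`m` or is `p` times a divisor of `m`, and the second kind is impossible when `p ∣ h`. -/
theorem card_coprime_divisors_le (h : ℕ) {n : ℕ} (hn : n ≠ 0) :
    ((n.divisors.filter (Nat.Coprime · h)).card : ℝ) ≤ n * sieveHom h n := by
  induction n using induction_on_primes with
  | zero => exact absurd rfl hn
  | one =>
    rw [map_one, Nat.divisors_one]
    have := card_filter_le ({1} : Finset ℕ) (Nat.Coprime · h)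
    rw [card_singleton] at this
    simpa using (by exact_mod_cast this : ((filter (Nat.Coprime · h) {1}).card : ℝ) ≤ 1)
  | prime_mul p m hp ih =>
    have hm : m ≠ 0 := right_ne_zero_of_mul hn
    have ih' := ih hm
    have hp0 : (p : ℝ) ≠ 0 := by exact_mod_cast hp.ne_zero
    set D := m.divisors.filter (Nat.Coprime · h) with hD
    have key : (((p * m).divisors.filter (Nat.Coprime · h)).card : ℝ) ≤ sieveCount h p * D.card := by
      unfold sieveCount
      split_ifs with hd
      · rw [one_mul]
        norm_cast
        refine card_le_card fun b hb => ?_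
        simp only [mem_filter, Nat.mem_divisors, hD] at hb ⊢
        refine ⟨⟨?_, hm⟩, hb.2⟩
        have hc : Nat.Coprime b p := Nat.Coprime.coprime_dvd_right hd hb.2
        exact hc.dvd_of_dvd_mul_left hb.1.1
      · have hsub : (p * m).divisors.filter (Nat.Coprime · h) ⊆ D ∪ D.image (p * ·) := by
          intro b hb
          simp only [mem_filter, Nat.mem_divisors, hD, mem_union, mem_image] at hb ⊢
          by_cases hpb : p ∣ b
          · obtain ⟨b', rfl⟩ := hpb
            right
            exact ⟨b', ⟨⟨(Nat.mul_dvd_mul_iff_left hp.pos).1 hb.1.1, hm⟩,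
              Nat.Coprime.coprime_mul_left hb.2⟩, rfl⟩
          · left
            exact ⟨⟨((Nat.Prime.coprime_iff_not_dvd hp).2 hpb).symm.dvd_of_dvd_mul_left hb.1.1, hm⟩,
              hb.2⟩
        have h1 := (card_le_card hsub).trans (card_union_le _ _)
        have h2 := card_image_le (s := D) (f := (p * ·))
        have : ((p * m).divisors.filter (Nat.Coprime · h)).card ≤ 2 * D.card := by omega
        exact_mod_cast this
    refine key.trans ?_
    rw [map_mul, sieveHom_prime h hp, Nat.cast_mul]
    calc sieveCount h p * D.card ≤ sieveCount h p * (m * sieveHom h m) :=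
          mul_le_mul_of_nonneg_left ih' (sieveCount_pos h p).le
      _ = _ := by field_simp

/-- When the product is expanded, `1/n` occurs once for each admissible factorisation `n = ab`,
hence at most once per divisor `b` of `n` coprime to `h`. -/
theorem harmonic_mul_coprime_harmonic_le (h r : ℕ) :
    (∑ a ∈ Icc 1 r, (1 : ℝ) / a) * ∑ b ∈ (Icc 1 r).filter (Nat.Coprime · h), (1 : ℝ) / b ≤
      ∑ n ∈ Icc 1 (r * r), sieveHom h n := by
  rw [sum_mul_sum, ← sum_product']
  have hmaps : ∀ x ∈ Icc 1 r ×ˢ (Icc 1 r).filter (Nat.Coprime · h), x.1 * x.2 ∈ Icc 1 (r * r) := by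
    intro x hx
    simp only [mem_product, mem_filter, mem_Icc] at hx
    rw [mem_Icc]
    exact ⟨Nat.mul_pos hx.1.1 hx.2.1.1, Nat.mul_le_mul hx.1.2 hx.2.1.2⟩
  rw [← sum_fiberwise_of_maps_to hmaps]
  refine sum_le_sum fun n hn => ?_
  have hn0 : n ≠ 0 := by have := mem_Icc.1 hn; omega
  have hn0' : (0 : ℝ) < n := by exact_mod_cast Nat.pos_of_ne_zero hn0
  set X := (Icc 1 r ×ˢ (Icc 1 r).filter (Nat.Coprime · h)).filter (fun x => x.1 * x.2 = n) with hX
  have hcard : X.card ≤ (n.divisors.filter (Nat.Coprime · h)).card := by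
    refine card_le_card_of_injOn Prod.snd ?_ ?_
    · intro x hx
      simp only [hX, coe_filter, mem_product, mem_filter, Set.mem_ofPred_eq, Nat.mem_divisors] at hx ⊢
      exact ⟨⟨Dvd.intro_left _ hx.2, hn0⟩, hx.1.2.2⟩
    · intro x hx y hy hxy
      simp only [hX, coe_filter, mem_product, mem_filter, Set.mem_ofPred_eq, mem_Icc] at hx hy
      have h1 : x.1 * x.2 = y.1 * x.2 := by rw [hx.2, hxy, hy.2]
      exact Prod.ext (Nat.eq_of_mul_eq_mul_right hx.1.2.1.1 h1) hxy
  calc ∑ x ∈ X, (1 : ℝ) / x.1 * (1 / x.2) = ∑ x ∈ X, (1 : ℝ) / n := by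
        refine sum_congr rfl fun x hx => ?_
        have := (mem_filter.1 hx).2
        rw [← this]; push_cast; rw [div_mul_div_comm, one_mul]
    _ = X.card / n := by rw [sum_const, nsmul_eq_mul, mul_one_div]
    _ ≤ (n * sieveHom h n) / n := by
        gcongr
        exact le_trans (by exact_mod_cast hcard) (card_coprime_divisors_le h hn0)
    _ = sieveHom h n := by field_simp

/-- `∑_{e ∣ h} 1 / e`. -/
noncomputable def sigmaInv (h : ℕ) : ℝ := ∑ e ∈ h.divisors, (1 : ℝ) / e

theorem sigmaInv_nonneg (h : ℕ) : 0 ≤ sigmaInv h := sum_nonneg fun _ _ => by positivity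

theorem sum_one_div_sq_le_two (n : ℕ) : ∑ k ∈ Icc 1 n, (1 : ℝ) / (k : ℝ) ^ 2 ≤ 2 := by
  have h := sum_Ioo_inv_sq_le (α := ℝ) 0 (n + 1)
  have h2 : Ioo 0 (n + 1) = Icc 1 n := by ext; simp only [mem_Ioo, mem_Icc]; omega
  rw [h2] at h
  simpa [one_div] using h

/-- Every `n` is `b e k²` with `b` coprime to `h` and `e ∣ h`. -/
theorem exists_coprime_mul_divisor_mul_sq (h : ℕ) {n : ℕ} (hn : n ≠ 0) :
    ∃ b e k : ℕ, n = b * e * k ^ 2 ∧ b.Coprime h ∧ e ∣ h := by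
  induction n using induction_on_primes with
  | zero => exact absurd rfl hn
  | one => exact ⟨1, 1, 1, by simp, Nat.coprime_one_left h, one_dvd h⟩
  | prime_mul p m hp ih =>
    obtain ⟨b, e, k, hm, hb, he⟩ := ih (right_ne_zero_of_mul hn)
    by_cases hph : p ∣ h
    · by_cases hpe : p ∣ e
      · obtain ⟨e', rfl⟩ := hpe
        exact ⟨b, e', p * k, by rw [hm]; ring, hb, (Dvd.intro_left p rfl).trans he⟩
      · refine ⟨b, p * e, k, by rw [hm]; ring, hb, ?_⟩
        exact Nat.Coprime.mul_dvd_of_dvd_of_dvd ((Nat.Prime.coprime_iff_not_dvd hp).2 hpe) hph he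
    · exact ⟨p * b, e, k, by rw [hm]; ring,
        Nat.Coprime.mul_left ((Nat.Prime.coprime_iff_not_dvd hp).2 hph) hb, he⟩

/-- Writing each integer as `b e k²` with `b` coprime to `h` and `e ∣ h` bounds the harmonic sum by
a product of three sums. The one over `k` is at most `2`. -/
theorem harmonic_le_coprime_harmonic {h : ℕ} (hh : h ≠ 0) (r : ℕ) :
    ∑ a ∈ Icc 1 r, (1 : ℝ) / a ≤
      (∑ b ∈ (Icc 1 r).filter (Nat.Coprime · h), (1 : ℝ) / b) * (2 * sigmaInv h) := by
  set Bs := (Icc 1 r).filter (Nat.Coprime · h) with hBs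
  have hbig : ∑ a ∈ Icc 1 r, (1 : ℝ) / a ≤
      ∑ x ∈ Bs ×ˢ h.divisors ×ˢ Icc 1 r, (1 : ℝ) / (x.1 * x.2.1 * x.2.2 ^ 2 : ℕ) := by
    have : Icc 1 r ⊆ (Bs ×ˢ h.divisors ×ˢ Icc 1 r).image fun x => x.1 * x.2.1 * x.2.2 ^ 2 := by
      intro n hn
      have hn' := mem_Icc.1 hn
      obtain ⟨b, e, k, hbek, hb, he⟩ := exists_coprime_mul_divisor_mul_sq h (n := n) (by omega)
      rw [mem_image]
      refine ⟨(b, e, k), ?_, hbek.symm⟩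
      have hn0 : 0 < b * e * k ^ 2 := by omega
      have hb0 : b ≠ 0 := by rintro rfl; simp at hn0
      have hk0 : k ≠ 0 := by rintro rfl; simp at hn0
      have hbn : b ∣ n := hbek ▸ (Dvd.intro _ rfl : b ∣ b * e).mul_right _
      have hkn : k ∣ n := hbek ▸ Dvd.dvd.mul_left (Dvd.intro_left k (by ring)) _
      have h1 := Nat.le_of_dvd (by omega) hbn
      have h2 := Nat.le_of_dvd (by omega) hkn
      simp only [mem_product, hBs, mem_filter, mem_Icc, Nat.mem_divisors]
      exact ⟨⟨⟨by omega, by omega⟩, hb⟩, ⟨he, hh⟩, by omega, by omega⟩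
    refine (sum_le_sum_of_subset_of_nonneg this fun _ _ _ => by positivity).trans ?_
    exact sum_image_le_of_nonneg (g := fun x : ℕ × ℕ × ℕ => x.1 * x.2.1 * x.2.2 ^ 2)
      (f := fun n : ℕ => (1 : ℝ) / n) (fun _ _ => by positivity)
  refine hbig.trans ?_
  have hfac : ∑ x ∈ Bs ×ˢ h.divisors ×ˢ Icc 1 r, (1 : ℝ) / (x.1 * x.2.1 * x.2.2 ^ 2 : ℕ) =
      (∑ b ∈ Bs, (1 : ℝ) / b) * (sigmaInv h * ∑ k ∈ Icc 1 r, (1 : ℝ) / (k : ℝ) ^ 2) := by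
    rw [sigmaInv, sum_mul_sum, ← sum_product', sum_mul_sum, ← sum_product']
    refine sum_congr rfl fun x _ => ?_
    push_cast
    rw [div_mul_div_comm, div_mul_div_comm]
    congr 1 <;> ring
  rw [hfac]
  have h0 : (0 : ℝ) ≤ ∑ b ∈ Bs, (1 : ℝ) / b := sum_nonneg fun _ _ => by positivity
  refine mul_le_mul_of_nonneg_left ?_ h0
  have := sum_one_div_sq_le_two r
  nlinarith [sigmaInv_nonneg h]

theorem log_le_sum_one_div (r : ℕ) : Real.log r ≤ ∑ a ∈ Icc 1 r, (1 : ℝ) / a := by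
  have h1 := log_add_one_le_harmonic r
  rw [harmonic_eq_sum_Icc] at h1
  push_cast at h1
  simp only [one_div]
  refine le_trans ?_ h1
  rcases Nat.eq_zero_or_pos r with rfl | h
  · simp
  · exact Real.log_le_log (by exact_mod_cast h) (by linarith)

theorem log_sq_le_sieveSum {h : ℕ} (hh : Even h) (h0 : h ≠ 0) (r : ℕ) :
    Real.log r ^ 2 ≤ 2 * sigmaInv h * sieveSum h (r * r) := by
  set A := ∑ a ∈ Icc 1 r, (1 : ℝ) / a
  set C := ∑ b ∈ (Icc 1 r).filter (Nat.Coprime · h), (1 : ℝ) / b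
  have h1 : A * C ≤ sieveSum h (r * r) :=
    (harmonic_mul_coprime_harmonic_le h r).trans (sum_sieveHom_le_sieveSum hh _)
  have h2 : A ≤ C * (2 * sigmaInv h) := harmonic_le_coprime_harmonic h0 r
  have h3 : Real.log r ≤ A := log_le_sum_one_div r
  have h4 : 0 ≤ Real.log r := Real.log_natCast_nonneg r
  have h5 := sigmaInv_nonneg h
  calc Real.log r ^ 2 ≤ A ^ 2 := by gcongr
    _ = A * A := sq A
    _ ≤ A * (C * (2 * sigmaInv h)) := mul_le_mul_of_nonneg_left h2 (h4.trans h3)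
    _ = 2 * sigmaInv h * (A * C) := by ring
    _ ≤ _ := mul_le_mul_of_nonneg_left h1 (by positivity)

/-- The inequality fails at `a = 12`; this is the source of the condition `130 ≤ j` on dyadic
blocks. -/
theorem sq_le_four_pow {a : ℕ} (ha : 13 ≤ a) : 102400 * (a + 1) ^ 2 ≤ 4 ^ a := by
  induction a, ha using Nat.le_induction with
  | base => norm_num
  | succ n hn ih => rw [pow_succ 4]; nlinarith

theorem one_le_sigmaInv {h : ℕ} (h0 : h ≠ 0) : 1 ≤ sigmaInv h := by
  have : (1 : ℝ) / (1 : ℕ) ≤ sigmaInv h :=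
    single_le_sum (f := fun e : ℕ => (1 : ℝ) / e) (fun _ _ => by positivity)
      (Nat.one_mem_divisors.2 h0)
  simpa using this

/-- The sifting level `r²` with `r = 2^(j/10 + 1)` has fourth power about `2^(4j/5)`, so a power of
`2^j` is left to absorb the logarithms. -/
theorem sieve_error_le {j : ℕ} (hj : 130 ≤ j) :
    4 * (((2 ^ (j / 10 + 1) * 2 ^ (j / 10 + 1) : ℕ) : ℝ)) ^ 4 ≤
      (2 : ℝ) ^ j / Real.log ((2 : ℝ) ^ j) ^ 2 := by
  have hlog : Real.log ((2 : ℝ) ^ j) = j * Real.log 2 := Real.log_pow _ _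
  have hl2 : 0 < Real.log 2 := Real.log_pos (by norm_num)
  have hl2' : Real.log 2 ≤ 1 := by have := Real.log_two_lt_d9; linarith
  have hj0 : (0 : ℝ) < j := by exact_mod_cast (by omega : 0 < j)
  rw [hlog, le_div_iff₀ (by positivity)]
  set a := j / 10 with ha
  have hja : 10 * a ≤ j := Nat.mul_div_le j 10
  have hja' : j ≤ 10 * (a + 1) := by omega
  have key := sq_le_four_pow (a := a) (by omega)
  have e1 : (j : ℝ) * Real.log 2 ≤ 10 * (a + 1) := by
    calc (j : ℝ) * Real.log 2 ≤ j * 1 := by gcongr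
      _ = j := mul_one _
      _ ≤ _ := by exact_mod_cast hja'
  have key' : (102400 : ℝ) * (a + 1) ^ 2 ≤ 4 ^ a := by exact_mod_cast key
  calc 4 * (((2 ^ (a + 1) * 2 ^ (a + 1) : ℕ) : ℝ)) ^ 4 * (j * Real.log 2) ^ 2
      ≤ 4 * (((2 ^ (a + 1) * 2 ^ (a + 1) : ℕ) : ℝ)) ^ 4 * (10 * (a + 1)) ^ 2 := by gcongr
    _ = (102400 * ((a : ℝ) + 1) ^ 2) * (2 ^ a) ^ 8 := by push_cast; ring
    _ ≤ 4 ^ a * (2 ^ a) ^ 8 := by gcongr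
    _ = 2 ^ (10 * a) := by
        rw [show (4 : ℝ) = 2 ^ 2 by norm_num, ← pow_mul, ← pow_mul, ← pow_add]; congr 1; ring
    _ ≤ 2 ^ j := pow_le_pow_right₀ (by norm_num) hja

/-- Upper bound for the number of prime pairs `p, p + h` with `p` in a dyadic interval. -/
theorem card_prime_pairs_le {j : ℕ} (hj : 130 ≤ j) {h : ℕ} (h0 : h ≠ 0) :
    (((Ioc (2 ^ j) (2 * 2 ^ j)).filter fun p => p.Prime ∧ (p + h).Prime).card : ℝ) ≤
      201 * sigmaInv h * ((2 : ℝ) ^ j / Real.log ((2 : ℝ) ^ j) ^ 2) := by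
  set P := 2 ^ j with hP
  have hσ := one_le_sigmaInv h0
  have hP2 : 2 ≤ P := by
    calc 2 = 2 ^ 1 := rfl
      _ ≤ 2 ^ j := Nat.pow_le_pow_right (by norm_num) (by omega)
  set Y := (2 : ℝ) ^ j / Real.log ((2 : ℝ) ^ j) ^ 2 with hY
  have hY0 : 0 ≤ Y := by positivity
  rcases Nat.even_or_odd h with hh | hh
  · set a := j / 10 with ha
    set r := 2 ^ (a + 1) with hr
    set Z := (range P).filter fun n => (P + 1 + n).Prime ∧ (P + 1 + n + h).Prime with hZ
    have hcard : ((Ioc P (2 * P)).filter fun p => p.Prime ∧ (p + h).Prime).card ≤ Z.card := by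
      refine card_le_card_of_injOn (fun p => p - (P + 1)) ?_ ?_
      · intro p hp
        simp only [coe_filter, mem_Ioc, Set.mem_ofPred_eq, hZ, mem_range] at hp ⊢
        have : P + 1 + (p - (P + 1)) = p := by omega
        rw [this]
        exact ⟨by omega, hp.2⟩
      · intro p hp q hq hpq
        simp only [coe_filter, mem_Ioc, Set.mem_ofPred_eq] at hp hq hpq
        omega
    have hrP : r * r ≤ P := by
      rw [hr, hP, ← pow_add]
      exact Nat.pow_le_pow_right (by norm_num) (by omega)
    have hr1 : 1 ≤ r * r := Nat.mul_pos (by positivity) (by positivity)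
    have hbound := card_sifted_le hh hr1 P (P + 1) (filter_subset _ _ : Z ⊆ range P) (by
      intro n hn p hp hpQ
      have hn' := (mem_filter.1 hn).2
      constructor
      · intro hd
        have := (Nat.prime_dvd_prime_iff_eq hp hn'.1).1 hd
        omega
      · intro hd
        have := (Nat.prime_dvd_prime_iff_eq hp hn'.2).1 hd
        omega)
    have hJ := log_sq_le_sieveSum hh h0 r
    have hJ1 := one_le_sieveSum hh hr1
    set J := sieveSum h (r * r)
    have herr := sieve_error_le hj
    have hl2 : 0 < Real.log 2 := Real.log_pos (by norm_num)
    have hj0 : (0 : ℝ) < j := by exact_mod_cast (by omega : 0 < j)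
    have hlogP : Real.log ((2 : ℝ) ^ j) = j * Real.log 2 := Real.log_pow _ _
    have hlogr : (j * Real.log 2) / 10 ≤ Real.log r := by
      rw [hr]; push_cast; rw [Real.log_pow]
      have : (j : ℝ) ≤ 10 * ((a + 1 : ℕ) : ℝ) := by exact_mod_cast (by omega : j ≤ 10 * (a + 1))
      nlinarith
    -- From `log r ≥ (log P)/10` and `log² r ≤ 2 σ J` one gets `J ≥ log² P / (200 σ)`. The sieve
    -- error adds one more `Y ≤ σ Y`, whence the constant `201`.
    have hmain : (P : ℝ) / J ≤ 200 * sigmaInv h * Y := by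
      rw [div_le_iff₀ (by linarith), hY, hlogP]
      have hsq : ((j * Real.log 2) / 10) ^ 2 ≤ 2 * sigmaInv h * J :=
        le_trans (by gcongr) hJ
      have hlpos : 0 < (j * Real.log 2) ^ 2 := by positivity
      have h2j : (P : ℝ) = 2 ^ j := by rw [hP]; push_cast; rfl
      rw [h2j]
      calc (2 : ℝ) ^ j = (100 * ((j * Real.log 2) / 10) ^ 2) * (2 ^ j / (j * Real.log 2) ^ 2) := by
            field_simp; norm_num
        _ ≤ (100 * (2 * sigmaInv h * J)) * (2 ^ j / (j * Real.log 2) ^ 2) := by gcongr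
        _ = _ := by ring
    calc (((Ioc P (2 * P)).filter fun p => p.Prime ∧ (p + h).Prime).card : ℝ) ≤ Z.card := by
          exact_mod_cast hcard
      _ ≤ 200 * sigmaInv h * Y + Y := hbound.trans (add_le_add hmain herr)
      _ ≤ 201 * sigmaInv h * Y := by nlinarith
  -- For odd `h` one of `p`, `p + h` is even, and both exceed `2`.
  · have : (Ioc P (2 * P)).filter (fun p => p.Prime ∧ (p + h).Prime) = ∅ := by
      rw [filter_eq_empty_iff]
      rintro p hp ⟨h1, h2⟩
      have hp' := mem_Ioc.1 hp
      have o1 := h1.odd_of_ne_two (by omega)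
      have o2 := h2.odd_of_ne_two (by omega)
      exact (Nat.not_even_iff_odd.2 o2) (o1.add_odd hh)
    rw [this, card_empty, Nat.cast_zero]
    positivity

/-! ### Smoothed Dirichlet kernels -/

/-- `∑_{|m| ≤ H} u_{|m|} e^{imx}`. -/
noncomputable def cosKernel (u : ℕ → ℝ) (H : ℕ) (x : ℝ) : ℝ :=
  u 0 + 2 * ∑ m ∈ range H, u (m + 1) * Real.cos ((m + 1 : ℕ) * x)

/-- Summation by parts based on `2 sin(x/2) cos(mx) = sin((m + 1/2)x) - sin((m - 1/2)x)`. -/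
theorem sin_mul_cosKernel (u : ℕ → ℝ) (H : ℕ) (x : ℝ) :
    Real.sin (x / 2) * cosKernel u H x =
      ∑ m ∈ range (H + 1), (u m - u (m + 1)) * Real.sin ((m + 1 / 2) * x) +
        u (H + 1) * Real.sin ((H + 1 / 2) * x) := by
  induction H with
  | zero =>
    simp only [cosKernel, range_zero, sum_empty, zero_add, range_one, sum_singleton, Nat.cast_zero]
    rw [show (1 / 2 : ℝ) * x = x / 2 by ring]
    ring
  | succ H ih =>
    have hK : cosKernel u (H + 1) x =
        cosKernel u H x + 2 * (u (H + 1) * Real.cos ((H + 1 : ℕ) * x)) := by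
      simp only [cosKernel, sum_range_succ _ H]; ring
    have h1 : Real.sin (((H + 1 : ℕ) + 1 / 2) * x) =
        Real.sin ((H + 1 : ℕ) * x) * Real.cos (x / 2) +
          Real.cos ((H + 1 : ℕ) * x) * Real.sin (x / 2) := by
      rw [← Real.sin_add]; congr 1; ring
    have h2 : Real.sin ((H + 1 / 2) * x) =
        Real.sin ((H + 1 : ℕ) * x) * Real.cos (x / 2) -
          Real.cos ((H + 1 : ℕ) * x) * Real.sin (x / 2) := by
      rw [← Real.sin_sub]; congr 1; push_cast; ring
    rw [hK, mul_add, ih, sum_range_succ _ (H + 1), h1, h2]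
    ring

/-- A second summation by parts: multiplication by `1 - cos x` turns the coefficients into their
second differences, which are small in total for a smoothed cutoff. -/
theorem sin_sq_mul_cosKernel (u : ℕ → ℝ) (H : ℕ) (x : ℝ) :
    2 * Real.sin (x / 2) ^ 2 * cosKernel u H x =
      (u 0 - u 1) - ∑ m ∈ range H, (u m - 2 * u (m + 1) + u (m + 2)) * Real.cos ((m + 1 : ℕ) * x) +
        (u (H + 1) * Real.cos (H * x) - u H * Real.cos ((H + 1 : ℕ) * x)) := by
  have hs : 2 * Real.sin (x / 2) ^ 2 = 1 - Real.cos x := by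
    have := Real.cos_sq' (x / 2)
    have h2 := Real.cos_two_mul (x / 2)
    rw [show 2 * (x / 2) = x by ring] at h2
    linarith
  rw [hs]
  induction H with
  | zero => simp [cosKernel]; ring
  | succ H ih =>
    have hK : cosKernel u (H + 1) x =
        cosKernel u H x + 2 * (u (H + 1) * Real.cos ((H + 1 : ℕ) * x)) := by
      simp only [cosKernel, sum_range_succ _ H]; ring
    have h1 : Real.cos ((H + 1 + 1 : ℕ) * x) =
        Real.cos ((H + 1 : ℕ) * x) * Real.cos x - Real.sin ((H + 1 : ℕ) * x) * Real.sin x := by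
      rw [← Real.cos_add]; congr 1; push_cast; ring
    have h2 : Real.cos (H * x) =
        Real.cos ((H + 1 : ℕ) * x) * Real.cos x + Real.sin ((H + 1 : ℕ) * x) * Real.sin x := by
      rw [← Real.cos_sub]; congr 1; push_cast; ring
    rw [hK, mul_add, ih, sum_range_succ _ H, h1, h2]
    ring

theorem abs_cosKernel_mul_sin_le {u : ℕ → ℝ} (hu : Antitone u) {H : ℕ} (hH : u (H + 1) = 0)
    (x : ℝ) : |cosKernel u H x| * |Real.sin (x / 2)| ≤ u 0 := by
  rw [← abs_mul, mul_comm, sin_mul_cosKernel, hH, zero_mul, add_zero]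
  calc |∑ m ∈ range (H + 1), (u m - u (m + 1)) * Real.sin ((m + 1 / 2) * x)|
      ≤ ∑ m ∈ range (H + 1), |(u m - u (m + 1)) * Real.sin ((m + 1 / 2) * x)| :=
        abs_sum_le_sum_abs _ _
    _ ≤ ∑ m ∈ range (H + 1), (u m - u (m + 1)) := by
        refine sum_le_sum fun m _ => ?_
        have h0 : 0 ≤ u m - u (m + 1) := sub_nonneg.2 (hu (Nat.le_succ m))
        rw [abs_mul, abs_of_nonneg h0]
        exact mul_le_of_le_one_right h0 (Real.abs_sin_le_one _)
    _ = u 0 := by rw [sum_range_sub', hH, sub_zero]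

theorem abs_cosKernel_mul_sin_sq_le {u : ℕ → ℝ} {H : ℕ} (hH : u H = 0) (hH' : u (H + 1) = 0)
    (x : ℝ) : 2 * (|cosKernel u H x| * Real.sin (x / 2) ^ 2) ≤
      |u 0 - u 1| + ∑ m ∈ range H, |u m - 2 * u (m + 1) + u (m + 2)| := by
  have h := sin_sq_mul_cosKernel u H x
  rw [hH, hH', zero_mul, zero_mul, sub_zero, add_zero] at h
  have h2 : 2 * (|cosKernel u H x| * Real.sin (x / 2) ^ 2) =
      |2 * Real.sin (x / 2) ^ 2 * cosKernel u H x| := by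
    rw [abs_mul, abs_of_nonneg (by positivity : 0 ≤ 2 * Real.sin (x / 2) ^ 2)]; ring
  rw [h2, h]
  refine (abs_sub _ _).trans (add_le_add le_rfl ((abs_sum_le_sum_abs _ _).trans ?_))
  refine sum_le_sum fun m _ => ?_
  rw [abs_mul]
  exact mul_le_of_le_one_right (abs_nonneg _) (Real.abs_cos_le_one _)

theorem abs_cosKernel_le {u : ℕ → ℝ} (h0 : ∀ m, 0 ≤ u m) (h1 : ∀ m, u m ≤ 1) (H : ℕ) (x : ℝ) :
    |cosKernel u H x| ≤ 1 + 2 * H := by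
  unfold cosKernel
  refine (abs_add_le _ _).trans (add_le_add ?_ ?_)
  · rw [abs_of_nonneg (h0 0)]; exact h1 0
  · rw [abs_mul, abs_of_pos (by norm_num : (0 : ℝ) < 2)]
    gcongr
    refine (abs_sum_le_sum_abs _ _).trans ?_
    calc ∑ m ∈ range H, |u (m + 1) * Real.cos ((m + 1 : ℕ) * x)| ≤ ∑ m ∈ range H, (1 : ℝ) := by
          refine sum_le_sum fun m _ => ?_
          rw [abs_mul, abs_of_nonneg (h0 _)]
          exact mul_le_one₀ (h1 _) (abs_nonneg _) (Real.abs_cos_le_one _)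
      _ = H := by simp

/-- The ramp equal to `1` up to `X - w` and to `0` from `X` on. -/
noncomputable def ramp (X w x : ℝ) : ℝ := max 0 (min 1 ((X - x) / w))

theorem ramp_nonneg (X w x : ℝ) : 0 ≤ ramp X w x := le_max_left _ _

theorem ramp_le_one (X w x : ℝ) : ramp X w x ≤ 1 := max_le zero_le_one (min_le_left _ _)

theorem ramp_antitone (X : ℝ) {w : ℝ} (hw : 0 < w) : Antitone (ramp X w) := by
  intro x y hxy
  unfold ramp
  gcongr

theorem ramp_eq_zero {X w x : ℝ} (hw : 0 < w) (hx : X ≤ x) : ramp X w x = 0 := by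
  unfold ramp
  refine max_eq_left ((min_le_right _ _).trans ?_)
  exact div_nonpos_of_nonpos_of_nonneg (by linarith) hw.le

theorem ramp_eq_one {X w x : ℝ} (hw : 0 < w) (hx : x ≤ X - w) : ramp X w x = 1 := by
  unfold ramp
  have : 1 ≤ (X - x) / w := by rw [le_div_iff₀ hw]; linarith
  rw [min_eq_left this]
  norm_num

/-- As a difference of two convex hinge functions, the ramp inherits bounds on second differences
from the convex case. -/
theorem ramp_eq_sub (X : ℝ) {w : ℝ} (hw : 0 < w) (x : ℝ) :
    ramp X w x = (max (X - x) 0 - max (X - w - x) 0) / w := by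
  rcases le_total x (X - w) with h | h
  · rw [ramp_eq_one hw h, max_eq_left (by linarith), max_eq_left (by linarith)]
    field_simp; ring
  rcases le_total X x with h2 | h2
  · rw [ramp_eq_zero hw h2, max_eq_right (by linarith), max_eq_right (by linarith)]
    simp
  · rw [max_eq_left (by linarith : 0 ≤ X - x), max_eq_right (by linarith), sub_zero]
    unfold ramp
    rw [min_eq_right (by rw [div_le_one hw]; linarith),
      max_eq_right (div_nonneg (by linarith) hw.le)]

/-- By convexity the second differences are nonnegative, so their absolute values telescope to the
total change of slope. -/
theorem sum_abs_second_diff_pos_part_le (X : ℝ) {s : ℝ} (hs : 0 ≤ s) (H : ℕ) :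
    ∑ m ∈ range H, |max (X - (m : ℕ) * s) 0 - 2 * max (X - (m + 1 : ℕ) * s) 0 +
      max (X - (m + 2 : ℕ) * s) 0| ≤ s := by
  set g : ℕ → ℝ := fun m => max (X - m * s) 0 with hg
  have hconv : ∀ m, 0 ≤ g m - 2 * g (m + 1) + g (m + 2) := by
    intro m
    simp only [hg]
    push_cast
    rcases le_total 0 (X - (m + 1) * s) with h | h
    · rw [max_eq_left h]
      have := le_max_left (X - (m : ℝ) * s) 0
      have := le_max_left (X - ((m : ℝ) + 2) * s) 0
      linarith
    · rw [max_eq_right h]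
      have := le_max_right (X - (m : ℝ) * s) 0
      have := le_max_right (X - ((m : ℝ) + 2) * s) 0
      linarith
  have hmono : ∀ m, 0 ≤ g m - g (m + 1) := by
    intro m
    rw [sub_nonneg]
    simp only [hg]; push_cast
    gcongr
    linarith
  have h0 : g 0 - g 1 ≤ s := by
    simp only [hg]; push_cast
    rcases le_total 0 X with h | h
    · have := le_max_left (X - 1 * s) 0
      rw [max_eq_left (by linarith : 0 ≤ X - 0 * s)]; linarith
    · have := le_max_right (X - 1 * s) 0
      rw [max_eq_right (by linarith : X - 0 * s ≤ 0)]; linarith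
  calc ∑ m ∈ range H, |g m - 2 * g (m + 1) + g (m + 2)|
      = ∑ m ∈ range H, ((g m - g (m + 1)) - (g (m + 1) - g (m + 1 + 1))) := by
        refine sum_congr rfl fun m _ => ?_
        rw [abs_of_nonneg (hconv m)]; ring_nf
    _ = (g 0 - g 1) - (g H - g (H + 1)) := sum_range_sub' (fun m => g m - g (m + 1)) H
    _ ≤ s := by have := hmono H; linarith

theorem sum_abs_second_diff_ramp_le (X : ℝ) {w s : ℝ} (hw : 0 < w) (hs : 0 ≤ s) (H : ℕ) :
    ∑ m ∈ range H, |ramp X w ((m : ℕ) * s) - 2 * ramp X w ((m + 1 : ℕ) * s) +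
      ramp X w ((m + 2 : ℕ) * s)| ≤ 2 * s / w := by
  have h1 := sum_abs_second_diff_pos_part_le X hs H
  have h2 := sum_abs_second_diff_pos_part_le (X - w) hs H
  rw [le_div_iff₀ hw, sum_mul]
  rw [two_mul]
  refine le_trans ?_ (add_le_add h1 h2)
  rw [← sum_add_distrib]
  refine sum_le_sum fun m _ => ?_
  rw [ramp_eq_sub X hw, ramp_eq_sub X hw, ramp_eq_sub X hw]
  conv_lhs => rw [← abs_of_pos hw, ← abs_mul, abs_of_pos hw]
  refine le_trans (le_of_eq ?_) (abs_sub _ _)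
  congr 1
  field_simp
  ring

theorem ramp_sub_le (X : ℝ) {w : ℝ} (hw : 0 < w) {x y : ℝ} (hxy : x ≤ y) :
    ramp X w x - ramp X w y ≤ (y - x) / w := by
  rw [ramp_eq_sub X hw, ramp_eq_sub X hw, ← sub_div]
  refine div_le_div_of_nonneg_right ?_ hw.le
  have h1 : max (X - x) 0 ≤ max (X - y) 0 + (y - x) := by
    refine max_le ?_ ?_
    · linarith [le_max_left (X - y) 0]
    · linarith [le_max_right (X - y) 0]
  have h2 : max (X - w - y) 0 ≤ max (X - w - x) 0 := by gcongr
  linarith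

/-- Discrete product rule. The two mixed terms pair a first difference of `a`, at most `s`, with one
of the monotone `b`, whose differences telescope to at most `1`; together they give `2 * s`. -/
theorem sum_abs_second_diff_mul_le {a b : ℕ → ℝ} (ha : ∀ m, 0 ≤ a m ∧ a m ≤ 1)
    (hb : ∀ m, 0 ≤ b m ∧ b m ≤ 1) (hb' : Antitone b) {s : ℝ}
    (hs : ∀ m, |a m - a (m + 1)| ≤ s) (H : ℕ) :
    ∑ m ∈ range H, |a m * b m - 2 * (a (m + 1) * b (m + 1)) + a (m + 2) * b (m + 2)| ≤
      ∑ m ∈ range H, |a m - 2 * a (m + 1) + a (m + 2)| +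
        ∑ m ∈ range H, |b m - 2 * b (m + 1) + b (m + 2)| + 2 * s := by
  have hs0 : 0 ≤ s := (abs_nonneg _).trans (hs 0)
  have htel : ∑ m ∈ range H, s * (b m - b (m + 1)) ≤ s := by
    rw [← mul_sum, sum_range_sub']
    have := (hb 0).2
    have := (hb H).1
    nlinarith
  have htel' : ∑ m ∈ range H, s * (b (m + 1) - b (m + 1 + 1)) ≤ s := by
    rw [← mul_sum, sum_range_sub' (fun m => b (m + 1))]
    have := (hb (0 + 1)).2
    have := (hb (H + 1)).1
    nlinarith
  rw [two_mul]
  refine le_trans ?_ (add_le_add le_rfl (add_le_add htel htel'))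
  rw [← sum_add_distrib, ← sum_add_distrib, ← sum_add_distrib]
  refine sum_le_sum fun m _ => ?_
  have hid : a m * b m - 2 * (a (m + 1) * b (m + 1)) + a (m + 2) * b (m + 2) =
      (a m - 2 * a (m + 1) + a (m + 2)) * b (m + 1) +
      a (m + 1) * (b m - 2 * b (m + 1) + b (m + 2)) +
      ((a m - a (m + 1)) * (b m - b (m + 1)) +
        (a (m + 1) - a (m + 1 + 1)) * (b (m + 1) - b (m + 1 + 1))) := by ring
  have d1 : 0 ≤ b m - b (m + 1) := sub_nonneg.2 (hb' (Nat.le_succ _))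
  have d2 : 0 ≤ b (m + 1) - b (m + 1 + 1) := sub_nonneg.2 (hb' (Nat.le_succ _))
  rw [hid]
  refine (abs_add_le _ _).trans (add_le_add ((abs_add_le _ _).trans (add_le_add ?_ ?_))
    ((abs_add_le _ _).trans (add_le_add ?_ ?_)))
  · rw [abs_mul, abs_of_nonneg (hb _).1]
    exact mul_le_of_le_one_right (abs_nonneg _) (hb _).2
  · rw [abs_mul, abs_of_nonneg (ha _).1]
    exact mul_le_of_le_one_left (abs_nonneg _) (ha _).2
  · rw [abs_mul, abs_of_nonneg d1]
    exact mul_le_mul_of_nonneg_right (hs m) d1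
  · rw [abs_mul, abs_of_nonneg d2]
    exact mul_le_mul_of_nonneg_right (hs (m + 1)) d2

/-- The three bounds for the kernel attached to a pair of slopes `s`, `t`. -/
theorem cosKernel_ramp_bounds {X w P s t : ℝ} (hw : 0 < w) (hP : 0 < P)
    (hs : P ≤ s) (hs' : s ≤ 2 * P) (ht : P ≤ t) (ht' : t ≤ 2 * P) {H : ℕ} (hH : X ≤ H * P) (x : ℝ) :
    |cosKernel (fun m => ramp X w (m * s) * ramp X w (m * t)) H x| ≤ 1 + 2 * H ∧
    |cosKernel (fun m => ramp X w (m * s) * ramp X w (m * t)) H x| * |Real.sin (x / 2)| ≤ 1 ∧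
    |cosKernel (fun m => ramp X w (m * s) * ramp X w (m * t)) H x| * Real.sin (x / 2) ^ 2 ≤
      8 * P / w := by
  have hs0 : 0 ≤ s := hP.le.trans hs
  have ht0 : 0 ≤ t := hP.le.trans ht
  have anti : ∀ {v : ℝ}, 0 ≤ v → Antitone fun m : ℕ => ramp X w (m * v) := by
    intro v hv m n hmn
    refine ramp_antitone X hw ?_
    gcongr
  have bnd : ∀ {v : ℝ}, ∀ m : ℕ, 0 ≤ ramp X w (m * v) ∧ ramp X w (m * v) ≤ 1 :=
    fun m => ⟨ramp_nonneg _ _ _, ramp_le_one _ _ _⟩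
  have hz : ∀ m : ℕ, H ≤ m → ramp X w (m * s) * ramp X w (m * t) = 0 := by
    intro m hm
    rw [ramp_eq_zero hw, zero_mul]
    have : (H : ℝ) ≤ m := by exact_mod_cast hm
    calc X ≤ H * P := hH
      _ ≤ m * s := by gcongr
  have lip : ∀ {v : ℝ}, 0 ≤ v → ∀ m : ℕ, |ramp X w (m * v) - ramp X w ((m + 1 : ℕ) * v)| ≤ v / w := by
    intro v hv m
    rw [abs_of_nonneg (sub_nonneg.2 (anti hv (Nat.le_succ m)))]
    refine (ramp_sub_le X hw (by push_cast; nlinarith)).trans (le_of_eq ?_)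
    push_cast; ring
  have hu0 : ∀ m : ℕ, 0 ≤ ramp X w (m * s) * ramp X w (m * t) :=
    fun m => mul_nonneg (bnd m).1 (bnd m).1
  have hu1 : ∀ m : ℕ, ramp X w (m * s) * ramp X w (m * t) ≤ 1 :=
    fun m => mul_le_one₀ (bnd m).2 (bnd m).1 (bnd m).2
  refine ⟨abs_cosKernel_le hu0 hu1 H x, ?_, ?_⟩
  · refine (abs_cosKernel_mul_sin_le (u := fun m : ℕ => ramp X w (m * s) * ramp X w (m * t))
      ?_ (hz (H + 1) (by omega)) x).trans (hu1 0)
    intro m n hmn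
    exact mul_le_mul (anti hs0 hmn) (anti ht0 hmn) (bnd n).1 (bnd m).1
  · have h1 := abs_cosKernel_mul_sin_sq_le (u := fun m : ℕ => ramp X w (m * s) * ramp X w (m * t))
      (hz H le_rfl) (hz (H + 1) (by omega)) x
    have h2 := sum_abs_second_diff_mul_le (a := fun m : ℕ => ramp X w (m * s))
      (b := fun m : ℕ => ramp X w (m * t)) bnd bnd (anti ht0) (lip hs0) H
    have h3 := sum_abs_second_diff_ramp_le X hw hs0 H
    have h4 := sum_abs_second_diff_ramp_le X hw ht0 H
    have h5 : |ramp X w ((0 : ℕ) * s) * ramp X w ((0 : ℕ) * t) -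
        ramp X w ((1 : ℕ) * s) * ramp X w ((1 : ℕ) * t)| ≤ s / w + t / w := by
      have e1 := lip hs0 0
      have e2 := lip ht0 0
      have : ramp X w ((0 : ℕ) * s) * ramp X w ((0 : ℕ) * t) -
          ramp X w ((1 : ℕ) * s) * ramp X w ((1 : ℕ) * t) =
          (ramp X w ((0 : ℕ) * s) - ramp X w ((0 + 1 : ℕ) * s)) * ramp X w ((0 : ℕ) * t) +
          ramp X w ((1 : ℕ) * s) * (ramp X w ((0 : ℕ) * t) - ramp X w ((0 + 1 : ℕ) * t)) := by ring
      rw [this]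
      refine (abs_add_le _ _).trans (add_le_add ?_ ?_)
      · rw [abs_mul, abs_of_nonneg (bnd 0).1]
        exact (mul_le_of_le_one_right (abs_nonneg _) (bnd 0).2).trans e1
      · rw [abs_mul, abs_of_nonneg (bnd 1).1]
        exact (mul_le_of_le_one_left (abs_nonneg _) (bnd 1).2).trans e2
    have h6 : s / w ≤ 2 * P / w := by gcongr
    have h7 : t / w ≤ 2 * P / w := by gcongr
    -- The contributions add up to `5s/w + 3t/w ≤ 16P/w`, and half of this is the claimed bound.
    simp only [mul_div_assoc] at *
    linarith

/-! ### Expansion of the square of a bilinear form -/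

theorem e_add (α β : ℝ) : e (α + β) = e α * e β := by
  unfold e
  rw [← Complex.exp_add]; congr 1; push_cast; ring

theorem conj_e (α : ℝ) : (starRingEnd ℂ) (e α) = e (-α) := by
  unfold e
  rw [← Complex.exp_conj]
  congr 1
  simp only [map_mul, Complex.conj_ofReal, Complex.conj_I, map_ofNat]
  push_cast; ring

theorem norm_e (α : ℝ) : ‖e α‖ = 1 := by
  unfold e
  rw [show 2 * (Real.pi : ℂ) * Complex.I * α = ((2 * Real.pi * α : ℝ) : ℂ) * Complex.I by
    push_cast; ring]
  exact Complex.norm_exp_ofReal_mul_I _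

theorem e_zero : e 0 = 1 := by simp [e]

theorem e_add_e_neg (α : ℝ) : e α + e (-α) = (2 * Real.cos (2 * Real.pi * α) : ℝ) := by
  unfold e
  push_cast
  rw [Complex.two_cos]
  congr 1 <;> congr 1 <;> ring

theorem norm_sq_sum_e (Ps : Finset ℕ) (c : ℕ → ℂ) (w : ℕ → ℝ) (t : ℝ) :
    ((‖∑ p ∈ Ps, c p * w p * e (t * p)‖ ^ 2 : ℝ) : ℂ) =
      ∑ p ∈ Ps, ∑ p' ∈ Ps, c p * (starRingEnd ℂ) (c p') *
        ((w p * w p' : ℝ) * e (t * ((p : ℝ) - p'))) := by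
  rw [Complex.ofReal_pow, ← Complex.mul_conj', map_sum, sum_mul_sum]
  refine sum_congr rfl fun p _ => sum_congr rfl fun p' _ => ?_
  rw [map_mul, map_mul, Complex.conj_ofReal, conj_e, mul_sub, sub_eq_add_neg, e_add]
  push_cast; ring

theorem cosKernel_eq_sum_e (u : ℕ → ℝ) (H : ℕ) (α : ℝ) :
    ((cosKernel u H (2 * Real.pi * α) : ℝ) : ℂ) =
      u 0 * e ((0 : ℕ) * α) + ∑ m ∈ Icc 1 H, ((u m : ℂ) * e (m * α) + u m * e (-(m : ℝ) * α)) := by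
  have h1 : ∑ m ∈ Icc 1 H, ((u m : ℂ) * e (m * α) + u m * e (-(m : ℝ) * α)) =
      ∑ m ∈ range H, ((u (m + 1) : ℂ) * e ((m + 1 : ℕ) * α) +
        u (m + 1) * e (-((m + 1 : ℕ) : ℝ) * α)) := by
    rw [range_eq_Ico, sum_Ico_add' (fun m : ℕ => (u m : ℂ) * e (m * α) + u m * e (-(m : ℝ) * α)) 0 H 1]
    rfl
  rw [h1]
  unfold cosKernel
  push_cast
  rw [zero_mul, e_zero, mul_one, mul_sum]
  congr 1
  refine sum_congr rfl fun m _ => ?_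
  rw [← mul_add, neg_mul, e_add_e_neg]
  push_cast
  rw [show (2 * (Real.pi : ℂ) * ((m + 1) * α)) = ((m : ℂ) + 1) * (2 * Real.pi * α) by ring]
  ring

theorem sum_norm_sq_le_cosKernel (Ps : Finset ℕ) (c : ℕ → ℂ) (w : ℕ → ℕ → ℝ) (H : ℕ) (θ : ℝ) :
    ∑ m ∈ Icc 1 H, ‖∑ p ∈ Ps, c p * w m p * e (m * θ * p)‖ ^ 2 ≤
      ∑ p ∈ Ps, ∑ p' ∈ Ps, ‖c p‖ * ‖c p'‖ *
        |cosKernel (fun m => w m p * w m p') H (2 * Real.pi * (((p : ℝ) - p') * θ))| := by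
  set A : ℝ → ℕ → ℝ := fun t m => ‖∑ p ∈ Ps, c p * w m p * e (t * p)‖ ^ 2 with hA
  have hAnn : ∀ t m, 0 ≤ A t m := fun t m => sq_nonneg _
  -- The nonnegative terms with index `0` and `-m` are added so that the coefficient of each pair
  -- `(p, p')` becomes a full real cosine kernel.
  have hle : ∑ m ∈ Icc 1 H, A (m * θ) m ≤
      A ((0 : ℕ) * θ) 0 + ∑ m ∈ Icc 1 H, (A (m * θ) m + A (-(m : ℝ) * θ) m) := by
    have : ∑ m ∈ Icc 1 H, A (m * θ) m ≤ ∑ m ∈ Icc 1 H, (A (m * θ) m + A (-(m : ℝ) * θ) m) :=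
      sum_le_sum fun m _ => le_add_of_nonneg_right (hAnn _ _)
    linarith [hAnn ((0 : ℕ) * θ) 0]
  refine hle.trans ?_
  have key : ((A ((0 : ℕ) * θ) 0 + ∑ m ∈ Icc 1 H, (A (m * θ) m + A (-(m : ℝ) * θ) m) : ℝ) : ℂ) =
      ∑ p ∈ Ps, ∑ p' ∈ Ps, c p * (starRingEnd ℂ) (c p') *
        (cosKernel (fun m => w m p * w m p') H (2 * Real.pi * (((p : ℝ) - p') * θ)) : ℝ) := by
    simp only [cosKernel_eq_sum_e, hA, Complex.ofReal_add, Complex.ofReal_sum, norm_sq_sum_e]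
    simp only [mul_add, sum_add_distrib, mul_sum]
    congr 1
    · refine sum_congr rfl fun p _ => sum_congr rfl fun p' _ => ?_
      rw [show ((0 : ℕ) : ℝ) * θ * ((p : ℝ) - p') = ((0 : ℕ) : ℝ) * (((p : ℝ) - p') * θ) by ring]
    · congr 1
      · rw [sum_comm]
        refine sum_congr rfl fun p _ => ?_
        rw [sum_comm]
        refine sum_congr rfl fun p' _ => sum_congr rfl fun m _ => ?_
        rw [show (m : ℝ) * θ * ((p : ℝ) - p') = m * (((p : ℝ) - p') * θ) by ring]
      · rw [sum_comm]
        refine sum_congr rfl fun p _ => ?_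
        rw [sum_comm]
        refine sum_congr rfl fun p' _ => sum_congr rfl fun m _ => ?_
        rw [show -(m : ℝ) * θ * ((p : ℝ) - p') = -(m : ℝ) * (((p : ℝ) - p') * θ) by ring]
  have hnn : 0 ≤ A ((0 : ℕ) * θ) 0 + ∑ m ∈ Icc 1 H, (A (m * θ) m + A (-(m : ℝ) * θ) m) :=
    add_nonneg (hAnn _ _) (sum_nonneg fun m _ => add_nonneg (hAnn _ _) (hAnn _ _))
  rw [← abs_of_nonneg hnn, ← Real.norm_eq_abs, ← Complex.norm_real, key]
  refine (norm_sum_le _ _).trans (sum_le_sum fun p _ => (norm_sum_le _ _).trans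
    (sum_le_sum fun p' _ => ?_))
  rw [norm_mul, norm_mul, RCLike.norm_conj, Complex.norm_real, Real.norm_eq_abs]

/-! ### Sums of truncated reciprocals over residue classes -/

/-- The primitive `∫₀ᵗ min(1, y / u) du`. -/
noncomputable def truncLog (y t : ℝ) : ℝ := if t ≤ y then t else y + y * Real.log (t / y)

/-- The integrand `min(1, y/u)` is nonincreasing, so its value at `s` is at most its integral over
`[s - 1, s]`. The logarithms are compared through `log v ≥ 1 - 1/v`. -/
theorem min_one_div_le_truncLog {y s : ℝ} (hy : 0 < y) (hs : 1 ≤ s) :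
    min 1 (y / s) ≤ truncLog y s - truncLog y (s - 1) := by
  have hs0 : 0 < s := by linarith
  have hlog : ∀ u v : ℝ, 0 < u → 0 < v → 1 - u / v ≤ Real.log (v / u) := by
    intro u v hu hv
    have := Real.one_sub_inv_le_log_of_pos (div_pos hv hu)
    rwa [inv_div] at this
  unfold truncLog
  split_ifs with h1 h2 h2
  · refine (min_le_left _ _).trans (by linarith)
  · exact absurd (show s - 1 ≤ y by linarith) h2
  · push Not at h1
    refine (min_le_right _ _).trans ?_
    have h := hlog y s hy hs0
    have h3 : y * (1 - y / s) ≤ y * Real.log (s / y) := mul_le_mul_of_nonneg_left h hy.le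
    have h4 : y / s ≤ y + y * (1 - y / s) - (s - 1) := by
      rw [div_le_iff₀ hs0]
      have : (y + y * (1 - y / s) - (s - 1)) * s = 2 * y * s - y ^ 2 - s * (s - 1) := by
        field_simp; ring
      rw [this]
      nlinarith
    linarith
  · push Not at h2
    refine (min_le_right _ _).trans ?_
    have hs1 : 0 < s - 1 := by linarith
    have h := hlog (s - 1) s hs1 hs0
    have e1 : Real.log (s / y) - Real.log ((s - 1) / y) = Real.log (s / (s - 1)) := by
      rw [Real.log_div hs0.ne' hy.ne', Real.log_div hs1.ne' hy.ne', Real.log_div hs0.ne' hs1.ne']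
      ring
    have e2 : y / s = y * (1 - (s - 1) / s) := by field_simp; ring
    have : y * (1 - (s - 1) / s) ≤ y * Real.log (s / (s - 1)) := mul_le_mul_of_nonneg_left h hy.le
    rw [e2]
    nlinarith [e1]

theorem sum_min_one_div_le {y Y : ℝ} (hy : 0 < y) (hyY : y ≤ Y) {n : ℕ} (hn : (n : ℝ) ≤ Y) :
    ∑ s ∈ Icc 1 n, min 1 (y / (s : ℝ)) ≤ y * (1 + Real.log (Y / y)) := by
  have h1 : ∀ n : ℕ, ∑ s ∈ Icc 1 n, min 1 (y / (s : ℝ)) ≤ truncLog y n := by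
    intro n
    induction n with
    | zero => simp [truncLog, hy.le]
    | succ n ih =>
      rw [sum_Icc_succ_top (by omega)]
      have := min_one_div_le_truncLog hy (s := (n + 1 : ℕ)) (by push_cast; linarith [(Nat.cast_nonneg n : (0:ℝ) ≤ n)])
      have e : ((n + 1 : ℕ) : ℝ) - 1 = n := by push_cast; ring
      rw [e] at this
      linarith
  refine (h1 n).trans ?_
  have hlog : 0 ≤ Real.log (Y / y) := Real.log_nonneg (by rw [le_div_iff₀ hy]; linarith)
  unfold truncLog
  split_ifs with h
  · nlinarith
  · push Not at h
    have : Real.log (n / y) ≤ Real.log (Y / y) := by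
      apply Real.log_le_log (by apply div_pos _ hy; linarith)
      gcongr
    nlinarith

/-- Up to the cut `Y` only `A` and `b/s` are used, which gives the logarithm. Beyond `Y` the
convergent tail of `C/s²` takes over. -/
theorem sum_min_le {A b C Y : ℝ} (hA : 0 < A) (hb : 0 < b) (hC : 0 ≤ C) (hY : b / A ≤ Y) (n : ℕ) :
    ∑ s ∈ Ico 1 n, min A (min (b / (s : ℝ)) (C / (s : ℝ) ^ 2)) ≤
      b * (1 + Real.log (Y * A / b)) + 2 * C / Y := by
  have hy : 0 < b / A := div_pos hb hA
  have hY0 : 0 < Y := hy.trans_le hY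
  set k := ⌊Y⌋₊ with hk
  have hk1 : (k : ℝ) ≤ Y := Nat.floor_le hY0.le
  have hk2 : Y < k + 1 := Nat.lt_floor_add_one Y
  have hsplit : Ico 1 n ⊆ Icc 1 k ∪ Ioo k n := by
    intro s hs
    simp only [mem_Ico, mem_union, mem_Icc, mem_Ioo] at hs ⊢
    omega
  have hnn : ∀ s : ℕ, 0 ≤ min A (min (b / (s : ℝ)) (C / (s : ℝ) ^ 2)) :=
    fun s => le_min hA.le (le_min (by positivity) (by positivity))
  refine (sum_le_sum_of_subset_of_nonneg hsplit fun s _ _ => hnn s).trans ?_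
  have hdisj : Disjoint (Icc 1 k) (Ioo k n) := by
    rw [disjoint_left]; intro s h1 h2
    simp only [mem_Icc, mem_Ioo] at h1 h2; omega
  rw [sum_union hdisj]
  refine add_le_add ?_ ?_
  · have h := sum_min_one_div_le hy hY hk1
    calc ∑ s ∈ Icc 1 k, min A (min (b / (s : ℝ)) (C / (s : ℝ) ^ 2))
        ≤ ∑ s ∈ Icc 1 k, A * min 1 (b / A / (s : ℝ)) := by
          refine sum_le_sum fun s _ => ?_
          rw [mul_min_of_nonneg _ _ hA.le, mul_one]
          refine min_le_min le_rfl ((min_le_left _ _).trans (le_of_eq ?_))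
          field_simp
      _ = A * ∑ s ∈ Icc 1 k, min 1 (b / A / (s : ℝ)) := by rw [mul_sum]
      _ ≤ A * (b / A * (1 + Real.log (Y / (b / A)))) := mul_le_mul_of_nonneg_left h hA.le
      _ = _ := by
          rw [show Y / (b / A) = Y * A / b by field_simp]
          field_simp
  · calc ∑ s ∈ Ioo k n, min A (min (b / (s : ℝ)) (C / (s : ℝ) ^ 2))
        ≤ ∑ s ∈ Ioo k n, C * ((s : ℝ) ^ 2)⁻¹ :=
          sum_le_sum fun s _ => (min_le_right _ _).trans ((min_le_right _ _).trans (le_of_eq (by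
            rw [div_eq_mul_inv])))
      _ = C * ∑ s ∈ Ioo k n, ((s : ℝ) ^ 2)⁻¹ := by rw [mul_sum]
      _ ≤ C * (2 / (k + 1)) := mul_le_mul_of_nonneg_left (sum_Ioo_inv_sq_le k n) hC
      _ ≤ C * (2 / Y) := by gcongr
      _ = 2 * C / Y := by ring

/-- The bound for a kernel at distance `s / n` from the integers. -/
noncomputable def kernelBound (A c : ℝ) (n s : ℕ) : ℝ :=
  min A (min ((n : ℝ) / 2 / (s : ℝ)) (c * (n : ℝ) ^ 2 / 4 / (s : ℝ) ^ 2))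

theorem kernelBound_nonneg {A c : ℝ} (hA : 0 ≤ A) (hc : 0 ≤ c) (n s : ℕ) :
    0 ≤ kernelBound A c n s :=
  le_min hA (le_min (by positivity) (by positivity))

/-- Cutting at `Y = c n` produces `log(2cA)`, while ignoring the quadratic bound produces `log(2A)`.
In the application `c` is about `P/q`, so the better choice depends on which of `P`, `q` is larger.
-/
theorem sum_kernelBound_le {A c L : ℝ} (hA : 1 ≤ A) (hc : 0 < c) (hcA : 1 ≤ 2 * c * A)
    (hL : 2 + Real.log (2 * c * A) ≤ L ∨ 1 + Real.log (2 * A) ≤ L) (n : ℕ) :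
    ∑ s ∈ Ico 1 n, kernelBound A c n s ≤ n * L / 2 := by
  rcases Nat.eq_zero_or_pos n with rfl | hn
  · simp
  have hn' : (0 : ℝ) < n := by exact_mod_cast hn
  have hA0 : 0 < A := by linarith
  rcases hL with hL | hL
  · have h := sum_min_le (A := A) (b := (n : ℝ) / 2) (C := c * (n : ℝ) ^ 2 / 4) (Y := c * n) hA0
      (by positivity) (by positivity) (by rw [div_le_iff₀ hA0]; nlinarith) n
    refine h.trans ?_
    rw [show c * n * A / (n / 2) = 2 * c * A by field_simp]
    rw [show 2 * (c * (n : ℝ) ^ 2 / 4) / (c * n) = n / 2 by field_simp; norm_num]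
    nlinarith
  · have hsub : ∀ s ∈ Ico 1 n, kernelBound A c n s ≤ A * min 1 ((n : ℝ) / 2 / A / (s : ℝ)) := by
      intro s _
      rw [mul_min_of_nonneg _ _ hA0.le, mul_one]
      refine min_le_min le_rfl ((min_le_left _ _).trans (le_of_eq ?_))
      field_simp
    have hsub2 : Ico 1 n ⊆ Icc 1 n := Ico_subset_Icc_self
    have h := sum_min_one_div_le (y := (n : ℝ) / 2 / A) (Y := n) (by positivity)
      (by rw [div_le_iff₀ hA0]; nlinarith) (n := n) le_rfl
    calc ∑ s ∈ Ico 1 n, kernelBound A c n s ≤ ∑ s ∈ Ico 1 n, A * min 1 ((n : ℝ) / 2 / A / (s : ℝ)) :=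
          sum_le_sum hsub
      _ ≤ ∑ s ∈ Icc 1 n, A * min 1 ((n : ℝ) / 2 / A / (s : ℝ)) :=
          sum_le_sum_of_subset_of_nonneg hsub2 fun s _ _ => by positivity
      _ ≤ A * ((n : ℝ) / 2 / A * (1 + Real.log (n / ((n : ℝ) / 2 / A)))) := by
          rw [← mul_sum]; exact mul_le_mul_of_nonneg_left h hA0.le
      _ = n / 2 * (1 + Real.log (2 * A)) := by
          rw [show (n : ℝ) / ((n : ℝ) / 2 / A) = 2 * A by field_simp]
          field_simp
      _ ≤ n * L / 2 := by nlinarith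

theorem two_mul_div_le_sin {n r : ℕ} (hr : 2 * r ≤ n) (hn : 0 < n) :
    2 * (r : ℝ) / n ≤ Real.sin (Real.pi * (r / n)) := by
  have hn' : (0 : ℝ) < n := by exact_mod_cast hn
  have hr' : 2 * (r : ℝ) ≤ n := by exact_mod_cast hr
  have := Real.mul_le_sin (x := Real.pi * (r / n)) (by positivity) (by
    rw [div_eq_mul_one_div Real.pi 2]
    have : (r : ℝ) / n ≤ 1 / 2 := by rw [div_le_iff₀ hn']; linarith
    gcongr)
  refine le_trans (le_of_eq ?_) this
  field_simp

/-- A quantity controlled by `|sin|` is at most `kernelBound`. -/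
theorem le_kernelBound_of_sin {A c x σ : ℝ} {n s : ℕ} (hs : 0 < s) (hn : 0 < n) (hx0 : 0 ≤ x)
    (hxA : x ≤ A) (h1 : x * σ ≤ 1) (h2 : x * σ ^ 2 ≤ c) (hσ : 2 * (s : ℝ) / n ≤ σ) :
    x ≤ kernelBound A c n s := by
  have hs' : (0 : ℝ) < s := by exact_mod_cast hs
  have hn' : (0 : ℝ) < n := by exact_mod_cast hn
  have hpos : 0 < 2 * (s : ℝ) / n := by positivity
  refine le_min hxA (le_min ?_ ?_)
  · have : x * (2 * (s : ℝ) / n) ≤ 1 := (mul_le_mul_of_nonneg_left hσ hx0).trans h1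
    rw [div_div, le_div_iff₀ (by positivity)]
    calc x * (2 * s) = x * (2 * (s : ℝ) / n) * n := by field_simp
      _ ≤ 1 * n := by gcongr
      _ = n := one_mul _
  · have : x * (2 * (s : ℝ) / n) ^ 2 ≤ c := by
      refine le_trans (mul_le_mul_of_nonneg_left ?_ hx0) h2
      gcongr
    rw [div_div, le_div_iff₀ (by positivity)]
    calc x * (4 * (s : ℝ) ^ 2) = x * (2 * (s : ℝ) / n) ^ 2 * n ^ 2 := by field_simp; ring
      _ ≤ c * n ^ 2 := by gcongr

theorem abs_sin_eq_of_intModEq {n : ℕ} (hn : 0 < n) {b r : ℤ} (h : b ≡ r [ZMOD n]) :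
    |Real.sin (Real.pi * ((b : ℝ) / n))| = |Real.sin (Real.pi * ((r : ℝ) / n))| := by
  obtain ⟨k, hk⟩ := h.dvd
  have hn' : (n : ℝ) ≠ 0 := by exact_mod_cast hn.ne'
  have hr : r = b + n * k := by linarith
  have : Real.pi * ((r : ℝ) / n) = Real.pi * ((b : ℝ) / n) + k * Real.pi := by
    rw [hr]; push_cast; field_simp
  rw [this, Real.sin_add_int_mul_pi, abs_mul]
  rcases Int.even_or_odd k with hk | hk
  · simp [hk.neg_one_zpow]
  · simp [hk.neg_one_zpow]

/-- Sum of the kernel bounds at both distances of a nonzero residue to `0`. -/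
noncomputable def residueBound (A c : ℝ) (n : ℕ) (x : ZMod n) : ℝ :=
  if x = 0 then 0 else kernelBound A c n x.val + kernelBound A c n (n - x.val)

theorem residueBound_nonneg {A c : ℝ} (hA : 0 ≤ A) (hc : 0 ≤ c) (n : ℕ) (x : ZMod n) :
    0 ≤ residueBound A c n x := by
  unfold residueBound
  split_ifs
  · exact le_rfl
  · exact add_nonneg (kernelBound_nonneg hA hc _ _) (kernelBound_nonneg hA hc _ _)

theorem sum_range_natCast_zmod {n : ℕ} [NeZero n] (g : ZMod n → ℝ) :
    ∑ k ∈ range n, g (k : ZMod n) = ∑ x, g x := by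
  refine sum_nbij' (fun k => (k : ZMod n)) ZMod.val ?_ ?_ ?_ ?_ ?_
  · intro k _; exact mem_univ _
  · intro x _; exact mem_range.2 (ZMod.val_lt x)
  · intro k hk; exact ZMod.val_cast_of_lt (mem_range.1 hk)
  · intro x _; exact ZMod.natCast_zmod_val x
  · intro k _; rfl

theorem sum_residueBound {A c : ℝ} {n : ℕ} [NeZero n] :
    ∑ x : ZMod n, residueBound A c n x = 2 * ∑ s ∈ Ico 1 n, kernelBound A c n s := by
  rw [← sum_range_natCast_zmod]
  have hn : 0 < n := Nat.pos_of_ne_zero (NeZero.ne n)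
  have h0 : range n = insert 0 (Ico 1 n) := by
    ext k; simp only [mem_range, mem_insert, mem_Ico]; omega
  rw [h0, sum_insert (by simp)]
  have h1 : residueBound A c n ((0 : ℕ) : ZMod n) = 0 := by simp [residueBound]
  rw [h1, zero_add]
  have h2 : ∀ k ∈ Ico 1 n, residueBound A c n (k : ZMod n) =
      kernelBound A c n k + kernelBound A c n (n - k) := by
    intro k hk
    have hk' := mem_Ico.1 hk
    have hv : (k : ZMod n).val = k := ZMod.val_cast_of_lt hk'.2
    have hne : (k : ZMod n) ≠ 0 := by
      intro h
      rw [h, ZMod.val_zero] at hv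
      omega
    rw [residueBound, if_neg hne, hv]
  rw [sum_congr rfl h2, sum_add_distrib, two_mul]
  congr 1
  refine sum_nbij' (fun k => n - k) (fun k => n - k) ?_ ?_ ?_ ?_ ?_ <;>
    · intro k hk
      simp only [mem_Ico] at hk ⊢
      try omega

theorem sum_range_mul_of_mod {n : ℕ} {g : ℕ → ℝ} (hg : ∀ k, g (k % n) = g k) (B : ℕ) :
    ∑ k ∈ range (B * n), g k = B * ∑ k ∈ range n, g k := by
  induction B with
  | zero => simp
  | succ B ih =>
    rw [Nat.succ_mul, sum_range_add, ih, sum_range_add_of_periodic hg]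
    push_cast; ring

/-- Multiples of `n` receive only the trivial bound `A`. In each block of `n` consecutive integers
multiplication by the unit `a` permutes the residues, so the remaining terms are at most `2 ∑
kernelBound ≤ n L`. -/
theorem sum_le_of_sin_bounds {A c L : ℝ} (hA : 1 ≤ A) (hc : 0 < c) (hcA : 1 ≤ 2 * c * A)
    (hL : 2 + Real.log (2 * c * A) ≤ L ∨ 1 + Real.log (2 * A) ≤ L) {n : ℕ} (hn : 0 < n)
    {a : ℤ} (ha : IsCoprime a n) {F : ℕ → ℝ} (X : ℕ)
    (hF : ∀ k ∈ Icc 1 X, 0 ≤ F k ∧ F k ≤ A ∧ F k * |Real.sin (Real.pi * (((k * a : ℤ) : ℝ) / n))| ≤ 1 ∧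
      F k * |Real.sin (Real.pi * (((k * a : ℤ) : ℝ) / n))| ^ 2 ≤ c) :
    ∑ k ∈ Icc 1 X, F k ≤ A * ((X : ℝ) / n) + ((X : ℝ) / n + 1) * (n * L) := by
  have : NeZero n := ⟨hn.ne'⟩
  have hn' : (0 : ℝ) < n := by exact_mod_cast hn
  have hA0 : 0 ≤ A := by linarith
  have haunit : IsUnit (a : ZMod n) := by
    rw [ZMod.coe_int_isUnit_iff_isCoprime]; exact ha.symm
  obtain ⟨u, hu⟩ := haunit
  set g : ℕ → ℝ := fun k => residueBound A c n ((k : ZMod n) * (a : ZMod n)) with hg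
  have hgnn : ∀ k, 0 ≤ g k := fun k => residueBound_nonneg hA0 hc.le _ _
  have hpt : ∀ k ∈ Icc 1 X, F k ≤ (if n ∣ k then A else 0) + g k := by
    intro k hk
    obtain ⟨f0, fA, f1, f2⟩ := hF k hk
    split_ifs with hd
    · exact fA.trans (le_add_of_nonneg_right (hgnn k))
    · rw [zero_add]
      have hk0 : (k : ZMod n) ≠ 0 := by rwa [Ne, ZMod.natCast_eq_zero_iff]
      set x : ZMod n := (k : ZMod n) * (a : ZMod n) with hx
      have hx0 : x ≠ 0 := by
        rw [hx, ← hu]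
        intro h
        exact hk0 ((Units.mul_left_eq_zero u).1 h)
      have hxpos : 0 < x.val := Nat.pos_of_ne_zero fun h => hx0 ((ZMod.val_eq_zero x).1 h)
      have hxlt := ZMod.val_lt x
      have hmod : ((k : ℤ) * a) ≡ (x.val : ℤ) [ZMOD n] := by
        rw [← ZMod.intCast_eq_intCast_iff]
        push_cast
        rw [ZMod.natCast_zmod_val]
      have hsin := abs_sin_eq_of_intModEq hn hmod
      rw [hsin] at f1 f2
      have hgk : g k = kernelBound A c n x.val + kernelBound A c n (n - x.val) := by
        simp only [hg]
        rw [← hx, residueBound, if_neg hx0]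
      rw [hgk]
      -- The smaller of `x` and `n - x` is at most `n/2`, where `sin(πt) ≥ 2t` applies; the other
      -- summand of `residueBound` is dropped.
      rcases le_total (2 * x.val) n with h | h
      · refine le_add_of_le_of_nonneg ?_ (kernelBound_nonneg hA0 hc.le _ _)
        refine le_kernelBound_of_sin hxpos hn f0 fA f1 f2 ?_
        refine (two_mul_div_le_sin h hn).trans ?_
        push_cast
        exact le_abs_self _
      · refine le_add_of_nonneg_of_le (kernelBound_nonneg hA0 hc.le _ _) ?_
        refine le_kernelBound_of_sin (by omega) hn f0 fA f1 f2 ?_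
        refine (two_mul_div_le_sin (by omega) hn).trans ?_
        have e1 : Real.pi * (((n - x.val : ℕ) : ℝ) / n) = Real.pi - Real.pi * ((x.val : ℝ) / n) := by
          rw [Nat.cast_sub hxlt.le]; field_simp
        rw [e1, Real.sin_pi_sub]
        push_cast
        exact le_abs_self _
  have hsum_g : ∑ k ∈ Icc 1 X, g k ≤ ((X : ℝ) / n + 1) * (n * L) := by
    have hsub : Icc 1 X ⊆ range ((X / n + 1) * n) := by
      intro k hk
      have := (mem_Icc.1 hk).2
      rw [mem_range]
      have h2 := Nat.lt_div_mul_add hn (a := X)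
      calc k ≤ X := this
        _ < X / n * n + n := h2
        _ = _ := by ring
    have hper : ∀ k, g (k % n) = g k := by
      intro k; simp only [hg, ZMod.natCast_mod]
    have hblock : ∑ k ∈ range n, g k ≤ n * L := by
      have e1 : ∑ k ∈ range n, g k = ∑ x : ZMod n, residueBound A c n (x * (a : ZMod n)) :=
        sum_range_natCast_zmod fun x => residueBound A c n (x * (a : ZMod n))
      have e2 : ∑ x : ZMod n, residueBound A c n (x * (a : ZMod n)) = ∑ x, residueBound A c n x := by
        rw [← hu]
        exact Equiv.sum_comp (Units.mulRight u) (residueBound A c n)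
      rw [e1, e2, sum_residueBound]
      have := sum_kernelBound_le hA hc hcA hL n
      linarith
    have hblock0 : 0 ≤ ∑ k ∈ range n, g k := sum_nonneg fun k _ => hgnn k
    calc ∑ k ∈ Icc 1 X, g k ≤ ∑ k ∈ range ((X / n + 1) * n), g k :=
          sum_le_sum_of_subset_of_nonneg hsub fun k _ _ => hgnn k
      _ = ((X / n + 1 : ℕ) : ℝ) * ∑ k ∈ range n, g k := sum_range_mul_of_mod hper _
      _ ≤ ((X : ℝ) / n + 1) * ∑ k ∈ range n, g k := by
          refine mul_le_mul_of_nonneg_right ?_ hblock0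
          push_cast
          have := @Nat.cast_div_le ℝ _ _ _ X n
          linarith
      _ ≤ _ := mul_le_mul_of_nonneg_left hblock (by positivity)
  have hmult : ∑ k ∈ Icc 1 X, (if n ∣ k then A else 0) ≤ A * ((X : ℝ) / n) := by
    rw [← sum_filter, sum_const, nsmul_eq_mul]
    have hcard : ((Icc 1 X).filter (n ∣ ·)).card = X / n := by
      rw [← Nat.Ioc_filter_dvd_card_eq_div X n]
      congr 2
    rw [hcard, mul_comm]
    exact mul_le_mul_of_nonneg_left Nat.cast_div_le hA0
  calc ∑ k ∈ Icc 1 X, F k ≤ ∑ k ∈ Icc 1 X, ((if n ∣ k then A else 0) + g k) := sum_le_sum hpt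
    _ = _ := sum_add_distrib
    _ ≤ _ := add_le_add hmult hsum_g

/-! ### Averaging kernels against the divisor weight `σ₋₁` -/

theorem sum_filter_dvd_eq {M : Type*} [AddCommMonoid M] (H : ℕ) {d : ℕ} (hd : 0 < d) (f : ℕ → M) :
    ∑ h ∈ (Icc 1 H).filter (d ∣ ·), f h = ∑ k ∈ Icc 1 (H / d), f (k * d) := by
  refine sum_nbij' (fun h => h / d) (fun k => k * d) ?_ ?_ ?_ ?_ ?_
  · intro h hh
    rw [mem_filter, mem_Icc] at hh
    rw [mem_Icc]
    exact ⟨Nat.div_pos (Nat.le_of_dvd (by omega) hh.2) hd, Nat.div_le_div_right hh.1.2⟩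
  · intro k hk
    rw [mem_Icc] at hk
    rw [mem_filter, mem_Icc]
    exact ⟨⟨Nat.mul_pos hk.1 hd, (Nat.le_div_iff_mul_le hd).1 hk.2⟩, Dvd.intro_left k rfl⟩
  · intro h hh
    exact Nat.div_mul_cancel (mem_filter.1 hh).2
  · intro k _
    exact Nat.mul_div_cancel k hd
  · intro h hh
    rw [Nat.div_mul_cancel (mem_filter.1 hh).2]

theorem sum_sum_divisors_mul (H : ℕ) (w f : ℕ → ℝ) :
    ∑ h ∈ Icc 1 H, (∑ d ∈ h.divisors, w d) * f h =
      ∑ d ∈ Icc 1 H, w d * ∑ k ∈ Icc 1 (H / d), f (k * d) := by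
  have h1 : ∀ h ∈ Icc 1 H, (∑ d ∈ h.divisors, w d) * f h =
      ∑ d ∈ Icc 1 H, if d ∣ h then w d * f h else 0 := by
    intro h hh
    have hh' := mem_Icc.1 hh
    rw [sum_mul, ← sum_filter]
    refine sum_congr ?_ fun _ _ => rfl
    ext d
    rw [Nat.mem_divisors, mem_filter, mem_Icc]
    constructor
    · rintro ⟨hd, h0⟩
      exact ⟨⟨Nat.pos_of_dvd_of_pos hd (by omega), (Nat.le_of_dvd (by omega) hd).trans hh'.2⟩, hd⟩
    · rintro ⟨_, hd⟩
      exact ⟨hd, by omega⟩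
  rw [sum_congr rfl h1, sum_comm]
  refine sum_congr rfl fun d hd => ?_
  rw [← sum_filter, ← mul_sum, sum_filter_dvd_eq H (mem_Icc.1 hd).1]

theorem totient_mul_le (a b : ℕ) : (a * b).totient ≤ a * b.totient := by
  induction a using induction_on_primes with
  | zero => simp
  | one => simp
  | prime_mul p m hp ih =>
    rw [mul_assoc, mul_assoc]
    refine le_trans ?_ (Nat.mul_le_mul_left p ih)
    by_cases hd : p ∣ m * b
    · rw [Nat.totient_mul_of_prime_of_dvd hp hd]
    · rw [Nat.totient_mul_of_prime_of_not_dvd hp hd]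
      exact Nat.mul_le_mul_right _ (Nat.sub_le _ _)

/-- From `φ(q) ≤ e φ(q/e)` for `e ∣ q`, together with `∑_{e ∣ q} φ(e) = q`. -/
theorem sigmaInv_mul_totient_le (q : ℕ) : sigmaInv q * q.totient ≤ q := by
  rw [sigmaInv, sum_mul]
  calc ∑ e ∈ q.divisors, (1 : ℝ) / e * q.totient ≤ ∑ e ∈ q.divisors, ((q / e).totient : ℝ) := by
        refine sum_le_sum fun e he => ?_
        have hd := Nat.dvd_of_mem_divisors he
        have he0 : (0 : ℝ) < e := by exact_mod_cast Nat.pos_of_mem_divisors he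
        have := totient_mul_le e (q / e)
        rw [Nat.mul_div_cancel' hd] at this
        rw [one_div, inv_mul_le_iff₀ he0]
        exact_mod_cast this
    _ = ∑ e ∈ q.divisors, (e.totient : ℝ) := Nat.sum_div_divisors q fun e => (e.totient : ℝ)
    _ = q := by exact_mod_cast Nat.sum_totient q

/-- The gcd is one of the common divisors `e` of `d` and `q`, so it is at most their sum. The
multiples of `e` then contribute at most `2/e`. -/
theorem sum_gcd_div_sq_le (D q : ℕ) (hq : q ≠ 0) :
    ∑ d ∈ Icc 1 D, (Nat.gcd d q : ℝ) / (d : ℝ) ^ 2 ≤ 2 * sigmaInv q := by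
  calc ∑ d ∈ Icc 1 D, (Nat.gcd d q : ℝ) / (d : ℝ) ^ 2
      ≤ ∑ d ∈ Icc 1 D, ∑ e ∈ q.divisors, (if e ∣ d then (e : ℝ) / (d : ℝ) ^ 2 else 0) := by
        refine sum_le_sum fun d _ => ?_
        have hg : Nat.gcd d q ∈ q.divisors := Nat.mem_divisors.2 ⟨Nat.gcd_dvd_right d q, hq⟩
        have := single_le_sum (f := fun e : ℕ => if e ∣ d then (e : ℝ) / (d : ℝ) ^ 2 else 0)
          (fun e _ => by split_ifs <;> positivity) hg
        simpa [Nat.gcd_dvd_left] using this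
    _ = ∑ e ∈ q.divisors, ∑ k ∈ Icc 1 (D / e), (e : ℝ) / ((k * e : ℕ) : ℝ) ^ 2 := by
        rw [sum_comm]
        refine sum_congr rfl fun e he => ?_
        rw [← sum_filter, sum_filter_dvd_eq D (Nat.pos_of_mem_divisors he)
          (fun d => (e : ℝ) / (d : ℝ) ^ 2)]
    _ ≤ ∑ e ∈ q.divisors, 2 * ((1 : ℝ) / e) := by
        refine sum_le_sum fun e he => ?_
        have he0 : (0 : ℝ) < e := by exact_mod_cast Nat.pos_of_mem_divisors he
        calc ∑ k ∈ Icc 1 (D / e), (e : ℝ) / ((k * e : ℕ) : ℝ) ^ 2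
            = (∑ k ∈ Icc 1 (D / e), 1 / (k : ℝ) ^ 2) * (1 / e) := by
              rw [sum_mul]
              refine sum_congr rfl fun k _ => ?_
              push_cast
              field_simp
          _ ≤ 2 * (1 / e) := mul_le_mul_of_nonneg_right (sum_one_div_sq_le_two _) (by positivity)
    _ = 2 * sigmaInv q := by rw [sigmaInv, mul_sum]

theorem sum_one_div_le_one_add_log (D : ℕ) : ∑ d ∈ Icc 1 D, (1 : ℝ) / d ≤ 1 + Real.log D := by
  have h := harmonic_le_one_add_log D
  rw [harmonic_eq_sum_Icc] at h
  push_cast at h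
  simpa [one_div] using h

/-- A kernel with sine bounds, weighted by `∑_{e ∣ h} 1 / e`. -/
theorem sum_sigmaInv_mul_le {A c L : ℝ} (hA : 1 ≤ A) (hc : 0 < c) (hcA : 1 ≤ 2 * c * A)
    (hL : 2 + Real.log (2 * c * A) ≤ L ∨ 1 + Real.log (2 * A) ≤ L) (hL0 : 0 ≤ L) {q : ℕ} (hq : 0 < q)
    {a : ℤ} (ha : IsCoprime a q) {F : ℕ → ℝ} (H D : ℕ)
    (hF : ∀ h ∈ Icc 1 H, 0 ≤ F h ∧ F h ≤ A ∧
      F h * |Real.sin (Real.pi * (((h * a : ℤ) : ℝ) / q))| ≤ 1 ∧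
      F h * |Real.sin (Real.pi * (((h * a : ℤ) : ℝ) / q))| ^ 2 ≤ c) :
    ∑ h ∈ Icc 1 H, sigmaInv h * F h ≤ 2 * A * H / q.totient + 2 * H * L +
      q * L * (1 + Real.log D) + 2 * A * H / (D + 1) := by
  have hA0 : 0 ≤ A := by linarith
  have hq' : (0 : ℝ) < q := by exact_mod_cast hq
  have hswap : ∑ h ∈ Icc 1 H, sigmaInv h * F h =
      ∑ d ∈ Icc 1 H, 1 / (d : ℝ) * ∑ k ∈ Icc 1 (H / d), F (k * d) :=
    sum_sum_divisors_mul H (fun d => 1 / (d : ℝ)) F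
  have hmem : ∀ d ∈ Icc 1 H, ∀ k ∈ Icc 1 (H / d), k * d ∈ Icc 1 H := by
    intro d hd k hk
    rw [mem_Icc] at *
    exact ⟨Nat.mul_pos hk.1 hd.1, (Nat.le_div_iff_mul_le hd.1).1 hk.2⟩
  have htail : ∀ d ∈ Icc 1 H, 1 / (d : ℝ) * ∑ k ∈ Icc 1 (H / d), F (k * d) ≤
      A * H * ((d : ℝ) ^ 2)⁻¹ := by
    intro d hd
    have hd0 : (0 : ℝ) < d := by exact_mod_cast (mem_Icc.1 hd).1
    have : ∑ k ∈ Icc 1 (H / d), F (k * d) ≤ A * (H / d) := by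
      calc ∑ k ∈ Icc 1 (H / d), F (k * d) ≤ ∑ k ∈ Icc 1 (H / d), A :=
            sum_le_sum fun k hk => (hF _ (hmem d hd k hk)).2.1
        _ = A * ((H / d : ℕ) : ℝ) := by simp [mul_comm]
        _ ≤ A * (H / d) := mul_le_mul_of_nonneg_left Nat.cast_div_le hA0
    calc 1 / (d : ℝ) * ∑ k ∈ Icc 1 (H / d), F (k * d) ≤ 1 / (d : ℝ) * (A * (H / d)) := by gcongr
      _ = _ := by field_simp
  -- Along multiples of `d` the phase is `k d a/q`, whose reduced denominator is `n = q / gcd(d,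
  -- q)`. The loss `gcd(d, q)` in the term `A H / (d n)` is harmless after summation over `d`.
  have hhead : ∀ d ∈ Icc 1 H, 1 / (d : ℝ) * ∑ k ∈ Icc 1 (H / d), F (k * d) ≤
      A * H / q * ((Nat.gcd d q : ℝ) / (d : ℝ) ^ 2) + H * L * (1 / (d : ℝ) ^ 2) +
        q * L * (1 / (d : ℝ)) := by
    intro d hd
    have hd1 := (mem_Icc.1 hd).1
    have hd0 : (0 : ℝ) < d := by exact_mod_cast hd1
    set g := Nat.gcd d q with hg
    have hg0 : 0 < g := Nat.gcd_pos_of_pos_left q hd1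
    have hg0' : (0 : ℝ) < g := by exact_mod_cast hg0
    obtain ⟨d', hd'⟩ : g ∣ d := Nat.gcd_dvd_left d q
    obtain ⟨n, hn⟩ : g ∣ q := Nat.gcd_dvd_right d q
    have hn0 : 0 < n := Nat.pos_of_ne_zero (by rintro rfl; simp at hn; omega)
    have hn0' : (0 : ℝ) < n := by exact_mod_cast hn0
    have hcop : Nat.Coprime d' n := by
      have h1 := Nat.coprime_div_gcd_div_gcd (m := d) (n := q) hg0
      rw [← hg] at h1
      rwa [hd', Nat.mul_div_cancel_left _ hg0, hn, Nat.mul_div_cancel_left _ hg0] at h1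
    have ha' : IsCoprime ((d' : ℤ) * a) n := by
      refine IsCoprime.mul_left (Nat.isCoprime_iff_coprime.2 hcop) ?_
      rw [hn] at ha
      push_cast at ha
      exact ha.of_mul_right_right
    have hqn : (q : ℝ) = g * n := by rw [hn]; push_cast; ring
    have hdd : (d : ℝ) = g * d' := by
      have : ((d : ℕ) : ℝ) = ((g * d' : ℕ) : ℝ) := by rw [← hd']
      rw [this]; push_cast; ring
    have hb := sum_le_of_sin_bounds hA hc hcA hL hn0 ha' (F := fun k => F (k * d)) (H / d) (by
      intro k hk
      have h1 := hF _ (hmem d hd k hk)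
      have e1 : ((((k * d : ℕ) : ℤ) * a : ℤ) : ℝ) / q = (((k : ℤ) * (d' * a) : ℤ) : ℝ) / n := by
        push_cast
        rw [hqn, hdd]
        field_simp
      rw [e1] at h1
      exact h1)
    have hX : ((H / d : ℕ) : ℝ) ≤ H / d := Nat.cast_div_le
    have hnq : (n : ℝ) ≤ q := by
      exact_mod_cast Nat.le_of_dvd hq (hn ▸ Dvd.intro_left g rfl)
    calc 1 / (d : ℝ) * ∑ k ∈ Icc 1 (H / d), F (k * d)
        ≤ 1 / (d : ℝ) * (A * (((H / d : ℕ) : ℝ) / n) + (((H / d : ℕ) : ℝ) / n + 1) * (n * L)) := by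
          gcongr
      _ ≤ 1 / (d : ℝ) * (A * ((H / d : ℝ) / n) + ((H / d : ℝ) / n + 1) * (n * L)) := by gcongr
      _ = A * H / q * ((g : ℝ) / (d : ℝ) ^ 2) + H * L * (1 / (d : ℝ) ^ 2) + n * L * (1 / (d : ℝ)) := by
          rw [hqn]; field_simp; ring
      _ ≤ _ := by gcongr
  set T : ℕ → ℝ := fun d => 1 / (d : ℝ) * ∑ k ∈ Icc 1 (H / d), F (k * d) with hT
  -- The cutoff `D` keeps `∑ 1/d` down to `1 + log D` rather than `1 + log H`. Larger `d` are left
  -- to the trivial bound, which is summable like `1/d²`.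
  have hsplit : ∑ d ∈ Icc 1 H, T d ≤
      ∑ d ∈ (Icc 1 H).filter (· ≤ D), T d + ∑ d ∈ (Icc 1 H).filter (¬ · ≤ D), T d :=
    (sum_filter_add_sum_filter_not _ _ _).ge
  have h1 : ∑ d ∈ (Icc 1 H).filter (· ≤ D), T d ≤
      2 * A * H / q.totient + 2 * H * L + q * L * (1 + Real.log D) := by
    have hsub : (Icc 1 H).filter (· ≤ D) ⊆ Icc 1 D := by
      intro d hd
      simp only [mem_filter, mem_Icc] at hd ⊢
      omega
    have hφ : (0 : ℝ) < q.totient := by exact_mod_cast Nat.totient_pos.2 hq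
    calc ∑ d ∈ (Icc 1 H).filter (· ≤ D), T d
        ≤ ∑ d ∈ (Icc 1 H).filter (· ≤ D), (A * H / q * ((Nat.gcd d q : ℝ) / (d : ℝ) ^ 2) +
            H * L * (1 / (d : ℝ) ^ 2) + q * L * (1 / (d : ℝ))) :=
          sum_le_sum fun d hd => hhead d (mem_filter.1 hd).1
      _ ≤ ∑ d ∈ Icc 1 D, (A * H / q * ((Nat.gcd d q : ℝ) / (d : ℝ) ^ 2) +
            H * L * (1 / (d : ℝ) ^ 2) + q * L * (1 / (d : ℝ))) :=
          sum_le_sum_of_subset_of_nonneg hsub fun _ _ _ => by positivity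
      _ = A * H / q * ∑ d ∈ Icc 1 D, (Nat.gcd d q : ℝ) / (d : ℝ) ^ 2 +
            H * L * ∑ d ∈ Icc 1 D, 1 / (d : ℝ) ^ 2 + q * L * ∑ d ∈ Icc 1 D, 1 / (d : ℝ) := by
          rw [sum_add_distrib, sum_add_distrib, mul_sum, mul_sum, mul_sum]
      _ ≤ A * H / q * (2 * (q / q.totient)) + H * L * 2 + q * L * (1 + Real.log D) := by
          have e1 := sum_gcd_div_sq_le D q hq.ne'
          have e2 : sigmaInv q ≤ q / q.totient := by
            rw [le_div_iff₀ hφ]; exact sigmaInv_mul_totient_le q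
          refine add_le_add (add_le_add ?_ ?_) ?_
          · exact mul_le_mul_of_nonneg_left (e1.trans (by linarith)) (by positivity)
          · exact mul_le_mul_of_nonneg_left (sum_one_div_sq_le_two D) (by positivity)
          · exact mul_le_mul_of_nonneg_left (sum_one_div_le_one_add_log D) (by positivity)
      _ = _ := by field_simp
  have h2 : ∑ d ∈ (Icc 1 H).filter (¬ · ≤ D), T d ≤ 2 * A * H / (D + 1) := by
    have hsub : (Icc 1 H).filter (¬ · ≤ D) ⊆ Ioo D (H + 1) := by
      intro d hd
      simp only [mem_filter, mem_Icc, mem_Ioo] at hd ⊢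
      omega
    calc ∑ d ∈ (Icc 1 H).filter (¬ · ≤ D), T d
        ≤ ∑ d ∈ (Icc 1 H).filter (¬ · ≤ D), A * H * ((d : ℝ) ^ 2)⁻¹ :=
          sum_le_sum fun d hd => htail d (mem_filter.1 hd).1
      _ ≤ ∑ d ∈ Ioo D (H + 1), A * H * ((d : ℝ) ^ 2)⁻¹ :=
          sum_le_sum_of_subset_of_nonneg hsub fun _ _ _ => by positivity
      _ = A * H * ∑ d ∈ Ioo D (H + 1), ((d : ℝ) ^ 2)⁻¹ := by rw [mul_sum]
      _ ≤ A * H * (2 / (D + 1)) := mul_le_mul_of_nonneg_left (sum_Ioo_inv_sq_le D (H + 1)) (by positivity)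
      _ = _ := by ring
  rw [hswap]
  linarith

/-! ### Bilinear sums over a dyadic range of primes -/

/-- `∑_m f(m) ∑_{p ∈ X} f(p) log p · ramp(mp) e(mpθ)`. -/
noncomputable def bilinearSum (f : ℕ → ℂ) (N : ℕ) (w θ : ℝ) (X : Finset ℕ) : ℂ :=
  ∑ m ∈ Icc 1 N, f m * ∑ p ∈ X, f p * Real.log p * ramp N w (m * p) * e (m * θ * p)

theorem bilinearSum_eq_of_lt (f : ℕ → ℂ) {N P : ℕ} {w : ℝ} (hw : 0 < w) (θ : ℝ) (hP : 0 < P)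
    {X : Finset ℕ} (hX : ∀ p ∈ X, P < p) :
    bilinearSum f N w θ X = ∑ m ∈ Icc 1 (N / P),
      f m * ∑ p ∈ X, f p * Real.log p * ramp N w (m * p) * e (m * θ * p) := by
  refine (sum_subset (Icc_subset_Icc_right (Nat.div_le_self N P)) fun m hm hm' => ?_).symm
  have h1 : N / P < m := by
    simp only [mem_Icc] at hm hm'
    omega
  rw [sum_eq_zero, mul_zero]
  intro p hp
  rw [ramp_eq_zero hw]
  · simp
  · have h2 : N < m * P := (Nat.div_lt_iff_lt_mul hP).1 h1
    have h3 : N ≤ m * p := h2.le.trans (Nat.mul_le_mul_left m (hX p hp).le)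
    exact_mod_cast h3

theorem norm_bilinearSum_sq_le {f : ℕ → ℂ} {B : ℝ} (hf : ∀ n, ‖f n‖ ≤ B) {N P : ℕ}
    {w : ℝ} (hw : 0 < w) (θ : ℝ) (hP : 0 < P) {X : Finset ℕ} (hX : ∀ p ∈ X, P < p ∧ p ≤ 2 * P) :
    ‖bilinearSum f N w θ X‖ ^ 2 ≤ B ^ 4 * ((N : ℝ) / P) * Real.log (2 * P) ^ 2 *
      ∑ p ∈ X, ∑ p' ∈ X, |cosKernel (fun m => ramp N w (m * p) * ramp N w (m * p')) (N / P + 1)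
        (2 * Real.pi * (((p : ℝ) - p') * θ))| := by
  have hB : 0 ≤ B := (norm_nonneg _).trans (hf 0)
  rw [bilinearSum_eq_of_lt f hw θ hP fun p hp => (hX p hp).1]
  set A : ℕ → ℂ := fun m => ∑ p ∈ X, f p * Real.log p * ramp N w (m * p) * e (m * θ * p) with hA
  have h1 : ‖∑ m ∈ Icc 1 (N / P), f m * A m‖ ≤ ∑ m ∈ Icc 1 (N / P), ‖f m‖ * ‖A m‖ :=
    (norm_sum_le _ _).trans (le_of_eq (sum_congr rfl fun m _ => norm_mul _ _))
  have h2 := sum_mul_sq_le_sq_mul_sq (Icc 1 (N / P)) (fun m => ‖f m‖) (fun m => ‖A m‖)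
  have h3 : ∑ m ∈ Icc 1 (N / P), ‖f m‖ ^ 2 ≤ B ^ 2 * ((N : ℝ) / P) := by
    calc ∑ m ∈ Icc 1 (N / P), ‖f m‖ ^ 2 ≤ ∑ m ∈ Icc 1 (N / P), B ^ 2 :=
          sum_le_sum fun m _ => by have := hf m; gcongr
      _ = B ^ 2 * ((N / P : ℕ) : ℝ) := by simp [mul_comm]
      _ ≤ _ := mul_le_mul_of_nonneg_left Nat.cast_div_le (by positivity)
  -- One extra index makes the last weight vanish, as the summations by parts require.
  have h4 : ∑ m ∈ Icc 1 (N / P), ‖A m‖ ^ 2 ≤ ∑ m ∈ Icc 1 (N / P + 1), ‖A m‖ ^ 2 :=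
    sum_le_sum_of_subset_of_nonneg (Icc_subset_Icc_right (Nat.le_succ _)) fun _ _ _ => sq_nonneg _
  have h5 := sum_norm_sq_le_cosKernel X (fun p => f p * Real.log p)
    (fun m p => ramp N w (m * p)) (N / P + 1) θ
  have hc : ∀ p ∈ X, ‖f p * (Real.log p : ℂ)‖ ≤ B * Real.log (2 * P) := by
    intro p hp
    have hp' := hX p hp
    have hp1 : (1 : ℝ) ≤ p := by exact_mod_cast (by omega : 1 ≤ p)
    rw [norm_mul, Complex.norm_real, Real.norm_of_nonneg (Real.log_nonneg hp1)]
    have : (p : ℝ) ≤ 2 * P := by exact_mod_cast hp'.2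
    have := Real.log_le_log (by linarith) this
    exact mul_le_mul (hf p) this (Real.log_nonneg hp1) hB
  have h6 : ∑ p ∈ X, ∑ p' ∈ X, ‖f p * (Real.log p : ℂ)‖ * ‖f p' * (Real.log p' : ℂ)‖ *
      |cosKernel (fun m => ramp N w (m * p) * ramp N w (m * p')) (N / P + 1)
        (2 * Real.pi * (((p : ℝ) - p') * θ))| ≤ (B * Real.log (2 * P)) ^ 2 *
      ∑ p ∈ X, ∑ p' ∈ X, |cosKernel (fun m => ramp N w (m * p) * ramp N w (m * p')) (N / P + 1)
        (2 * Real.pi * (((p : ℝ) - p') * θ))| := by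
    rw [mul_sum]
    refine sum_le_sum fun p hp => ?_
    rw [mul_sum]
    refine sum_le_sum fun p' hp' => ?_
    refine mul_le_mul_of_nonneg_right ?_ (abs_nonneg _)
    rw [sq]
    exact mul_le_mul (hc p hp) (hc p' hp') (norm_nonneg _) ((norm_nonneg _).trans (hc p hp))
  set K := ∑ p ∈ X, ∑ p' ∈ X, |cosKernel (fun m => ramp N w (m * p) * ramp N w (m * p')) (N / P + 1)
        (2 * Real.pi * (((p : ℝ) - p') * θ))|
  have hK : ∑ m ∈ Icc 1 (N / P), ‖A m‖ ^ 2 ≤ (B * Real.log (2 * P)) ^ 2 * K :=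
    h4.trans (h5.trans h6)
  calc ‖∑ m ∈ Icc 1 (N / P), f m * A m‖ ^ 2 ≤ (∑ m ∈ Icc 1 (N / P), ‖f m‖ * ‖A m‖) ^ 2 := by gcongr
    _ ≤ _ := h2
    _ ≤ (B ^ 2 * ((N : ℝ) / P)) * ((B * Real.log (2 * P)) ^ 2 * K) := by
        refine mul_le_mul h3 hK (sum_nonneg fun _ _ => sq_nonneg _) (by positivity)
    _ = _ := by ring

/-- An even majorant, as a function of the difference, of the kernels of a dyadic block. -/
noncomputable def kernelMajorant (A c α : ℝ) : ℝ :=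
  if Real.sin α = 0 then A else min A (min (1 / |Real.sin α|) (c / |Real.sin α| ^ 2))

theorem le_kernelMajorant {A c α x : ℝ} (h1 : x ≤ A) (h2 : x * |Real.sin α| ≤ 1)
    (h3 : x * |Real.sin α| ^ 2 ≤ c) : x ≤ kernelMajorant A c α := by
  unfold kernelMajorant
  split_ifs with h
  · exact h1
  · have : 0 < |Real.sin α| := abs_pos.2 h
    exact le_min h1 (le_min ((le_div_iff₀ this).2 h2) ((le_div_iff₀ (by positivity)).2 h3))

theorem kernelMajorant_bounds {A c : ℝ} (hA : 0 ≤ A) (hc : 0 ≤ c) (α : ℝ) :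
    0 ≤ kernelMajorant A c α ∧ kernelMajorant A c α ≤ A ∧
      kernelMajorant A c α * |Real.sin α| ≤ 1 ∧ kernelMajorant A c α * |Real.sin α| ^ 2 ≤ c := by
  unfold kernelMajorant
  split_ifs with h
  · simp [h, hA, hc]
  · have : 0 < |Real.sin α| := abs_pos.2 h
    refine ⟨le_min hA (le_min (by positivity) (by positivity)), min_le_left _ _, ?_, ?_⟩
    · rw [← le_div_iff₀ this]
      exact (min_le_right _ _).trans (min_le_left _ _)
    · rw [← le_div_iff₀ (by positivity)]
      exact (min_le_right _ _).trans (min_le_right _ _)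

theorem kernelMajorant_neg (A c α : ℝ) : kernelMajorant A c (-α) = kernelMajorant A c α := by
  simp [kernelMajorant]

/-- A double sum of a function of `|p - p'|` in terms of the number of representations. -/
theorem sum_sum_dist_eq {P : ℕ} {X : Finset ℕ} (hX : ∀ p ∈ X, P < p ∧ p ≤ 2 * P) (F : ℕ → ℝ) :
    ∑ p ∈ X, ∑ p' ∈ X, F (Nat.dist p p') =
      X.card * F 0 + 2 * ∑ h ∈ Icc 1 P, ((X.filter (· + h ∈ X)).card : ℝ) * F h := by
  have hlt : ∑ p ∈ X, ∑ p' ∈ X.filter (p < ·), F (Nat.dist p p') =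
      ∑ h ∈ Icc 1 P, ((X.filter (· + h ∈ X)).card : ℝ) * F h := by
    have h1 : ∀ h ∈ Icc 1 P, ((X.filter (· + h ∈ X)).card : ℝ) * F h =
        ∑ p ∈ X, if p + h ∈ X then F h else 0 := by
      intro h _
      rw [← sum_filter, sum_const, nsmul_eq_mul]
    rw [sum_congr rfl h1, sum_comm]
    refine sum_congr rfl fun p hp => ?_
    rw [← sum_filter]
    refine sum_nbij' (fun p' => p' - p) (fun h => p + h) ?_ ?_ ?_ ?_ ?_
    · intro p' hp'
      rw [mem_filter] at hp'
      have e1 := hX p hp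
      have e2 := hX p' hp'.1
      rw [mem_filter, mem_Icc, Nat.add_sub_cancel' hp'.2.le]
      exact ⟨by omega, hp'.1⟩
    · intro h hh
      rw [mem_filter, mem_Icc] at hh
      rw [mem_filter]
      exact ⟨hh.2, by omega⟩
    · intro p' hp'
      exact Nat.add_sub_cancel' (mem_filter.1 hp').2.le
    · intro h _
      exact Nat.add_sub_cancel_left p h
    · intro p' hp'
      rw [Nat.dist_eq_sub_of_le (mem_filter.1 hp').2.le]
  have hgt : ∑ p ∈ X, ∑ p' ∈ X.filter (· < p), F (Nat.dist p p') =
      ∑ p ∈ X, ∑ p' ∈ X.filter (p < ·), F (Nat.dist p p') := by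
    simp only [sum_filter]
    rw [sum_comm]
    refine sum_congr rfl fun p _ => sum_congr rfl fun p' _ => ?_
    rw [Nat.dist_comm]
  have hsplit : ∀ p ∈ X, ∑ p' ∈ X, F (Nat.dist p p') =
      F 0 + ∑ p' ∈ X.filter (p < ·), F (Nat.dist p p') +
        ∑ p' ∈ X.filter (· < p), F (Nat.dist p p') := by
    intro p hp
    have : F 0 = ∑ p' ∈ X, if p' = p then F (Nat.dist p p') else 0 := by
      rw [sum_ite_eq' X p, if_pos hp, Nat.dist_self]
    rw [this, sum_filter, sum_filter, ← sum_add_distrib, ← sum_add_distrib]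
    refine sum_congr rfl fun p' _ => ?_
    rcases lt_trichotomy p p' with h | h | h
    · simp [h, h.ne', h.not_gt]
    · simp [h]
    · simp [h, h.ne, h.not_gt]
  rw [sum_congr rfl hsplit, sum_add_distrib, sum_add_distrib, hgt, hlt, sum_const, nsmul_eq_mul]
  ring

/-- The primes in `(2^j, 2^(j+1)]`. -/
def dyadicPrimes (j : ℕ) : Finset ℕ := (Ioc (2 ^ j) (2 * 2 ^ j)).filter Nat.Prime

theorem sum_abs_cosKernel_le {N q j : ℕ} (hq : 0 < q) (hqN : q ≤ N) (hj : 130 ≤ j)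
    (hjN : 4 * 2 ^ j ≤ N) {a : ℤ} (ha : IsCoprime a q) {L : ℝ} (hL0 : 0 ≤ L)
    (hL : 2 + Real.log (48 * (N / q)) ≤ L ∨ 1 + Real.log (6 * ((N : ℝ) / 2 ^ j)) ≤ L) :
    ∑ p ∈ dyadicPrimes j, ∑ p' ∈ dyadicPrimes j,
      |cosKernel (fun m => ramp N q (m * p) * ramp N q (m * p')) (N / 2 ^ j + 1)
        (2 * Real.pi * (((p : ℝ) - p') * (a / q)))| ≤
      3 * N + 402 * ((2 : ℝ) ^ j / Real.log ((2 : ℝ) ^ j) ^ 2) *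
        (6 * N / q.totient + 2 * 2 ^ j * L + q * L * (1 + Real.log (N / q)) + 6 * q) := by
  set P := 2 ^ j with hP
  have hP0 : 0 < P := by positivity
  have hPr : (P : ℝ) = 2 ^ j := by rw [hP]; push_cast; rfl
  rw [← hPr] at hL ⊢
  have hP0' : (0 : ℝ) < P := by exact_mod_cast hP0
  have hq' : (0 : ℝ) < q := by exact_mod_cast hq
  have hN0 : 0 < N := by omega
  have hN' : (0 : ℝ) < N := by exact_mod_cast hN0
  have hjN' : 4 * (P : ℝ) ≤ N := by exact_mod_cast hjN
  have hM4 : 4 ≤ (N : ℝ) / P := by rw [le_div_iff₀ hP0']; exact hjN'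
  have hqN' : (q : ℝ) ≤ N := by exact_mod_cast hqN
  have hR1 : 1 ≤ (N : ℝ) / q := by rw [le_div_iff₀ hq']; linarith
  set A : ℝ := 3 * ((N : ℝ) / P) with hA
  set c : ℝ := 8 * P / q with hc
  have hA1 : 1 ≤ A := by linarith
  have hA0 : 0 ≤ A := by linarith
  have hc0 : 0 < c := by positivity
  have hcAeq : 2 * c * A = 48 * (N / q) := by rw [hA, hc]; field_simp; norm_num
  have hcA : 1 ≤ 2 * c * A := by rw [hcAeq]; linarith
  have hL' : 2 + Real.log (2 * c * A) ≤ L ∨ 1 + Real.log (2 * A) ≤ L := by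
    rw [hcAeq, show 2 * A = 6 * ((N : ℝ) / P) by rw [hA]; ring]
    exact hL
  set F : ℕ → ℝ := fun h => kernelMajorant A c (Real.pi * (((h * a : ℤ) : ℝ) / q)) with hF
  have hmem : ∀ p ∈ dyadicPrimes j, P < p ∧ p ≤ 2 * P := fun p hp =>
    mem_Ioc.1 (mem_filter.1 hp).1
  have hker : ∀ p ∈ dyadicPrimes j, ∀ p' ∈ dyadicPrimes j,
      |cosKernel (fun m => ramp N q (m * p) * ramp N q (m * p')) (N / P + 1)
        (2 * Real.pi * (((p : ℝ) - p') * (a / q)))| ≤ F (Nat.dist p p') := by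
    intro p hp p' hp'
    have e1 := hmem p hp
    have e2 := hmem p' hp'
    have f1 : (P : ℝ) ≤ p := by exact_mod_cast e1.1.le
    have f2 : (p : ℝ) ≤ 2 * P := by exact_mod_cast e1.2
    have f3 : (P : ℝ) ≤ p' := by exact_mod_cast e2.1.le
    have f4 : (p' : ℝ) ≤ 2 * P := by exact_mod_cast e2.2
    have hH : (N : ℝ) ≤ ((N / P + 1 : ℕ) : ℝ) * P := by
      have := Nat.lt_div_mul_add hP0 (a := N)
      exact_mod_cast (by rw [Nat.add_mul, one_mul]; exact this.le : N ≤ (N / P + 1) * P)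
    obtain ⟨b1, b2, b3⟩ := cosKernel_ramp_bounds (X := N) (w := q) hq' hP0' f1 f2 f3 f4 hH
      (2 * Real.pi * (((p : ℝ) - p') * (a / q)))
    have hhalf : 2 * Real.pi * (((p : ℝ) - p') * (a / q)) / 2 =
        Real.pi * (((p : ℝ) - p') * (a / q)) := by ring
    rw [hhalf] at b2 b3
    rw [← sq_abs (Real.sin _)] at b3
    have hFeq : F (Nat.dist p p') = kernelMajorant A c (Real.pi * (((p : ℝ) - p') * (a / q))) := by
      simp only [hF]
      rcases le_total p p' with h | h
      · rw [Nat.dist_eq_sub_of_le h, ← kernelMajorant_neg]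
        congr 1
        push_cast [Nat.cast_sub h]
        ring
      · rw [Nat.dist_eq_sub_of_le_right h]
        congr 1
        push_cast [Nat.cast_sub h]
        ring
    rw [hFeq]
    refine le_kernelMajorant (b1.trans ?_) b2 b3
    have : ((N / P : ℕ) : ℝ) ≤ (N : ℝ) / P := Nat.cast_div_le
    push_cast
    linarith
  have hFb : ∀ h, 0 ≤ F h ∧ F h ≤ A ∧
      F h * |Real.sin (Real.pi * (((h * a : ℤ) : ℝ) / q))| ≤ 1 ∧
      F h * |Real.sin (Real.pi * (((h * a : ℤ) : ℝ) / q))| ^ 2 ≤ c :=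
    fun h => kernelMajorant_bounds hA0 hc0.le _
  -- The choice `D = ⌊N/q⌋` brings the tail `6N/(D + 1)` below `6q` and costs only `log(N/q)` in the
  -- head.
  have hG := sum_sigmaInv_mul_le hA1 hc0 hcA hL' hL0 hq ha P (⌊(N : ℝ) / q⌋₊) (F := F)
    fun h _ => hFb h
  set Y := (P : ℝ) / Real.log (P : ℝ) ^ 2 with hY
  have hY0 : 0 ≤ Y := by positivity
  have hcount : ∀ h ∈ Icc 1 P,
      (((dyadicPrimes j).filter (· + h ∈ dyadicPrimes j)).card : ℝ) ≤ 201 * sigmaInv h * Y := by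
    intro h hh
    have h0 : h ≠ 0 := by have := mem_Icc.1 hh; omega
    have h1 := card_prime_pairs_le hj h0
    rw [← hPr] at h1
    refine le_trans ?_ h1
    norm_cast
    refine card_le_card fun p hp => ?_
    simp only [dyadicPrimes, mem_filter] at hp ⊢
    exact ⟨hp.1.1, hp.1.2, hp.2.2⟩
  have hcardX : ((dyadicPrimes j).card : ℝ) ≤ P := by
    have h1 : (dyadicPrimes j).card ≤ (Ioc P (2 * P)).card := card_filter_le _ _
    rw [Nat.card_Ioc] at h1
    exact_mod_cast (by omega : (dyadicPrimes j).card ≤ P)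
  have hAP : A * P = 3 * N := by rw [hA]; field_simp
  calc _ ≤ ∑ p ∈ dyadicPrimes j, ∑ p' ∈ dyadicPrimes j, F (Nat.dist p p') :=
        sum_le_sum fun p hp => sum_le_sum fun p' hp' => hker p hp p' hp'
    _ = (dyadicPrimes j).card * F 0 + 2 * ∑ h ∈ Icc 1 P,
          (((dyadicPrimes j).filter (· + h ∈ dyadicPrimes j)).card : ℝ) * F h :=
        sum_sum_dist_eq hmem F
    _ ≤ P * A + 2 * ∑ h ∈ Icc 1 P, 201 * sigmaInv h * Y * F h := by
        refine add_le_add (mul_le_mul hcardX (hFb 0).2.1 (hFb 0).1 hP0'.le) ?_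
        refine mul_le_mul_of_nonneg_left (sum_le_sum fun h hh => ?_) (by norm_num)
        exact mul_le_mul_of_nonneg_right (hcount h hh) (hFb h).1
    _ = 3 * N + 402 * Y * ∑ h ∈ Icc 1 P, sigmaInv h * F h := by
        rw [mul_comm (P : ℝ) A, hAP, mul_sum, mul_sum]
        congr 1
        exact sum_congr rfl fun h _ => by ring
    _ ≤ 3 * N + 402 * Y * (6 * N / q.totient + 2 * P * L + q * L * (1 + Real.log (N / q)) + 6 * q) := by
        have hfl : ((⌊(N : ℝ) / q⌋₊ : ℕ) : ℝ) ≤ N / q := Nat.floor_le (by positivity)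
        have hfl' : (N : ℝ) / q < ⌊(N : ℝ) / q⌋₊ + 1 := Nat.lt_floor_add_one _
        have hfl1 : (1 : ℝ) ≤ (⌊(N : ℝ) / q⌋₊ : ℕ) := by
          exact_mod_cast Nat.one_le_floor_iff _ |>.2 hR1
        have t1 : 2 * A * P / (⌊(N : ℝ) / q⌋₊ + 1) ≤ 6 * q := by
          rw [div_le_iff₀ (by positivity), show 2 * A * P = 6 * N by linarith]
          have : (N : ℝ) = q * (N / q) := by field_simp
          nlinarith
        have t2 : Real.log (⌊(N : ℝ) / q⌋₊ : ℕ) ≤ Real.log (N / q) :=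
          Real.log_le_log (by linarith) hfl
        have t3 : 2 * A * P / q.totient = 6 * N / q.totient := by
          rw [show 2 * A * P = 6 * N by linarith]
        have t4 : q * L * (1 + Real.log (⌊(N : ℝ) / q⌋₊ : ℕ)) ≤ q * L * (1 + Real.log (N / q)) := by
          have : 0 ≤ q * L := by positivity
          nlinarith
        rw [t3] at hG
        have hG' : ∑ h ∈ Icc 1 P, sigmaInv h * F h ≤
            6 * N / q.totient + 2 * P * L + q * L * (1 + Real.log (N / q)) + 6 * q := by linarith
        have : 0 ≤ 402 * Y := by positivity
        nlinarith

theorem log_two_mul_sq_mul_le {j : ℕ} (hj : 130 ≤ j) :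
    Real.log (2 * (2 : ℝ) ^ j) ^ 2 * ((2 : ℝ) ^ j / Real.log ((2 : ℝ) ^ j) ^ 2) ≤ 1.016 * 2 ^ j := by
  have hl2 : 0 < Real.log 2 := Real.log_pos (by norm_num)
  have hj' : (130 : ℝ) ≤ j := by exact_mod_cast hj
  have e1 : Real.log (2 * (2 : ℝ) ^ j) = (j + 1) * Real.log 2 := by
    rw [← pow_succ', Real.log_pow]; push_cast; ring
  have e2 : Real.log ((2 : ℝ) ^ j) = j * Real.log 2 := Real.log_pow _ _
  rw [e1, e2]
  have e3 : ((j + 1) * Real.log 2) ^ 2 * ((2 : ℝ) ^ j / (j * Real.log 2) ^ 2) =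
      ((j + 1) ^ 2 / (j : ℝ) ^ 2) * 2 ^ j := by field_simp
  rw [e3]
  refine mul_le_mul_of_nonneg_right ?_ (by positivity)
  rw [div_le_iff₀ (by positivity)]
  nlinarith

/-- The mean square bound for the bilinear sum over one dyadic range. -/
theorem norm_bilinearSum_dyadic_sq_le {f : ℕ → ℂ} {B : ℝ} (hf : ∀ n, ‖f n‖ ≤ B) {N q j : ℕ}
    (hq : 0 < q) (hqN : q ≤ N) (hj : 130 ≤ j) (hjN : 4 * 2 ^ j ≤ N) {a : ℤ} (ha : IsCoprime a q) :
    ‖bilinearSum f N q (a / q) (dyadicPrimes j)‖ ^ 2 ≤ B ^ 4 * (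
      3 * (N : ℝ) ^ 2 * (Real.log (2 * 2 ^ j) ^ 2 / 2 ^ j) + 2454 * ((N : ℝ) ^ 2 / q.totient) +
      818 * (N : ℝ) ^ 2 * ((2 : ℝ) ^ j / N * (1 + Real.log (6 * ((N : ℝ) / 2 ^ j)))) +
      409 * (N * q) * ((Real.log (N / q) + 6) * (Real.log (N / q) + 3) + 6)) := by
  have hq' : (0 : ℝ) < q := by exact_mod_cast hq
  have hN' : (0 : ℝ) < N := by exact_mod_cast (by omega : 0 < N)
  have hqN' : (q : ℝ) ≤ N := by exact_mod_cast hqN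
  have hP0' : (0 : ℝ) < 2 ^ j := by positivity
  have hjN' : 4 * (2 : ℝ) ^ j ≤ N := by exact_mod_cast hjN
  have hM4 : 4 ≤ (N : ℝ) / 2 ^ j := by rw [le_div_iff₀ hP0']; exact hjN'
  have hR1 : 1 ≤ (N : ℝ) / q := by rw [le_div_iff₀ hq']; linarith
  set x := Real.log (N / q) with hx
  have hx0 : 0 ≤ x := Real.log_nonneg hR1
  set L₁ := 1 + Real.log (6 * ((N : ℝ) / 2 ^ j)) with hL₁
  have hL₁0 : 0 ≤ L₁ := by
    have := Real.log_nonneg (show 1 ≤ 6 * ((N : ℝ) / 2 ^ j) by linarith)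
    linarith
  have hexp4 : Real.log 48 ≤ 4 := by
    rw [Real.log_le_iff_le_exp (by norm_num)]
    have := Real.exp_one_gt_d9
    calc (48 : ℝ) ≤ 2.7 ^ 4 := by norm_num
      _ ≤ Real.exp 1 ^ 4 := by gcongr; linarith
      _ = Real.exp 4 := by rw [← Real.exp_nat_mul]; norm_num
  -- For `2^j ≤ q` the smoothed bound gives `L = log(N/q) + 6`, as `2 + log 48 ≤ 6`. For larger
  -- blocks `log(N/2^j)` is already at most `log(N/q)`, and the unsmoothed bound is used. In both
  -- cases `L ≤ x + 6`.
  obtain ⟨L, hL0, hL, hLx, hLP⟩ : ∃ L : ℝ, 0 ≤ L ∧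
      (2 + Real.log (48 * (N / q)) ≤ L ∨ 1 + Real.log (6 * ((N : ℝ) / 2 ^ j)) ≤ L) ∧
      L ≤ x + 6 ∧ 2 * 2 ^ j * L ≤ 2 * 2 ^ j * L₁ + 2 * q * (x + 6) := by
    rcases le_total ((2 : ℝ) ^ j) q with h | h
    · refine ⟨x + 6, by linarith, Or.inl ?_, le_rfl, ?_⟩
      · rw [Real.log_mul (by norm_num) (by positivity)]
        linarith
      · have : 0 ≤ 2 * 2 ^ j * L₁ := by positivity
        nlinarith
    · refine ⟨L₁, hL₁0, Or.inr le_rfl, ?_, ?_⟩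
      · rw [hL₁, Real.log_mul (by norm_num) (by positivity)]
        have e1 : Real.log 6 ≤ Real.log 48 := Real.log_le_log (by norm_num) (by norm_num)
        have e2 : Real.log ((N : ℝ) / 2 ^ j) ≤ x := Real.log_le_log (by positivity) (by gcongr)
        linarith
      · have : 0 ≤ 2 * q * (x + 6) := by positivity
        linarith
  have hmem : ∀ p ∈ dyadicPrimes j, 2 ^ j < p ∧ p ≤ 2 * 2 ^ j := fun p hp =>
    mem_Ioc.1 (mem_filter.1 hp).1
  have h1 := norm_bilinearSum_sq_le hf hq' ((a : ℝ) / q) (by positivity : 0 < 2 ^ j) hmem (N := N)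
  have h2 := sum_abs_cosKernel_le hq hqN hj hjN ha hL0 hL
  have h3 := log_two_mul_sq_mul_le hj
  push_cast at h1
  set Y := (2 : ℝ) ^ j / Real.log ((2 : ℝ) ^ j) ^ 2 with hY
  set l := Real.log (2 * (2 : ℝ) ^ j) with hl
  set G := 6 * (N : ℝ) / q.totient + 2 * 2 ^ j * L + q * L * (1 + x) + 6 * q with hG
  have hG0 : 0 ≤ G := by positivity
  have hGle : G ≤ 6 * (N : ℝ) / q.totient + 2 * 2 ^ j * L₁ + q * ((x + 6) * (x + 3) + 6) := by
    have : q * L * (1 + x) ≤ q * (x + 6) * (1 + x) := by gcongr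
    rw [hG]; nlinarith
  have hB4 : 0 ≤ B ^ 4 := by positivity
  refine h1.trans ?_
  calc B ^ 4 * ((N : ℝ) / 2 ^ j) * l ^ 2 * _
      ≤ B ^ 4 * ((N : ℝ) / 2 ^ j) * l ^ 2 * (3 * N + 402 * Y * G) := by
        refine mul_le_mul_of_nonneg_left h2 (by positivity)
    _ = B ^ 4 * (3 * (N : ℝ) ^ 2 * (l ^ 2 / 2 ^ j) + 402 * (N / 2 ^ j) * G * (l ^ 2 * Y)) := by ring
    _ ≤ B ^ 4 * (3 * (N : ℝ) ^ 2 * (l ^ 2 / 2 ^ j) + 402 * (N / 2 ^ j) * G * (1.016 * 2 ^ j)) := by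
        gcongr
    _ = B ^ 4 * (3 * (N : ℝ) ^ 2 * (l ^ 2 / 2 ^ j) + (402 * 1.016) * N * G) := by
        congr 2; field_simp
    -- `402 · 1.016 < 409`; the constants `2454` and `818` in the statement are `6 · 409` and `2 ·
    -- 409`.
    _ ≤ B ^ 4 * (3 * (N : ℝ) ^ 2 * (l ^ 2 / 2 ^ j) + 409 * N *
          (6 * (N : ℝ) / q.totient + 2 * 2 ^ j * L₁ + q * ((x + 6) * (x + 3) + 6))) := by
        gcongr
        norm_num
    _ = _ := by field_simp; ring

/-! ### Geometric decay within the middle range and summation over blocks -/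

theorem three_mul_sq_le_pow {j : ℕ} (hj : 130 ≤ j) : 3 * ((j : ℝ) + 1) ^ 2 ≤ 1.62 ^ j := by
  induction j, hj using Nat.le_induction with
  | base => norm_num
  | succ n hn ih =>
    have : (130 : ℝ) ≤ n := by exact_mod_cast hn
    rw [pow_succ (1.62 : ℝ)]
    push_cast
    nlinarith

theorem log_sq_div_two_pow_le {j : ℕ} (hj : 130 ≤ j) :
    3 * (Real.log (2 * 2 ^ j) ^ 2 / 2 ^ j) ≤ ((0.9 : ℝ) ^ j) ^ 2 := by
  have e1 : Real.log (2 * (2 : ℝ) ^ j) = (j + 1) * Real.log 2 := by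
    rw [← pow_succ', Real.log_pow]; push_cast; ring
  have hl2 : 0 < Real.log 2 := Real.log_pos (by norm_num)
  have hl2' : Real.log 2 ≤ 1 := by have := Real.log_two_lt_d9; linarith
  have h1 := three_mul_sq_le_pow hj
  have h2 : ((j + 1) * Real.log 2) ^ 2 ≤ ((j : ℝ) + 1) ^ 2 := by
    have : (j + 1) * Real.log 2 ≤ (j : ℝ) + 1 := by nlinarith [(Nat.cast_nonneg j : (0 : ℝ) ≤ j)]
    gcongr
  rw [e1, ← mul_div_assoc, div_le_iff₀ (by positivity), ← pow_mul, mul_comm j 2, pow_mul, ← mul_pow]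
  norm_num at h1 ⊢
  linarith

/-- `(1 + log(6t))/t` is `O(t^(-1/2))` for `t = N/2^j`, hence geometrically small in `J - j`. The
margin `2^50` between `2^J` and `N` absorbs the constant. -/
theorem log_div_le_pow {N j J : ℕ} (hjJ : j < J) (hJ : 2 ^ (J + 50) ≤ N) :
    818 * ((2 : ℝ) ^ j / N * (1 + Real.log (6 * ((N : ℝ) / 2 ^ j)))) ≤ ((0.9 : ℝ) ^ (J - j)) ^ 2 := by
  set t : ℝ := (N : ℝ) / 2 ^ j with ht
  obtain ⟨k, hk⟩ := Nat.exists_eq_add_of_lt hjJ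
  have hk' : J - j = k + 1 := by omega
  have hJ' : (2 : ℝ) ^ (J + 50) ≤ N := by exact_mod_cast hJ
  have ht2 : (2 : ℝ) ^ (k + 51) ≤ t := by
    rw [ht, le_div_iff₀ (by positivity), ← pow_add]
    refine le_trans (le_of_eq ?_) hJ'
    congr 1; omega
  have ht1 : 1 ≤ t := (one_le_pow₀ (by norm_num)).trans ht2
  -- `4908 = 818 · 6`, the `6` coming from `1 + log(6t) ≤ 6√t`. The ratio works because `0.9⁻⁴ < 2`.
  have hs : (4908 : ℝ) * ((0.9 : ℝ) ^ (k + 1))⁻¹ ^ 2 ≤ Real.sqrt t := by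
    apply Real.le_sqrt_of_sq_le
    refine le_trans ?_ ht2
    have e1 : ((4908 : ℝ) * ((0.9 : ℝ) ^ (k + 1))⁻¹ ^ 2) ^ 2 = 4908 ^ 2 * ((0.9⁻¹ : ℝ) ^ 4) ^ (k + 1) := by
      rw [mul_pow, ← pow_mul, ← inv_pow, ← pow_mul, ← pow_mul]
      congr 2; ring
    have e2 : (2 : ℝ) ^ (k + 51) = 2 ^ 50 * 2 ^ (k + 1) := by rw [← pow_add]; congr 1; omega
    rw [e1, e2]
    refine mul_le_mul (by norm_num) ?_ (by positivity) (by positivity)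
    exact pow_le_pow_left₀ (by positivity) (by norm_num) _
  have hst : 1 ≤ Real.sqrt t := Real.one_le_sqrt.2 ht1
  have hsq : Real.sqrt t ^ 2 = t := Real.sq_sqrt (by linarith)
  have hlog : 1 + Real.log (6 * t) ≤ 6 * Real.sqrt t := by
    have e : Real.log (6 * t) = 2 * Real.log (Real.sqrt (6 * t)) := by
      rw [Real.log_sqrt (by linarith)]; ring
    have h1 := Real.log_le_sub_one_of_pos (Real.sqrt_pos.2 (show 0 < 6 * t by linarith))
    have h2 : Real.sqrt (6 * t) ≤ 3 * Real.sqrt t := by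
      rw [Real.sqrt_le_left (by positivity), mul_pow, hsq]; linarith
    rw [e]; linarith
  have hinv : (2 : ℝ) ^ j / N = 1 / t := by rw [ht, one_div_div]
  rw [hinv, hk']
  have hp : (0 : ℝ) < 0.9 ^ (k + 1) := by positivity
  calc 818 * (1 / t * (1 + Real.log (6 * t))) ≤ 818 * (1 / t * (6 * Real.sqrt t)) := by gcongr
    _ = 4908 / Real.sqrt t := by
        have hne : Real.sqrt t ≠ 0 := by linarith
        nth_rewrite 1 [← hsq]
        field_simp; norm_num
    _ ≤ ((0.9 : ℝ) ^ (k + 1)) ^ 2 := by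
        rw [div_le_iff₀ (by linarith)]
        have : 4908 = ((0.9 : ℝ) ^ (k + 1)) ^ 2 * (4908 * ((0.9 : ℝ) ^ (k + 1))⁻¹ ^ 2) := by
          field_simp
        rw [this]
        gcongr

/-- Square root of the mean square bound, each of its four terms being at most the square of one
summand here; `2454 < 50²`. -/
theorem norm_bilinearSum_dyadic_le {f : ℕ → ℂ} {B : ℝ} (hf : ∀ n, ‖f n‖ ≤ B) {N q j J : ℕ}
    (hq : 0 < q) (hqN : q ≤ N) (hj : 130 ≤ j) (hjJ : j < J) (hJ : 2 ^ (J + 50) ≤ N)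
    {a : ℤ} (ha : IsCoprime a q) :
    ‖bilinearSum f N q (a / q) (dyadicPrimes j)‖ ≤ B ^ 2 * (
      N * 0.9 ^ j + N * 0.9 ^ (J - j) + 50 * (N / Real.sqrt q.totient) +
      Real.sqrt (409 * (N * q) * ((Real.log (N / q) + 6) * (Real.log (N / q) + 3) + 6))) := by
  have hq' : (0 : ℝ) < q := by exact_mod_cast hq
  have hN' : (0 : ℝ) < N := by exact_mod_cast (by omega : 0 < N)
  have hqN' : (q : ℝ) ≤ N := by exact_mod_cast hqN
  have hR1 : 1 ≤ (N : ℝ) / q := by rw [le_div_iff₀ hq']; linarith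
  have hx0 : 0 ≤ Real.log (N / q) := Real.log_nonneg hR1
  have hjN : 4 * 2 ^ j ≤ N := by
    refine le_trans ?_ hJ
    rw [show 4 = 2 ^ 2 by norm_num, ← pow_add]
    exact Nat.pow_le_pow_right (by norm_num) (by omega)
  have h1 := norm_bilinearSum_dyadic_sq_le hf hq hqN hj hjN ha
  have h2 := log_sq_div_two_pow_le hj
  have h3 := log_div_le_pow hjJ hJ
  set x := Real.log (N / q)
  set W := Real.sqrt (409 * (N * q) * ((x + 6) * (x + 3) + 6)) with hW
  have hWsq : W ^ 2 = 409 * (N * q) * ((x + 6) * (x + 3) + 6) := Real.sq_sqrt (by positivity)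
  have hφ : (0 : ℝ) < q.totient := by exact_mod_cast Nat.totient_pos.2 hq
  have hφsq : Real.sqrt q.totient ^ 2 = q.totient := Real.sq_sqrt hφ.le
  set u : ℝ := N * 0.9 ^ j
  set v : ℝ := N * 0.9 ^ (J - j)
  set s : ℝ := 50 * (N / Real.sqrt q.totient) with hs
  have hssq : s ^ 2 = 2500 * ((N : ℝ) ^ 2 / q.totient) := by
    rw [hs, mul_pow, div_pow, hφsq]; norm_num
  have hu0 : 0 ≤ u := by positivity
  have hv0 : 0 ≤ v := by positivity
  have hs0 : 0 ≤ s := by positivity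
  have hW0 : 0 ≤ W := Real.sqrt_nonneg _
  have hB4 : 0 ≤ B ^ 4 := by positivity
  have hle : ‖bilinearSum f N q (a / q) (dyadicPrimes j)‖ ^ 2 ≤ (B ^ 2 * (u + v + s + W)) ^ 2 := by
    refine h1.trans ?_
    rw [mul_pow, ← pow_mul]
    refine mul_le_mul_of_nonneg_left ?_ hB4
    have a1 : 3 * (N : ℝ) ^ 2 * (Real.log (2 * 2 ^ j) ^ 2 / 2 ^ j) ≤ u ^ 2 := by
      calc 3 * (N : ℝ) ^ 2 * (Real.log (2 * 2 ^ j) ^ 2 / 2 ^ j)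
          = (N : ℝ) ^ 2 * (3 * (Real.log (2 * 2 ^ j) ^ 2 / 2 ^ j)) := by ring
        _ ≤ (N : ℝ) ^ 2 * ((0.9 : ℝ) ^ j) ^ 2 := by gcongr
        _ = u ^ 2 := by rw [← mul_pow]
    have a2 : 818 * (N : ℝ) ^ 2 * ((2 : ℝ) ^ j / N * (1 + Real.log (6 * ((N : ℝ) / 2 ^ j)))) ≤ v ^ 2 := by
      calc 818 * (N : ℝ) ^ 2 * ((2 : ℝ) ^ j / N * (1 + Real.log (6 * ((N : ℝ) / 2 ^ j))))
          = (N : ℝ) ^ 2 * (818 * ((2 : ℝ) ^ j / N * (1 + Real.log (6 * ((N : ℝ) / 2 ^ j))))) := by ring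
        _ ≤ (N : ℝ) ^ 2 * ((0.9 : ℝ) ^ (J - j)) ^ 2 := by gcongr
        _ = v ^ 2 := by rw [← mul_pow]
    have a3 : 2454 * ((N : ℝ) ^ 2 / q.totient) ≤ s ^ 2 := by
      rw [hssq]; gcongr; norm_num
    have a4 : u ^ 2 + s ^ 2 + v ^ 2 + W ^ 2 ≤ (u + v + s + W) ^ 2 := by
      nlinarith [mul_nonneg hu0 hv0, mul_nonneg hu0 hs0, mul_nonneg hu0 hW0, mul_nonneg hv0 hs0,
        mul_nonneg hv0 hW0, mul_nonneg hs0 hW0]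
    linarith
  exact (pow_le_pow_iff_left₀ (norm_nonneg _) (by positivity) two_ne_zero).1 hle

theorem bilinearSum_union (f : ℕ → ℂ) (N : ℕ) (w θ : ℝ) {X Y : Finset ℕ} (h : Disjoint X Y) :
    bilinearSum f N w θ (X ∪ Y) = bilinearSum f N w θ X + bilinearSum f N w θ Y := by
  simp only [bilinearSum, sum_union h, mul_add, sum_add_distrib]

/-- The contribution of all primes in `(2^130, 2^J]`. -/
theorem norm_bilinearSum_middle_le {f : ℕ → ℂ} {B : ℝ} (hf : ∀ n, ‖f n‖ ≤ B) {N q J : ℕ}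
    (hq : 0 < q) (hqN : q ≤ N) (hJ130 : 130 ≤ J) (hJ : 2 ^ (J + 50) ≤ N)
    {a : ℤ} (ha : IsCoprime a q) :
    ‖bilinearSum f N q (a / q) ((Ioc (2 ^ 130) (2 ^ J)).filter Nat.Prime)‖ ≤ B ^ 2 * (
      20 * N + Real.log N / Real.log 2 * (50 * (N / Real.sqrt q.totient) +
      Real.sqrt (409 * (N * q) * ((Real.log (N / q) + 6) * (Real.log (N / q) + 3) + 6)))) := by
  set E₀ : ℝ := 50 * (N / Real.sqrt q.totient) +
      Real.sqrt (409 * (N * q) * ((Real.log (N / q) + 6) * (Real.log (N / q) + 3) + 6)) with hE₀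
  have hE₀0 : 0 ≤ E₀ := by positivity
  have hstep : ∀ K, 130 ≤ K → K ≤ J →
      ‖bilinearSum f N q (a / q) ((Ioc (2 ^ 130) (2 ^ K)).filter Nat.Prime)‖ ≤
        ∑ j ∈ Ico 130 K, B ^ 2 * (N * 0.9 ^ j + N * 0.9 ^ (J - j) + E₀) := by
    intro K hK
    induction K, hK using Nat.le_induction with
    | base => intro _; simp [bilinearSum]
    | succ K hK ih =>
      intro hKJ
      have hsplit : (Ioc (2 ^ 130) (2 ^ (K + 1))).filter Nat.Prime =
          (Ioc (2 ^ 130) (2 ^ K)).filter Nat.Prime ∪ dyadicPrimes K := by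
        have h1 : 2 ^ 130 ≤ 2 ^ K := Nat.pow_le_pow_right (by norm_num) hK
        have h2 : 2 ^ K ≤ 2 * 2 ^ K := by omega
        rw [dyadicPrimes, ← filter_union, pow_succ' 2 K, Ioc_union_Ioc_eq_Ioc h1 h2]
      have hdisj : Disjoint ((Ioc (2 ^ 130) (2 ^ K)).filter Nat.Prime) (dyadicPrimes K) := by
        rw [disjoint_left]
        intro p hp hp'
        have h1 := (mem_Ioc.1 (mem_filter.1 hp).1).2
        have h2 := (mem_Ioc.1 (mem_filter.1 hp').1).1
        omega
      rw [hsplit, bilinearSum_union f N q _ hdisj, sum_Ico_succ_top hK]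
      refine (norm_add_le _ _).trans (add_le_add (ih (by omega)) ?_)
      refine (norm_bilinearSum_dyadic_le hf hq hqN hK (by omega) hJ ha).trans (le_of_eq ?_)
      rw [hE₀]; ring
  have hN1 : (1 : ℝ) ≤ N := by exact_mod_cast (by omega : 1 ≤ N)
  refine (hstep J hJ130 le_rfl).trans ?_
  rw [← mul_sum]
  refine mul_le_mul_of_nonneg_left ?_ (by positivity)
  rw [sum_add_distrib, sum_add_distrib, ← mul_sum, ← mul_sum, sum_const, nsmul_eq_mul, Nat.card_Ico]
  have hgeo : ∀ n : ℕ, ∑ j ∈ range n, (0.9 : ℝ) ^ j ≤ 10 := by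
    intro n
    rw [geom_sum_eq (by norm_num)]
    have : (0 : ℝ) ≤ 0.9 ^ n := by positivity
    rw [div_le_iff_of_neg (by norm_num)]
    linarith
  have g1 : ∑ j ∈ Ico 130 J, (0.9 : ℝ) ^ j ≤ 10 :=
    (sum_le_sum_of_subset_of_nonneg (by intro j hj; simp only [mem_Ico, mem_range] at *; omega)
      fun _ _ _ => by positivity).trans (hgeo J)
  have g2 : ∑ j ∈ Ico 130 J, (0.9 : ℝ) ^ (J - j) ≤ 10 := by
    have : ∑ j ∈ Ico 130 J, (0.9 : ℝ) ^ (J - j) ≤ ∑ j ∈ range (J + 1), (0.9 : ℝ) ^ (J - j) :=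
      sum_le_sum_of_subset_of_nonneg (by intro j hj; simp only [mem_Ico, mem_range] at *; omega)
        fun _ _ _ => by positivity
    refine this.trans ?_
    have h := sum_range_reflect (fun j => (0.9 : ℝ) ^ j) (J + 1)
    rw [Nat.add_sub_cancel] at h
    exact h ▸ hgeo (J + 1)
  -- The number of blocks: the two terms without decay are multiplied by it.
  have g3 : ((J - 130 : ℕ) : ℝ) ≤ Real.log N / Real.log 2 := by
    rw [le_div_iff₀ (Real.log_pos (by norm_num)), ← Real.log_pow]
    apply Real.log_le_log (by positivity)
    calc (2 : ℝ) ^ (J - 130) ≤ 2 ^ (J + 50) := pow_le_pow_right₀ (by norm_num) (by omega)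
      _ ≤ N := by exact_mod_cast hJ
  have := mul_le_mul_of_nonneg_right g3 hE₀0
  nlinarith

/-! ### Trivial ranges -/

theorem norm_bilinearSum_le {f : ℕ → ℂ} {B : ℝ} (hf : ∀ n, ‖f n‖ ≤ B) (N : ℕ) {w : ℝ} (hw : 0 < w)
    (θ : ℝ) {X : Finset ℕ} (hX : ∀ p ∈ X, 0 < p) :
    ‖bilinearSum f N w θ X‖ ≤ B ^ 2 * ∑ p ∈ X, Real.log p * ((N / p : ℕ) : ℝ) := by
  have hB : 0 ≤ B := (norm_nonneg _).trans (hf 0)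
  have hterm : ∀ m p : ℕ, p ∈ X → ‖f p * Real.log p * ramp N w (m * p) * e (m * θ * p)‖ ≤
      if m * p ≤ N then B * Real.log p else 0 := by
    intro m p _
    have hlog : 0 ≤ Real.log p := Real.log_natCast_nonneg p
    rw [norm_mul, norm_e, mul_one, norm_mul, norm_mul, Complex.norm_real, Complex.norm_real,
      Real.norm_of_nonneg hlog, Real.norm_of_nonneg (ramp_nonneg _ _ _)]
    split_ifs with h
    · calc ‖f p‖ * Real.log p * ramp N w (m * p) ≤ B * Real.log p * 1 := by
            have := hf p
            have := ramp_le_one N w (m * p)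
            have := ramp_nonneg N w (m * p)
            gcongr
        _ = _ := mul_one _
    · have h' : (N : ℝ) ≤ m * p := by exact_mod_cast (not_le.1 h).le
      rw [ramp_eq_zero hw h', mul_zero]
  calc ‖bilinearSum f N w θ X‖
      ≤ ∑ m ∈ Icc 1 N, B * ∑ p ∈ X, if m * p ≤ N then B * Real.log p else 0 := by
        refine (norm_sum_le _ _).trans (sum_le_sum fun m _ => ?_)
        rw [norm_mul]
        refine mul_le_mul (hf m) ((norm_sum_le _ _).trans (sum_le_sum fun p hp => hterm m p hp))
          (norm_nonneg _) hB
    _ = B * ∑ p ∈ X, ∑ m ∈ Icc 1 N, (if m * p ≤ N then B * Real.log p else 0) := by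
        rw [← mul_sum, sum_comm]
    _ ≤ B * ∑ p ∈ X, B * (Real.log p * ((N / p : ℕ) : ℝ)) := by
        refine mul_le_mul_of_nonneg_left (sum_le_sum fun p hp => ?_) hB
        rw [← sum_filter, sum_const, nsmul_eq_mul]
        have hcard : ((Icc 1 N).filter (fun m => m * p ≤ N)).card ≤ N / p := by
          have : (Icc 1 N).filter (fun m => m * p ≤ N) ⊆ Icc 1 (N / p) := by
            intro m hm
            rw [mem_filter, mem_Icc] at hm
            rw [mem_Icc]
            exact ⟨hm.1.1, (Nat.le_div_iff_mul_le (hX p hp)).2 hm.2⟩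
          simpa using card_le_card this
        have hcard' : (((Icc 1 N).filter (fun m => m * p ≤ N)).card : ℝ) ≤ ((N / p : ℕ) : ℝ) := by
          exact_mod_cast hcard
        have hlog : 0 ≤ Real.log p := Real.log_natCast_nonneg p
        calc _ ≤ ((N / p : ℕ) : ℝ) * (B * Real.log p) :=
              mul_le_mul_of_nonneg_right hcard' (by positivity)
          _ = _ := by ring
    _ = _ := by rw [← mul_sum]; ring

theorem sum_div_le_dyadic {g : ℕ → ℝ} (hg : ∀ n, 0 ≤ g n) (K : ℕ) :
    ∑ d ∈ Ioc 1 (2 ^ K), g d / d ≤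
      ∑ j ∈ range K, (∑ d ∈ Ioc 0 (2 ^ (j + 1)), g d) / 2 ^ j := by
  induction K with
  | zero => simp
  | succ K ih =>
    have h1 : 1 ≤ 2 ^ K := Nat.one_le_two_pow
    have h2 : 2 ^ K ≤ 2 ^ (K + 1) := Nat.pow_le_pow_right (by norm_num) (by omega)
    rw [← Ioc_union_Ioc_eq_Ioc h1 h2, sum_union (by
      rw [disjoint_left]; intro x hx hx'; rw [mem_Ioc] at hx hx'; omega), sum_range_succ]
    refine add_le_add ih ?_
    rw [sum_div]
    calc ∑ d ∈ Ioc (2 ^ K) (2 ^ (K + 1)), g d / d ≤ ∑ d ∈ Ioc (2 ^ K) (2 ^ (K + 1)), g d / 2 ^ K := by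
          refine sum_le_sum fun d hd => ?_
          have : ((2 : ℝ) ^ K) ≤ d := by exact_mod_cast (mem_Ioc.1 hd).1.le
          exact div_le_div_of_nonneg_left (hg d) (by positivity) this
      _ ≤ _ := sum_le_sum_of_subset_of_nonneg (Ioc_subset_Ioc_left (by omega))
          fun d _ _ => div_nonneg (hg d) (by positivity)

theorem sum_log_prime_le (n : ℕ) :
    ∑ p ∈ (Ioc 0 n).filter Nat.Prime, Real.log p ≤ Real.log 4 * n := by
  have h := Chebyshev.theta_le_log4_mul_x (x := n) (Nat.cast_nonneg n)
  rwa [Chebyshev.theta, Nat.floor_natCast] at h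

/-- Chebyshev's bound gives at most `2 log 4 < 2.7728` for each dyadic block. -/
theorem sum_log_prime_div_le (K : ℕ) :
    ∑ p ∈ (Ioc 0 (2 ^ K)).filter Nat.Prime, Real.log p / p ≤ 2.7728 * K := by
  set g : ℕ → ℝ := fun d => if d.Prime then Real.log d else 0 with hg
  have hg0 : ∀ n, 0 ≤ g n := by
    intro n
    simp only [hg]
    split_ifs
    · exact Real.log_natCast_nonneg n
    · exact le_rfl
  have h1 : ∑ p ∈ (Ioc 0 (2 ^ K)).filter Nat.Prime, Real.log p / p =
      ∑ d ∈ Ioc 1 (2 ^ K), g d / d := by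
    have : (Ioc 0 (2 ^ K)).filter Nat.Prime = (Ioc 1 (2 ^ K)).filter Nat.Prime := by
      ext p
      simp only [mem_filter, mem_Ioc]
      constructor
      · rintro ⟨h, hp⟩; exact ⟨⟨hp.one_lt, h.2⟩, hp⟩
      · rintro ⟨h, hp⟩; exact ⟨⟨hp.pos, h.2⟩, hp⟩
    rw [this, sum_filter]
    refine sum_congr rfl fun d _ => ?_
    simp only [hg]
    split_ifs <;> simp
  rw [h1]
  refine (sum_div_le_dyadic hg0 K).trans ?_
  have h4 : Real.log 4 ≤ 1.3864 := by
    have : Real.log 4 = 2 * Real.log 2 := by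
      rw [show (4 : ℝ) = 2 ^ 2 by norm_num, Real.log_pow]; norm_num
    have := Real.log_two_lt_d9
    linarith
  calc ∑ j ∈ range K, (∑ d ∈ Ioc 0 (2 ^ (j + 1)), g d) / 2 ^ j ≤ ∑ j ∈ range K, (2.7728 : ℝ) := by
        refine sum_le_sum fun j _ => ?_
        rw [div_le_iff₀ (by positivity)]
        have := sum_log_prime_le (2 ^ (j + 1))
        rw [sum_filter] at this
        refine this.trans ?_
        push_cast
        rw [pow_succ]
        have : (0 : ℝ) < 2 ^ j := by positivity
        nlinarith
    _ = 2.7728 * K := by simp [mul_comm]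

/-- Small primes contribute at most `361 B² N`. -/
theorem norm_bilinearSum_low_le {f : ℕ → ℂ} {B : ℝ} (hf : ∀ n, ‖f n‖ ≤ B) (N : ℕ) {w : ℝ}
    (hw : 0 < w) (θ : ℝ) :
    ‖bilinearSum f N w θ ((Ioc 0 (2 ^ 130)).filter Nat.Prime)‖ ≤ B ^ 2 * (361 * N) := by
  refine (norm_bilinearSum_le hf N hw θ fun p hp => (mem_Ioc.1 (mem_filter.1 hp).1).1).trans ?_
  refine mul_le_mul_of_nonneg_left ?_ (sq_nonneg B)
  calc ∑ p ∈ (Ioc 0 (2 ^ 130)).filter Nat.Prime, Real.log p * ((N / p : ℕ) : ℝ)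
      ≤ ∑ p ∈ (Ioc 0 (2 ^ 130)).filter Nat.Prime, N * (Real.log p / p) := by
        refine sum_le_sum fun p _ => ?_
        have h1 : ((N / p : ℕ) : ℝ) ≤ N / p := Nat.cast_div_le
        have h2 : 0 ≤ Real.log p := Real.log_natCast_nonneg p
        calc Real.log p * ((N / p : ℕ) : ℝ) ≤ Real.log p * (N / p) := by gcongr
          _ = _ := by ring
    _ = N * ∑ p ∈ (Ioc 0 (2 ^ 130)).filter Nat.Prime, Real.log p / p := by rw [mul_sum]
    _ ≤ N * (2.7728 * (130 : ℕ)) :=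
        mul_le_mul_of_nonneg_left (sum_log_prime_div_le 130) (Nat.cast_nonneg N)
    _ ≤ 361 * N := by
        have := Nat.cast_nonneg (α := ℝ) N
        push_cast; nlinarith

/-- Large primes contribute at most `51 B² N`. -/
theorem norm_bilinearSum_high_le {f : ℕ → ℂ} {B : ℝ} (hf : ∀ n, ‖f n‖ ≤ B) {N J : ℕ}
    (hNJ : N < 2 ^ (J + 51)) {w : ℝ} (hw : 0 < w) (θ : ℝ) :
    ‖bilinearSum f N w θ ((Ioc (2 ^ J) N).filter Nat.Prime)‖ ≤ B ^ 2 * (51 * N) := by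
  have hpos : ∀ p ∈ (Ioc (2 ^ J) N).filter Nat.Prime, 0 < p := fun p hp =>
    (mem_filter.1 hp).2.pos
  refine (norm_bilinearSum_le hf N hw θ hpos).trans ?_
  refine mul_le_mul_of_nonneg_left ?_ (sq_nonneg B)
  set X := (Ioc (2 ^ J) N).filter Nat.Prime with hX
  have h4 : Real.log 4 = 2 * Real.log 2 := by
    rw [show (4 : ℝ) = 2 ^ 2 by norm_num, Real.log_pow]; norm_num
  have hl2 := Real.log_two_lt_d9
  have hl2' := Real.log_two_gt_d9
  have hl4 : 0 ≤ Real.log 4 := Real.log_nonneg (by norm_num)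
  have hnum : Real.log 4 * (1 + 51 * Real.log 2) ≤ 51 := by
    rw [h4]; clear hNJ; nlinarith
  set V := N / 2 ^ J with hV
  have hVlt : V < 2 ^ 51 := by
    rw [hV, Nat.div_lt_iff_lt_mul (by positivity), ← pow_add, add_comm 51]; exact hNJ
  -- Writing `⌊N/p⌋` as a count of `m ≤ V < 2^51` and summing over `p` first allows Chebyshev's
  -- bound at `N/m`. The harmonic sum over `m` then costs at most `1 + 51 log 2`, a constant.
  have hexp : ∑ p ∈ X, Real.log p * ((N / p : ℕ) : ℝ) =
      ∑ p ∈ X, ∑ m ∈ Icc 1 V, if m * p ≤ N then Real.log p else 0 := by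
    refine sum_congr rfl fun p hp => ?_
    rw [← sum_filter, sum_const, nsmul_eq_mul, mul_comm]
    have : (Icc 1 V).filter (fun m => m * p ≤ N) = Icc 1 (N / p) := by
      have hp1 := (mem_Ioc.1 (mem_filter.1 hp).1).1
      ext m
      rw [mem_filter, mem_Icc, mem_Icc, Nat.le_div_iff_mul_le (hpos p hp)]
      constructor
      · rintro ⟨h1, h2⟩; exact ⟨h1.1, h2⟩
      · rintro ⟨h1, h2⟩
        refine ⟨⟨h1, ?_⟩, h2⟩
        rw [hV, Nat.le_div_iff_mul_le (by positivity)]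
        exact (Nat.mul_le_mul_left m hp1.le).trans h2
    rw [this, Nat.card_Icc, Nat.add_sub_cancel]
  rw [hexp, sum_comm]
  calc ∑ m ∈ Icc 1 V, ∑ p ∈ X, (if m * p ≤ N then Real.log p else 0)
      ≤ ∑ m ∈ Icc 1 V, Real.log 4 * N * (1 / m) := by
        refine sum_le_sum fun m hm => ?_
        have hm1 := (mem_Icc.1 hm).1
        rw [← sum_filter]
        have hsub : X.filter (fun p => m * p ≤ N) ⊆ (Ioc 0 (N / m)).filter Nat.Prime := by
          intro p hp
          rw [mem_filter] at hp
          rw [mem_filter, mem_Ioc, Nat.le_div_iff_mul_le hm1]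
          exact ⟨⟨hpos p hp.1, by rw [mul_comm]; exact hp.2⟩, (mem_filter.1 hp.1).2⟩
        calc ∑ p ∈ X.filter (fun p => m * p ≤ N), Real.log p
            ≤ ∑ p ∈ (Ioc 0 (N / m)).filter Nat.Prime, Real.log p :=
              sum_le_sum_of_subset_of_nonneg hsub fun p _ _ => Real.log_natCast_nonneg p
          _ ≤ Real.log 4 * ((N / m : ℕ) : ℝ) := sum_log_prime_le _
          _ ≤ Real.log 4 * (N / m) := by
              have : ((N / m : ℕ) : ℝ) ≤ N / m := Nat.cast_div_le
              gcongr
          _ = _ := by ring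
    _ = Real.log 4 * N * ∑ m ∈ Icc 1 V, 1 / (m : ℝ) := by rw [mul_sum]
    _ ≤ Real.log 4 * N * (1 + Real.log V) := by
        exact mul_le_mul_of_nonneg_left (sum_one_div_le_one_add_log V)
          (mul_nonneg hl4 (Nat.cast_nonneg N))
    _ ≤ Real.log 4 * N * (1 + 51 * Real.log 2) := by
        have : Real.log V ≤ 51 * Real.log 2 := by
          rcases Nat.eq_zero_or_pos V with h0 | h0
          · rw [h0, Nat.cast_zero, Real.log_zero]; linarith
          · have h5 : Real.log ((2 : ℝ) ^ 51) = 51 * Real.log 2 := by rw [Real.log_pow]; norm_num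
            have h6 : (V : ℝ) ≤ (2 : ℝ) ^ 51 := by
              have h7 := (Nat.cast_le (α := ℝ)).2 hVlt.le
              rwa [Nat.cast_pow, Nat.cast_ofNat] at h7
            rw [← h5]
            exact Real.log_le_log (Nat.cast_pos.2 h0) h6
        exact mul_le_mul_of_nonneg_left (by linarith) (mul_nonneg hl4 (Nat.cast_nonneg N))
    _ ≤ 51 * N := by
        rw [mul_right_comm]
        exact mul_le_mul_of_nonneg_right hnum (Nat.cast_nonneg N)

open ArithmeticFunction

/-! ### From the exponential sum to the bilinear sum -/

/-- The part of `log n` coming from proper prime powers. -/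
noncomputable def properPowerLog (n : ℕ) : ℝ :=
  ∑ d ∈ n.divisors, if d.Prime then 0 else vonMangoldt d

theorem sum_add_properPowerLog (n : ℕ) :
    ∑ p ∈ n.primeFactors, Real.log p + properPowerLog n = Real.log n := by
  rw [← vonMangoldt_sum, properPowerLog]
  have h1 : n.primeFactors = n.divisors.filter Nat.Prime := by
    ext p; simp only [Nat.mem_primeFactors, mem_filter, Nat.mem_divisors]; tauto
  rw [h1, sum_filter, ← sum_add_distrib]
  refine sum_congr rfl fun d _ => ?_
  split_ifs with h
  · rw [vonMangoldt_apply_prime h, add_zero]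
  · rw [zero_add]

/-- Each such `p` is accounted for by the divisor `p²`, since `Λ(p²) = log p`. -/
theorem sum_log_sq_dvd_le (n : ℕ) (hn : n ≠ 0) :
    ∑ p ∈ n.primeFactors.filter (fun p => p ^ 2 ∣ n), Real.log p ≤ properPowerLog n := by
  have h1 : ∑ p ∈ n.primeFactors.filter (fun p => p ^ 2 ∣ n), Real.log p =
      ∑ d ∈ (n.primeFactors.filter (fun p => p ^ 2 ∣ n)).image (· ^ 2),
        if d.Prime then 0 else vonMangoldt d := by
    rw [sum_image]
    · refine sum_congr rfl fun p hp => ?_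
      have hpp := Nat.prime_of_mem_primeFactors (mem_filter.1 hp).1
      rw [if_neg (Nat.Prime.not_prime_pow le_rfl), vonMangoldt_apply_pow two_ne_zero,
        vonMangoldt_apply_prime hpp]
    · intro p _ p' _ h
      exact Nat.pow_left_injective two_ne_zero h
  rw [h1, properPowerLog]
  refine sum_le_sum_of_subset_of_nonneg ?_ fun d _ _ => ?_
  · intro d hd
    obtain ⟨p, hp, rfl⟩ := mem_image.1 hd
    exact Nat.mem_divisors.2 ⟨(mem_filter.1 hp).2, hn⟩
  · split_ifs
    · exact le_rfl
    · exact vonMangoldt_nonneg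

theorem sum_succ_mul_pow_le (K : ℕ) : ∑ j ∈ range K, ((j : ℝ) + 1) * (3 / 4) ^ j ≤ 16 := by
  have h : ∀ K : ℕ, ∑ j ∈ range K, ((j : ℝ) + 1) * (3 / 4) ^ j =
      16 - (16 + 4 * K) * (3 / 4) ^ K := by
    intro K
    induction K with
    | zero => simp
    | succ K ih => rw [sum_range_succ, ih, pow_succ]; push_cast; ring
  rw [h]
  have : (0 : ℝ) ≤ (16 + 4 * K) * (3 / 4) ^ K := by positivity
  linarith

/-- By `ψ(x) - θ(x) ≤ 2 √x log x`, the dyadic block `j` contributes `O((j + 1) 2^(-j/2))`, here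
relaxed to ratio `3/4` to make the series explicit. -/
theorem sum_proper_prime_powers_le (n : ℕ) :
    ∑ d ∈ Icc 1 n, (if d.Prime then 0 else vonMangoldt d) / d ≤ 32 := by
  set g : ℕ → ℝ := fun d => if d.Prime then 0 else vonMangoldt d with hg
  have hg0 : ∀ d, 0 ≤ g d := by
    intro d; simp only [hg]
    split_ifs
    · exact le_rfl
    · exact vonMangoldt_nonneg
  have hsub : Icc 1 n ⊆ insert 1 (Ioc 1 (2 ^ n)) := by
    intro d hd
    rw [mem_Icc] at hd
    rw [mem_insert, mem_Ioc]
    have := (Nat.lt_two_pow_self (n := n)).le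
    omega
  have hnn : ∀ d : ℕ, 0 ≤ g d / d := fun d => div_nonneg (hg0 d) (Nat.cast_nonneg d)
  refine (sum_le_sum_of_subset_of_nonneg hsub fun d _ _ => hnn d).trans ?_
  rw [sum_insert (by simp)]
  have h1 : g 1 / (1 : ℕ) = 0 := by simp [hg]
  rw [h1, zero_add]
  refine (sum_div_le_dyadic hg0 n).trans ?_
  have hl2 := Real.log_two_lt_d9
  have hl2' := Real.log_two_gt_d9
  calc ∑ j ∈ range n, (∑ d ∈ Ioc 0 (2 ^ (j + 1)), g d) / 2 ^ j
      ≤ ∑ j ∈ range n, 2 * (((j : ℝ) + 1) * (3 / 4) ^ j) := by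
        refine sum_le_sum fun j _ => ?_
        rw [div_le_iff₀ (by positivity)]
        have h2 := Chebyshev.psi_sub_theta_eq_sum_not_prime ((2 ^ (j + 1) : ℕ) : ℝ)
        have h3 := Chebyshev.psi_sub_theta_le (x := ((2 ^ (j + 1) : ℕ) : ℝ))
          (by exact_mod_cast Nat.one_le_two_pow)
        rw [h2, Nat.floor_natCast, sum_filter] at h3
        have h4 : ∑ d ∈ Ioc 0 (2 ^ (j + 1)), g d =
            ∑ d ∈ Ioc 0 (2 ^ (j + 1)), if ¬ d.Prime then vonMangoldt d else 0 :=
          sum_congr rfl fun d _ => by simp only [hg, ite_not]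
        rw [h4]
        refine h3.trans ?_
        push_cast
        rw [Real.log_pow]
        push_cast
        have h5 : Real.sqrt ((2 : ℝ) ^ (j + 1)) ≤ 1.4143 * (3 / 2) ^ j := by
          rw [Real.sqrt_le_left (by positivity), mul_pow, pow_succ, ← pow_mul, mul_comm j 2, pow_mul]
          have : (2 : ℝ) ^ j ≤ ((3 / 2) ^ 2) ^ j := pow_le_pow_left₀ (by norm_num) (by norm_num) j
          nlinarith [pow_pos (show (0 : ℝ) < 2 by norm_num) j]
        have h6 : (3 / 4 : ℝ) ^ j * 2 ^ j = (3 / 2) ^ j := by rw [← mul_pow]; norm_num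
        calc 2 * Real.sqrt (2 ^ (j + 1)) * ((j + 1) * Real.log 2)
            ≤ 2 * (1.4143 * (3 / 2) ^ j) * ((j + 1) * 0.7) := by gcongr; linarith
          _ = (2 * 1.4143 * 0.7) * ((j + 1) * (3 / 2) ^ j) := by ring
          _ ≤ 2 * ((j + 1) * (3 / 2) ^ j) := by gcongr; norm_num
          _ = 2 * (((j : ℝ) + 1) * (3 / 4) ^ j) * 2 ^ j := by rw [← h6]; ring
    _ = 2 * ∑ j ∈ range n, ((j : ℝ) + 1) * (3 / 4) ^ j := by rw [mul_sum]
    _ ≤ 32 := by have := sum_succ_mul_pow_le n; linarith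

theorem sum_properPowerLog_le (N : ℕ) : ∑ n ∈ Icc 1 N, properPowerLog n ≤ 32 * N := by
  have h := sum_sum_divisors_mul N (fun d => if d.Prime then 0 else vonMangoldt d) (fun _ => 1)
  simp only [mul_one, sum_const, nsmul_eq_mul, Nat.card_Icc, Nat.add_sub_cancel] at h
  have h' : ∑ n ∈ Icc 1 N, properPowerLog n =
      ∑ d ∈ Icc 1 N, (if d.Prime then 0 else vonMangoldt d) * ((N / d : ℕ) : ℝ) := h
  rw [h']
  calc _ ≤ ∑ d ∈ Icc 1 N, N * ((if d.Prime then 0 else vonMangoldt d) / d) := by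
        refine sum_le_sum fun d _ => ?_
        have h1 : ((N / d : ℕ) : ℝ) ≤ N / d := Nat.cast_div_le
        have h0 : (0 : ℝ) ≤ if d.Prime then 0 else vonMangoldt d := by
          split_ifs
          · exact le_rfl
          · exact vonMangoldt_nonneg
        calc _ ≤ (if d.Prime then 0 else vonMangoldt d) * ((N : ℝ) / d) :=
              mul_le_mul_of_nonneg_left h1 h0
          _ = _ := by ring
    _ = N * ∑ d ∈ Icc 1 N, (if d.Prime then 0 else vonMangoldt d) / d := by rw [mul_sum]
    _ ≤ N * 32 := mul_le_mul_of_nonneg_left (sum_proper_prime_powers_le N) (Nat.cast_nonneg N)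
    _ = _ := by ring

/-- `f(n) log n` agrees with `∑_{p ∣ n} f(p) f(n/p) log p` up to proper prime powers. -/
theorem norm_mul_log_sub_sum_le {B : ℝ} (hB : 1 ≤ B) {f : ArithmeticFunction ℂ}
    (hf : BoundedMultiplicative B f) {n : ℕ} (hn : n ≠ 0) :
    ‖f n * (Real.log n : ℂ) - ∑ p ∈ n.primeFactors, f (n / p) * (f p * (Real.log p : ℂ))‖ ≤
      3 * B ^ 2 * properPowerLog n := by
  obtain ⟨hmul, hbd⟩ := hf
  have hΛ0 : 0 ≤ properPowerLog n :=
    (sum_nonneg fun p _ => Real.log_natCast_nonneg p).trans (sum_log_sq_dvd_le n hn)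
  have hid : f n * (Real.log n : ℂ) - ∑ p ∈ n.primeFactors, f (n / p) * (f p * (Real.log p : ℂ)) =
      ∑ p ∈ n.primeFactors, (f n - f (n / p) * f p) * (Real.log p : ℂ) +
        f n * (properPowerLog n : ℂ) := by
    rw [← sum_add_properPowerLog n]
    push_cast
    rw [mul_add, mul_sum]
    rw [add_sub_right_comm, ← sum_sub_distrib]
    congr 1
    exact sum_congr rfl fun p _ => by ring
  -- If `p² ∤ n` then `n/p` and `p` are coprime and the term vanishes by multiplicativity. Otherwise
  -- it costs at most `B + B² ≤ 2B²`.
  have hterm : ∀ p ∈ n.primeFactors, ‖(f n - f (n / p) * f p) * (Real.log p : ℂ)‖ ≤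
      if p ^ 2 ∣ n then 2 * B ^ 2 * Real.log p else 0 := by
    intro p hp
    have hpp := Nat.prime_of_mem_primeFactors hp
    have hpn := Nat.dvd_of_mem_primeFactors hp
    have hlog : 0 ≤ Real.log p := Real.log_natCast_nonneg p
    split_ifs with h
    · rw [norm_mul, Complex.norm_real, Real.norm_of_nonneg hlog]
      refine mul_le_mul_of_nonneg_right ?_ hlog
      refine (norm_sub_le _ _).trans ?_
      rw [norm_mul]
      have h1 := hbd n
      have h2 : ‖f (n / p)‖ * ‖f p‖ ≤ B * B :=
        mul_le_mul (hbd _) (hbd _) (norm_nonneg _) (by linarith)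
      nlinarith
    · have hcop : (n / p).Coprime p := by
        refine ((Nat.Prime.coprime_iff_not_dvd hpp).2 fun hd => h ?_).symm
        rw [sq]
        exact (Nat.dvd_div_iff_mul_dvd hpn).1 hd
      have := hmul.map_mul_of_coprime hcop
      rw [Nat.div_mul_cancel hpn] at this
      rw [this, sub_self, zero_mul, norm_zero]
  rw [hid]
  refine (norm_add_le _ _).trans ?_
  have h1 : ‖∑ p ∈ n.primeFactors, (f n - f (n / p) * f p) * (Real.log p : ℂ)‖ ≤
      2 * B ^ 2 * properPowerLog n := by
    refine (norm_sum_le _ _).trans ((sum_le_sum hterm).trans ?_)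
    rw [← sum_filter, ← mul_sum]
    exact mul_le_mul_of_nonneg_left (sum_log_sq_dvd_le n hn) (by positivity)
  have h2 : ‖f n * (properPowerLog n : ℂ)‖ ≤ B ^ 2 * properPowerLog n := by
    rw [norm_mul, Complex.norm_real, Real.norm_of_nonneg hΛ0]
    refine mul_le_mul_of_nonneg_right ((hbd n).trans ?_) hΛ0
    nlinarith
  linarith

theorem sum_primeFactors_eq_bilinearSum (f : ℕ → ℂ) (N : ℕ) {w : ℝ} (hw : 0 < w) (θ : ℝ) :
    ∑ n ∈ Icc 1 N, (∑ p ∈ n.primeFactors, f (n / p) * (f p * (Real.log p : ℂ))) *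
      (ramp N w n * e (n * θ)) = bilinearSum f N w θ ((Ioc 0 N).filter Nat.Prime) := by
  set X := (Ioc 0 N).filter Nat.Prime with hX
  set G : ℕ → ℕ → ℂ := fun m p => f m * (f p * Real.log p * ramp N w (m * p) * e (m * θ * p)) with hG
  have h1 : ∀ n ∈ Icc 1 N, (∑ p ∈ n.primeFactors, f (n / p) * (f p * (Real.log p : ℂ))) *
      (ramp N w n * e (n * θ)) = ∑ p ∈ X, if p ∣ n then G (n / p) p else 0 := by
    intro n hn
    rw [mem_Icc] at hn
    have hset : n.primeFactors = X.filter (· ∣ n) := by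
      ext p
      simp only [hX, Nat.mem_primeFactors, mem_filter, mem_Ioc]
      constructor
      · rintro ⟨hp, hd, _⟩
        exact ⟨⟨⟨hp.pos, (Nat.le_of_dvd (by omega) hd).trans hn.2⟩, hp⟩, hd⟩
      · rintro ⟨⟨_, hp⟩, hd⟩
        exact ⟨hp, hd, by omega⟩
    rw [← sum_filter, ← hset, sum_mul]
    refine sum_congr rfl fun p hp => ?_
    have hpn := Nat.dvd_of_mem_primeFactors hp
    have e1 : ((n / p : ℕ) : ℝ) * p = n := by exact_mod_cast Nat.div_mul_cancel hpn
    simp only [hG]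
    rw [e1, mul_right_comm _ θ, e1]
    ring
  rw [sum_congr rfl h1, sum_comm]
  have h2 : ∀ p ∈ X, ∑ n ∈ Icc 1 N, (if p ∣ n then G (n / p) p else 0) = ∑ m ∈ Icc 1 N, G m p := by
    intro p hp
    have hp0 : 0 < p := (mem_filter.1 hp).2.pos
    rw [← sum_filter, sum_filter_dvd_eq N hp0 (fun n => G (n / p) p)]
    simp only [Nat.mul_div_cancel _ hp0]
    refine sum_subset (Icc_subset_Icc_right (Nat.div_le_self N p)) fun m hm hm' => ?_
    have h3 : N / p < m := by
      simp only [mem_Icc] at hm hm'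
      omega
    have h4 : N ≤ m * p := ((Nat.div_lt_iff_lt_mul hp0).1 h3).le
    simp only [hG]
    rw [ramp_eq_zero hw (by exact_mod_cast h4)]
    simp
  rw [sum_congr rfl h2, sum_comm]
  refine sum_congr rfl fun m _ => ?_
  rw [mul_sum]

/-- The logarithm of `N^N / N! ≤ e^N`. -/
theorem sum_log_sub_log_le (N : ℕ) (hN : 0 < N) :
    ∑ n ∈ Icc 1 N, (Real.log N - Real.log n) ≤ N := by
  have h1 : ∑ n ∈ Icc 1 N, Real.log n = Real.log (N.factorial : ℝ) := by
    clear hN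
    induction N with
    | zero => simp
    | succ N ih =>
      rw [sum_Icc_succ_top (by omega), ih, Nat.factorial_succ, Nat.cast_mul,
        Real.log_mul (by positivity) (by positivity), add_comm]
  have hN' : (0 : ℝ) < N := by exact_mod_cast hN
  have h2 : (N : ℝ) ^ N / N.factorial ≤ Real.exp N := Real.pow_div_factorial_le_exp N hN'.le N
  have h3 := Real.log_le_log (by positivity) h2
  rw [Real.log_exp, Real.log_div (by positivity) (by positivity), Real.log_pow] at h3
  rw [sum_sub_distrib, h1, sum_const, nsmul_eq_mul, Nat.card_Icc, Nat.add_sub_cancel]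
  exact h3

/-- The exponential sum in terms of the smoothed bilinear sum over all primes. -/
theorem norm_S_mul_log_le {B : ℝ} (hB : 1 ≤ B) {f : ArithmeticFunction ℂ}
    (hf : BoundedMultiplicative B f) {N q : ℕ} (hq : 0 < q) (hqN : q ≤ N) (θ : ℝ) :
    ‖S f N θ‖ * Real.log N ≤ B * q * Real.log N + 97 * B ^ 2 * N +
      ‖bilinearSum f N q θ ((Ioc 0 N).filter Nat.Prime)‖ := by
  have hbd := hf.2
  have hq' : (0 : ℝ) < q := by exact_mod_cast hq
  have hB0 : 0 ≤ B := by linarith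
  have hlogN : 0 ≤ Real.log N := Real.log_natCast_nonneg N
  set w : ℕ → ℝ := fun n => ramp N q n with hw
  set Sw : ℂ := ∑ n ∈ Icc 1 N, f n * (w n * e (n * θ)) with hSw
  have hw0 : ∀ n, 0 ≤ w n := fun n => ramp_nonneg _ _ _
  have hw1 : ∀ n, w n ≤ 1 := fun n => ramp_le_one _ _ _
  have hwe : ∀ n, ‖(w n : ℂ) * e (n * θ)‖ ≤ 1 := by
    intro n
    rw [norm_mul, norm_e, mul_one, Complex.norm_real, Real.norm_of_nonneg (hw0 n)]
    exact hw1 n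
  -- The ramp equals `1` up to `N - q`, so smoothing alters at most `q` terms.
  have hdiff : ‖S f N θ - Sw‖ ≤ B * q := by
    rw [S, hSw, ← sum_sub_distrib]
    calc ‖∑ n ∈ Icc 1 N, (f n * e (n * θ) - f n * (w n * e (n * θ)))‖
        ≤ ∑ n ∈ Icc 1 N, if N - q < n then B else 0 := by
          refine (norm_sum_le _ _).trans (sum_le_sum fun n _ => ?_)
          have e1 : f n * e (n * θ) - f n * (w n * e (n * θ)) =
              f n * (((1 - w n : ℝ) : ℂ) * e (n * θ)) := by push_cast; ring
          rw [e1, norm_mul, norm_mul, norm_e, mul_one, Complex.norm_real,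
            Real.norm_of_nonneg (by linarith [hw1 n])]
          split_ifs with h
          · calc ‖f n‖ * (1 - w n) ≤ B * 1 :=
                  mul_le_mul (hbd n) (by linarith [hw0 n]) (by linarith [hw1 n]) hB0
              _ = B := mul_one B
          · have : w n = 1 := by
              refine ramp_eq_one hq' ?_
              have : n + q ≤ N := by omega
              have : (n : ℝ) + q ≤ N := by exact_mod_cast this
              linarith
            rw [this]; simp
      _ ≤ B * q := by
          rw [← sum_filter, sum_const, nsmul_eq_mul, mul_comm]
          refine mul_le_mul_of_nonneg_left ?_ hB0
          have hsub : (Icc 1 N).filter (N - q < ·) ⊆ Ioc (N - q) N := by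
            intro n hn
            rw [mem_filter, mem_Icc] at hn
            rw [mem_Ioc]; exact ⟨hn.2, hn.1.2⟩
          have := card_le_card hsub
          rw [Nat.card_Ioc] at this
          exact_mod_cast (by omega : ((Icc 1 N).filter (N - q < ·)).card ≤ q)
  set U : ℂ := ∑ n ∈ Icc 1 N, f n * (Real.log n : ℂ) * (w n * e (n * θ)) with hU
  have hlogdiff : ‖Sw * (Real.log N : ℂ) - U‖ ≤ B * N := by
    rw [hSw, hU, sum_mul, ← sum_sub_distrib]
    calc ‖∑ n ∈ Icc 1 N, (f n * (w n * e (n * θ)) * (Real.log N : ℂ) -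
          f n * (Real.log n : ℂ) * (w n * e (n * θ)))‖
        ≤ ∑ n ∈ Icc 1 N, B * (Real.log N - Real.log n) := by
          refine (norm_sum_le _ _).trans (sum_le_sum fun n hn => ?_)
          rw [mem_Icc] at hn
          have e1 : f n * (w n * e (n * θ)) * (Real.log N : ℂ) -
              f n * (Real.log n : ℂ) * (w n * e (n * θ)) =
              f n * ((Real.log N - Real.log n : ℝ) : ℂ) * (w n * e (n * θ)) := by push_cast; ring
          have h0 : 0 ≤ Real.log N - Real.log n := by
            rw [sub_nonneg]
            exact Real.log_le_log (by exact_mod_cast hn.1) (by exact_mod_cast hn.2)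
          rw [e1, norm_mul, norm_mul, Complex.norm_real, Real.norm_of_nonneg h0]
          calc ‖f n‖ * (Real.log N - Real.log n) * ‖(w n : ℂ) * e (n * θ)‖
              ≤ B * (Real.log N - Real.log n) * 1 := by
                refine mul_le_mul (mul_le_mul_of_nonneg_right (hbd n) h0) (hwe n) (norm_nonneg _)
                  (by positivity)
            _ = _ := mul_one _
      _ = B * ∑ n ∈ Icc 1 N, (Real.log N - Real.log n) := by rw [mul_sum]
      _ ≤ B * N := mul_le_mul_of_nonneg_left (sum_log_sub_log_le N (by omega)) hB0
  have hUb : ‖U - bilinearSum f N q θ ((Ioc 0 N).filter Nat.Prime)‖ ≤ 96 * B ^ 2 * N := by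
    rw [← sum_primeFactors_eq_bilinearSum (fun n => f n) N hq' θ, hU, ← sum_sub_distrib]
    calc _ ≤ ∑ n ∈ Icc 1 N, 3 * B ^ 2 * properPowerLog n := by
          refine (norm_sum_le _ _).trans (sum_le_sum fun n hn => ?_)
          have hn0 : n ≠ 0 := by have := (mem_Icc.1 hn).1; omega
          rw [← sub_mul, norm_mul]
          have h1 := norm_mul_log_sub_sum_le hB hf hn0
          calc _ ≤ 3 * B ^ 2 * properPowerLog n * 1 :=
                mul_le_mul h1 (hwe n) (norm_nonneg _) ((norm_nonneg _).trans h1)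
            _ = _ := mul_one _
      _ = 3 * B ^ 2 * ∑ n ∈ Icc 1 N, properPowerLog n := by rw [mul_sum]
      _ ≤ 3 * B ^ 2 * (32 * N) := mul_le_mul_of_nonneg_left (sum_properPowerLog_le N) (by positivity)
      _ = _ := by ring
  set T := bilinearSum f N q θ ((Ioc 0 N).filter Nat.Prime)
  have h1 : ‖S f N θ‖ ≤ B * q + ‖Sw‖ := by
    have := norm_add_le (S f N θ - Sw) Sw
    rw [sub_add_cancel] at this
    linarith
  have h2 : ‖Sw‖ * Real.log N ≤ B * N + 96 * B ^ 2 * N + ‖T‖ := by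
    have e1 : ‖Sw * (Real.log N : ℂ)‖ = ‖Sw‖ * Real.log N := by
      rw [norm_mul, Complex.norm_real, Real.norm_of_nonneg hlogN]
    rw [← e1]
    have e2 : Sw * (Real.log N : ℂ) = (Sw * (Real.log N : ℂ) - U) + (U - T) + T := by ring
    rw [e2]
    refine (norm_add_le _ _).trans (add_le_add ((norm_add_le _ _).trans (add_le_add hlogdiff hUb)) le_rfl)
  have h3 : B * N ≤ B ^ 2 * N := by
    refine mul_le_mul_of_nonneg_right ?_ (Nat.cast_nonneg N)
    nlinarith
  calc ‖S f N θ‖ * Real.log N ≤ (B * q + ‖Sw‖) * Real.log N := by gcongr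
    _ = B * q * Real.log N + ‖Sw‖ * Real.log N := by ring
    _ ≤ _ := by linarith

/-! ### The constants -/

theorem one_le_eulerFactor {p : ℕ} (hp : 2 < p) : 1 ≤ eulerFactor p := by
  have h3 : (3 : ℝ) ≤ p := by exact_mod_cast hp
  have h : (p : ℝ) ^ 3 - (p : ℝ) ^ 2 - 2 * p = p * ((p - 2) * (p + 1)) := by ring
  have h2 : (0 : ℝ) < (p : ℝ) - 2 := by linarith
  unfold eulerFactor
  rw [h]
  have : (0 : ℝ) ≤ 1 / (p * ((p - 2) * (p + 1))) := by positivity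
  linarith

/-- Every Euler factor is at least `1`, so `z ≥ 8√2 > 11.31`. -/
theorem le_z : 11.31 ≤ z := by
  have h1 : 1 ≤ ∏' p : {p : ℕ // p.Prime ∧ 2 < p}, eulerFactor p :=
    ge_of_tendsto' multipliable_eulerFactor.hasProd fun s => by
      simpa using prod_le_prod (fun _ _ => zero_le_one) fun p (_ : p ∈ s) => one_le_eulerFactor p.2.2
  have h2 : (1.41375 : ℝ) ≤ Real.sqrt (2 * ∏' p : {p : ℕ // p.Prime ∧ 2 < p}, eulerFactor p) :=
    Real.le_sqrt_of_sq_le (by norm_num; linarith)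
  unfold z
  linarith

/-- With `E = 4` and `z = 11.31` the terms in `B²` already total about `685.4`. -/
theorem le_b₁ {B E : ℝ} (hB : 1 ≤ B) (hE : 4 ≤ E) : 685 * B ^ 2 ≤ b₁ B E := by
  have hz := le_z
  have h0 : 0 ≤ B ^ 2 := sq_nonneg B
  have h1 : B ^ 2 * 11.31 ≤ B ^ 2 * z := by gcongr
  have h2 : (B ^ 2 * 1.59 + B ^ 2 * z) * 4 ≤ (B ^ 2 * 1.59 + B ^ 2 * z) * E := by
    gcongr
  have h3 : b₁ B E = B + 9.82 * B ^ 2 + 8.12 * ((B ^ 2 * 1.59 + B ^ 2 * z) * E)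
      + 18.9 * ((B ^ 2 * z) * 0.96) + 3.46 * (B ^ 2 * 1.59) + 4.06 * (B ^ 2 * z) := by
    unfold b₁ a₁ a₃ a₄
    ring
  rw [h3]
  nlinarith

theorem le_b₂ {B E : ℝ} (hE : 4 ≤ E) : B ^ 2 / Real.log 2 * 50 ≤ b₂ B E := by
  have hz := le_z
  have h0 : 0 ≤ B ^ 2 := sq_nonneg B
  have hl : 0 < Real.log 2 := Real.log_pos (by norm_num)
  have h1 : B ^ 2 * 11.31 ≤ B ^ 2 * z := by gcongr
  have hpi : (1.5 : ℝ) ≤ Real.pi ^ 2 / 6 := by nlinarith [Real.pi_gt_three]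
  have h2 : B ^ 2 * 11.31 * 1.5 ≤ B ^ 2 * z * (Real.pi ^ 2 / 6) := by gcongr
  have h3 : (1 : ℝ) ≤ Real.sqrt 2 := Real.one_le_sqrt.2 (by norm_num)
  have h4 : (5 : ℝ) ≤ Real.sqrt 2 * E + 1 := by nlinarith
  calc B ^ 2 / Real.log 2 * 50 ≤ B ^ 2 * 11.31 * 1.5 * (5 / Real.log 2) := by
        rw [div_mul_eq_mul_div, mul_div_assoc', div_le_div_iff_of_pos_right hl]
        nlinarith
    _ ≤ B ^ 2 * z * (Real.pi ^ 2 / 6) * ((Real.sqrt 2 * E + 1) / Real.log 2) := by gcongr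

theorem rpow_three_halves_pos {x : ℝ} (hx : 0 < x) : 0 < x ^ (3 / 2 : ℝ) :=
  Real.rpow_pos_of_pos hx _

theorem rpow_three_halves_eq {x : ℝ} (hx : 0 < x) : x ^ (3 / 2 : ℝ) = x * Real.sqrt x := by
  rw [Real.sqrt_eq_rpow, ← Real.rpow_one_add' hx.le (by norm_num)]
  norm_num

/-- The possibly negative first term of `b₃` is small. -/
theorem neg_le_first_term {E q : ℝ} (hE : 4 ≤ E) (hq : 4 ≤ q) :
    -(5.6 : ℝ) ≤ 7.63 / Real.sqrt E * (1 + (Real.log (64 / E) + 1) / Real.log q) := by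
  have hE0 : 0 < E := by linarith
  have hs : 0 < Real.sqrt E := Real.sqrt_pos.2 hE0
  have hl2 := Real.log_two_gt_d9
  have h64 : Real.log (64 / E) = 6 * Real.log 2 - Real.log E := by
    rw [Real.log_div (by norm_num) hE0.ne', show (64 : ℝ) = 2 ^ 6 by norm_num, Real.log_pow]
    norm_num
  have hlq : 1.38 ≤ Real.log q := by
    have : Real.log 4 ≤ Real.log q := Real.log_le_log (by norm_num) hq
    rw [show (4 : ℝ) = 2 ^ 2 by norm_num, Real.log_pow] at this
    push_cast at this
    linarith
  have hlE : Real.log E ≤ Real.sqrt E := by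
    have h1 : Real.log (Real.sqrt E / 2) ≤ Real.sqrt E / 2 - 1 :=
      Real.log_le_sub_one_of_pos (by positivity)
    rw [Real.log_div hs.ne' (by norm_num), Real.log_sqrt hE0.le] at h1
    have := Real.log_two_lt_d9
    linarith
  have h1 : -Real.sqrt E ≤ Real.log (64 / E) + 1 := by linarith
  have h2 : -(Real.sqrt E / 1.38) ≤ (Real.log (64 / E) + 1) / Real.log q := by
    rw [le_div_iff₀ (by linarith)]
    have : Real.sqrt E ≤ Real.sqrt E / 1.38 * Real.log q := by
      rw [div_mul_eq_mul_div, le_div_iff₀ (by norm_num)]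
      gcongr
    linarith
  calc -(5.6 : ℝ) ≤ 7.63 / Real.sqrt E * (-(Real.sqrt E / 1.38)) := by
        rw [mul_neg, div_mul_div_comm, mul_comm (Real.sqrt E), mul_div_mul_right _ _ hs.ne']
        norm_num
    _ ≤ _ := by gcongr; linarith

/-- The term `1.48 a₅` suffices, as `1.48 · 0.96 · 11.31 > 16`. For large `E` the first term may be
negative, but it is at least `-11.2 B² log(ER)` after multiplication, which the first `a₆` term
outweighs. -/
theorem le_b₃_mul {B E R q : ℝ} (hE : 4 ≤ E) (hR : 1 ≤ R) (hq : 4 ≤ q) :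
    16 * B ^ 2 * Real.log (4 * R) ^ (3 / 2 : ℝ) ≤ b₃ B E R q * Real.log (E * R) ^ (3 / 2 : ℝ) := by
  have hz := le_z
  have h0 : 0 ≤ B ^ 2 := sq_nonneg B
  have hl2 : 0 < Real.log 2 := Real.log_pos (by norm_num)
  have hl4 : 1.38 ≤ Real.log 4 := by
    rw [show (4 : ℝ) = 2 ^ 2 by norm_num, Real.log_pow]
    have := Real.log_two_gt_d9
    push_cast
    linarith
  have h4R : Real.log 4 ≤ Real.log (4 * R) := Real.log_le_log (by norm_num) (by linarith)
  have hER : Real.log (4 * R) ≤ Real.log (E * R) := Real.log_le_log (by linarith) (by gcongr)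
  have hL : Real.log (4 * E * R) = Real.log 4 + Real.log (E * R) := by
    rw [mul_assoc, Real.log_mul (by norm_num) (by positivity)]
  have h2R : 0 ≤ Real.log (2 * R) := Real.log_nonneg (by linarith)
  set l := Real.log (E * R) with hl
  have hl0 : 0 < l := by linarith
  have hp := rpow_three_halves_pos hl0
  have hsl : 1 ≤ Real.sqrt l := Real.one_le_sqrt.2 (by linarith)
  have hmono : Real.log (4 * R) ^ (3 / 2 : ℝ) ≤ l ^ (3 / 2 : ℝ) :=
    Real.rpow_le_rpow (by linarith) hER (by norm_num)
  set A := 7.63 / Real.sqrt E * (1 + (Real.log (64 / E) + 1) / Real.log q) with hA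
  have hA' : -5.6 ≤ A := neg_le_first_term hE hq
  have key : b₃ B E R q * l ^ (3 / 2 : ℝ) = B ^ 2 * A * (Real.log 4 + l)
      + 1.48 * 0.96 * (B ^ 2 * z) * l ^ (3 / 2 : ℝ) + 1.48 * 1.32 * (B ^ 2 * z) * l
      + B ^ 2 * z * 0.96 / Real.log 2 * Real.log (2 * R) + B ^ 2 * 1.32 * z / Real.log 2 := by
    have h1 : l ^ (3 / 2 : ℝ) / Real.sqrt l = l := by
      rw [rpow_three_halves_eq hl0, mul_div_assoc, div_self (by positivity), mul_one]
    have h2 : 1.48 * (a₆ B / Real.sqrt l) * l ^ (3 / 2 : ℝ) = 1.48 * a₆ B * l := by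
      rw [mul_assoc, div_mul_eq_mul_div, mul_div_assoc, h1, mul_assoc]
    unfold b₃
    rw [hL, ← hl, add_mul, add_mul, add_mul, add_mul, h2]
    unfold a₅ a₆
    rw [hA]
    generalize l ^ (3 / 2 : ℝ) = P at hp
    field_simp
  rw [key]
  have h1 : B ^ 2 * 11.31 ≤ B ^ 2 * z := by gcongr
  have h3 : 0 ≤ B ^ 2 * z * 0.96 / Real.log 2 * Real.log (2 * R) := by positivity
  have h4 : 0 ≤ B ^ 2 * 1.32 * z / Real.log 2 := by positivity
  have h5 : B ^ 2 * 11.31 * l ≤ B ^ 2 * z * l := by gcongr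
  have h6 : B ^ 2 * 11.31 * l ^ (3 / 2 : ℝ) ≤ B ^ 2 * z * l ^ (3 / 2 : ℝ) := by gcongr
  have h7 : B ^ 2 * (-5.6) * (Real.log 4 + l) ≤ B ^ 2 * A * (Real.log 4 + l) := by gcongr
  have h8 : B ^ 2 * (Real.log 4 + l) ≤ B ^ 2 * (2 * l) := by gcongr; linarith
  have h9 : B ^ 2 * Real.log (4 * R) ^ (3 / 2 : ℝ) ≤ B ^ 2 * l ^ (3 / 2 : ℝ) := by gcongr
  have h10 : 0 ≤ B ^ 2 * l := by positivity
  have h11 : 0 ≤ B ^ 2 * l ^ (3 / 2 : ℝ) := by positivity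
  nlinarith

/-! ### The main estimate -/

theorem norm_S_le_mul {B : ℝ} {f : ArithmeticFunction ℂ} (hf : ∀ n, ‖f n‖ ≤ B) (N : ℕ) (θ : ℝ) :
    ‖S f N θ‖ ≤ B * N := by
  unfold S
  refine (norm_sum_le_of_le _ (f := fun n => f n * e (n * θ)) (n := fun _ => B) fun n _ => ?_).trans ?_
  · rw [norm_mul, norm_e, mul_one]
    exact hf n
  · simp [mul_comm]

theorem log_four_ge : (1.386 : ℝ) ≤ Real.log 4 := by
  rw [show (4 : ℝ) = 2 ^ 2 by norm_num, Real.log_pow]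
  have := Real.log_two_gt_d9
  push_cast
  linarith

/-- For bounded `N/q` the trivial bound `N = √(N/q) √(Nq)` is absorbed by the third term. Two ranges
of `R` suffice: `√R ≤ 25` near `1`, and `√R ≤ e⁵ < 150` beyond. -/
theorem sqrt_le_of_log_le_ten {R : ℝ} (hR : 1 ≤ R) (hx : Real.log R ≤ 10) :
    Real.sqrt R ≤ 16 * Real.log (4 * R) ^ (3 / 2 : ℝ) := by
  have h4 := log_four_ge
  rcases le_total R 625 with h | h
  · have h1 : Real.sqrt R ≤ 25 := Real.sqrt_le_iff.2 ⟨by norm_num, by linarith⟩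
    have h2 : (1.386 : ℝ) ≤ Real.log (4 * R) :=
      h4.trans (Real.log_le_log (by norm_num) (by linarith))
    have h3 : (1.17 : ℝ) ≤ Real.sqrt (Real.log (4 * R)) := Real.le_sqrt_of_sq_le (by linarith)
    rw [rpow_three_halves_eq (by linarith)]
    nlinarith
  · have h1 : Real.sqrt R ≤ 150 := by
      have h2 : R ≤ Real.exp 1 ^ 10 := by
        rw [← Real.exp_nat_mul]
        exact (Real.log_le_iff_le_exp (by linarith)).1 (by simpa using hx)
      have h3 : Real.exp 1 ^ 10 ≤ 2.7183 ^ 10 := by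
        gcongr
        linarith [Real.exp_one_lt_d9]
      exact Real.sqrt_le_iff.2 ⟨by norm_num, h2.trans (h3.trans (by norm_num))⟩
    have h2 : (7.6 : ℝ) ≤ Real.log (4 * R) := by
      have h5 : Real.log (2 ^ 11) ≤ Real.log (4 * R) :=
        Real.log_le_log (by norm_num) (by linarith)
      rw [Real.log_pow] at h5
      have := Real.log_two_gt_d9
      push_cast at h5
      linarith
    have h3 : (2 : ℝ) ≤ Real.sqrt (Real.log (4 * R)) := Real.le_sqrt_of_sq_le (by linarith)
    rw [rpow_three_halves_eq (by linarith)]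
    nlinarith

/-- The left side grows only linearly in `x`, so the power `3/2` wins once `x ≥ 10`. The summand `1`
pays for the truncation error `B q`. -/
theorem one_add_sqrt_div_log_two_le {x : ℝ} (hx : 10 ≤ x) :
    1 + Real.sqrt (409 * ((x + 6) * (x + 3) + 6)) / Real.log 2 ≤
      16 * (Real.log 4 + x) ^ (3 / 2 : ℝ) := by
  have h4 := log_four_ge
  have hl := Real.log_two_gt_d9
  set y := Real.log 4 + x with hy
  have hy11 : 11.386 ≤ y := by linarith
  rw [rpow_three_halves_eq (by linarith)]
  have hsq : Real.sqrt y * Real.sqrt y = y := Real.mul_self_sqrt (by linarith)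
  have hs : (3 : ℝ) ≤ Real.sqrt y := Real.le_sqrt_of_sq_le (by linarith)
  set s := Real.sqrt y
  have hys : (34 : ℝ) ≤ y * s := by nlinarith
  have h1 : Real.sqrt (409 * ((x + 6) * (x + 3) + 6)) ≤ 11 * (y * s) := by
    refine Real.sqrt_le_iff.2 ⟨by positivity, ?_⟩
    have e1 : (11 * (y * s)) ^ 2 = 121 * y ^ 2 * y := by rw [← hsq]; ring
    rw [e1]
    have hxy : x ≤ y - 1.386 := by linarith
    have e2 : (x + 6) * (x + 3) ≤ (y + 5) * (y + 2) :=
      mul_le_mul (by linarith) (by linarith) (by linarith) (by linarith)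
    have e3 : 121 * y ^ 2 * 11.386 ≤ 121 * y ^ 2 * y := by gcongr
    nlinarith
  have h2 : Real.sqrt (409 * ((x + 6) * (x + 3) + 6)) / Real.log 2 ≤ 16 * (y * s) - 1 := by
    rw [div_le_iff₀ (by linarith)]
    nlinarith
  linarith

theorem filter_prime_Ioc_eq_union {a b N : ℕ} (hab : a ≤ b) (hbN : b ≤ N) :
    (Ioc 0 N).filter Nat.Prime =
      (Ioc 0 a).filter Nat.Prime ∪ ((Ioc a b).filter Nat.Prime ∪ (Ioc b N).filter Nat.Prime) := by
  rw [← filter_union, ← filter_union, Ioc_union_Ioc_eq_Ioc hab hbN,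
    Ioc_union_Ioc_eq_Ioc (Nat.zero_le a) (hab.trans hbN)]

theorem norm_bilinearSum_le_three {f : ℕ → ℂ} {N w a b : ℕ} {θ : ℝ} (hab : a ≤ b) (hbN : b ≤ N) :
    ‖bilinearSum f N w θ ((Ioc 0 N).filter Nat.Prime)‖ ≤
      ‖bilinearSum f N w θ ((Ioc 0 a).filter Nat.Prime)‖ +
      (‖bilinearSum f N w θ ((Ioc a b).filter Nat.Prime)‖ +
        ‖bilinearSum f N w θ ((Ioc b N).filter Nat.Prime)‖) := by
  rw [filter_prime_Ioc_eq_union hab hbN, bilinearSum_union, bilinearSum_union]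
  · exact (norm_add_le _ _).trans (by gcongr; exact norm_add_le _ _)
  · refine disjoint_filter_filter (disjoint_left.2 fun p hp hp' => ?_)
    simp only [mem_Ioc] at hp hp'
    omega
  · rw [← filter_union, Ioc_union_Ioc_eq_Ioc hab hbN]
    refine disjoint_filter_filter (disjoint_left.2 fun p hp hp' => ?_)
    simp only [mem_Ioc] at hp hp'
    omega

theorem norm_bilinearSum_prime_le {f : ℕ → ℂ} {B : ℝ} (hf : ∀ n, ‖f n‖ ≤ B) {N q : ℕ} (hq : 0 < q)
    (hqN : q ≤ N) (hN : 180 ≤ Nat.log 2 N) {a : ℤ} (ha : IsCoprime a (q : ℤ)) :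
    ‖bilinearSum f N q ((a : ℝ) / q) ((Ioc 0 N).filter Nat.Prime)‖ ≤
      B ^ 2 * (432 * N + Real.log N / Real.log 2 * (50 * (N / Real.sqrt q.totient) +
        Real.sqrt (409 * (N * q) * ((Real.log (N / q) + 6) * (Real.log (N / q) + 3) + 6)))) := by
  have hN0 : N ≠ 0 := by omega
  obtain ⟨J, hJ⟩ : ∃ J, Nat.log 2 N = J + 50 := ⟨Nat.log 2 N - 50, by omega⟩
  have hJ130 : 130 ≤ J := by omega
  have h1 : 2 ^ (J + 50) ≤ N := hJ ▸ Nat.pow_log_le_self 2 hN0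
  have h2 : N < 2 ^ (J + 51) := by
    have := Nat.lt_pow_succ_log_self (b := 2) (by norm_num) N
    rw [hJ] at this
    exact this
  have h3 : 2 ^ 130 ≤ 2 ^ J := Nat.pow_le_pow_right (by norm_num) hJ130
  have h4 : 2 ^ J ≤ N := (Nat.pow_le_pow_right (by norm_num) (Nat.le_add_right J 50)).trans h1
  have hq' : (0 : ℝ) < q := Nat.cast_pos.2 hq
  have hlow := norm_bilinearSum_low_le hf N hq' ((a : ℝ) / q)
  have hhigh := norm_bilinearSum_high_le hf h2 hq' ((a : ℝ) / q)
  have hmid := norm_bilinearSum_middle_le hf hq hqN hJ130 h1 ha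
  refine (norm_bilinearSum_le_three h3 h4).trans ((add_le_add hlow (add_le_add hmid hhigh)).trans
    (le_of_eq ?_))
  ring

/-- The estimate of Montgomery and Vaughan with absolute constants. -/
theorem norm_S_le {B : ℝ} (hB : 1 ≤ B) {f : ArithmeticFunction ℂ} (hf : BoundedMultiplicative B f)
    {N q : ℕ} (hq : 2 ≤ q) (hqN : q ≤ N) {a : ℤ} (ha : IsCoprime a (q : ℤ)) :
    ‖S f N ((a : ℝ) / q)‖ ≤ 685 * B ^ 2 * (N / Real.log N)
      + B ^ 2 / Real.log 2 * 50 * (N / Real.sqrt q.totient)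
      + 16 * B ^ 2 * Real.log (4 * (N / q)) ^ (3 / 2 : ℝ) * Real.sqrt (N * q) := by
  have hq0 : (0 : ℝ) < q := by exact_mod_cast (by omega : 0 < q)
  have hN2 : (2 : ℝ) ≤ N := by exact_mod_cast hq.trans hqN
  have hN0 : (0 : ℝ) < N := by linarith
  have hqN' : (q : ℝ) ≤ N := by exact_mod_cast hqN
  have hl2 : 0 < Real.log 2 := Real.log_pos (by norm_num)
  have hlN : 0 < Real.log N := Real.log_pos (by linarith)
  have hR : (1 : ℝ) ≤ N / q := (one_le_div hq0).2 hqN'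
  have hBB : B ≤ B ^ 2 := by nlinarith
  have hB0 : 0 ≤ B ^ 2 := sq_nonneg B
  have hl4 := log_four_ge
  have hl4R : Real.log (4 * (N / q)) = Real.log 4 + Real.log (N / q) :=
    Real.log_mul (by norm_num) (by positivity)
  have hx0 : 0 ≤ Real.log (N / q) := Real.log_nonneg hR
  have hpos2 : 0 ≤ B ^ 2 / Real.log 2 * 50 * (N / Real.sqrt q.totient) := by positivity
  have hpos3 : 0 ≤ 16 * B ^ 2 * Real.log (4 * (N / q)) ^ (3 / 2 : ℝ) * Real.sqrt (N * q) := by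
    have := Real.rpow_nonneg (by linarith : 0 ≤ Real.log (4 * (N / q))) (3 / 2 : ℝ)
    positivity
  have htriv : ‖S f N ((a : ℝ) / q)‖ ≤ B ^ 2 * N :=
    (norm_S_le_mul hf.2 N _).trans (by gcongr)
  -- The trivial bound `B² N` settles `log N ≤ 685`; beyond it, `N ≥ 2^180` leaves room for the
  -- middle range of primes.
  rcases le_or_gt (Real.log N) 685 with hsmall | hbig
  · have : B ^ 2 * N ≤ 685 * B ^ 2 * (N / Real.log N) := by
      rw [mul_div_assoc', le_div_iff₀ hlN]
      have : B ^ 2 * N * Real.log N ≤ B ^ 2 * N * 685 := by gcongr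
      linarith
    linarith
  have hpos1 : 0 ≤ 685 * B ^ 2 * (N / Real.log N) := by positivity
  rcases le_total (Real.log (N / q)) 10 with hx | hx
  · have h1 := sqrt_le_of_log_le_ten hR hx
    have h2 : (N : ℝ) = Real.sqrt (N / q) * Real.sqrt (N * q) := by
      rw [← Real.sqrt_mul (by positivity), show (N : ℝ) / q * (N * q) = N ^ 2 by field_simp,
        Real.sqrt_sq hN0.le]
    have h3 : Real.sqrt (N / q) * Real.sqrt (N * q) ≤
        16 * Real.log (4 * (N / q)) ^ (3 / 2 : ℝ) * Real.sqrt (N * q) := by gcongr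
    have h4 : B ^ 2 * N ≤ B ^ 2 * (16 * Real.log (4 * (N / q)) ^ (3 / 2 : ℝ) * Real.sqrt (N * q)) :=
      mul_le_mul_of_nonneg_left (h2.le.trans h3) hB0
    linarith
  have hlog : 180 ≤ Nat.log 2 N := by
    refine Nat.le_log_of_pow_le (by norm_num) ?_
    have h1 : Real.log (2 ^ 180) ≤ Real.log N := by
      rw [Real.log_pow]
      have := Real.log_two_lt_d9
      push_cast
      linarith
    have h2 := (Real.log_le_log_iff (by positivity) hN0).1 h1
    exact_mod_cast h2
  have hbil := norm_bilinearSum_prime_le hf.2 (by omega) hqN hlog ha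
  have hS := norm_S_mul_log_le hB hf (by omega) hqN ((a : ℝ) / q)
  have hconst := one_add_sqrt_div_log_two_le hx
  set W := (Real.log (N / q) + 6) * (Real.log (N / q) + 3) + 6
  set Φ := (N : ℝ) / Real.sqrt q.totient
  have hsplit : Real.sqrt (409 * (N * q) * W) = Real.sqrt (409 * W) * Real.sqrt (N * q) := by
    rw [← Real.sqrt_mul' _ (by positivity)]
    ring_nf
  have hqs : (q : ℝ) ≤ Real.sqrt (N * q) := by
    refine Real.le_sqrt_of_sq_le ?_
    rw [sq]
    gcongr
  rw [hsplit] at hbil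
  -- `529 = 97 + 432`: the error of passing to the bilinear sum, plus the small, middle and large
  -- primes (`361 + 20 + 51`).
  have h1 : ‖S f N ((a : ℝ) / q)‖ ≤ B * q + 529 * B ^ 2 * (N / Real.log N)
      + B ^ 2 / Real.log 2 * (50 * Φ + Real.sqrt (409 * W) * Real.sqrt (N * q)) := by
    have h2 := hS.trans (add_le_add_right hbil _)
    rw [← le_div_iff₀ hlN] at h2
    refine h2.trans (le_of_eq ?_)
    field_simp
    ring
  have h2 : B * q ≤ B ^ 2 * Real.sqrt (N * q) := by gcongr
  have h3 : B ^ 2 * ((1 + Real.sqrt (409 * W) / Real.log 2) * Real.sqrt (N * q)) ≤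
      B ^ 2 * (16 * Real.log (4 * (N / q)) ^ (3 / 2 : ℝ) * Real.sqrt (N * q)) := by
    rw [hl4R]
    gcongr
  have h4 : B ^ 2 / Real.log 2 * (50 * Φ + Real.sqrt (409 * W) * Real.sqrt (N * q)) =
      B ^ 2 / Real.log 2 * 50 * Φ +
        B ^ 2 * (Real.sqrt (409 * W) / Real.log 2 * Real.sqrt (N * q)) := by ring
  have h5 : 0 ≤ B ^ 2 * (N / Real.log N) := by positivity
  linarith

end MontgomeryVaughan

theorem theorem5 (B : ℝ) (hB : 1 ≤ B) (E : ℝ) (hE : 4 ≤ E) (N q : ℕ) (hq : 4 ≤ q) (hqN : q ≤ N)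
    (a : ℤ) (haq : IsCoprime a (q : ℤ))
    (f : ArithmeticFunction ℂ) (hf : MontgomeryVaughan.BoundedMultiplicative B f) :
    ‖MontgomeryVaughan.S f N ((a : ℝ) / (q : ℝ))‖ ≤
      MontgomeryVaughan.b₁ B E * ((N : ℝ) / Real.log N)
      + MontgomeryVaughan.b₂ B E * ((N : ℝ) / (Nat.totient q : ℝ) ^ (1 / 2 : ℝ))
      + MontgomeryVaughan.b₃ B E ((N : ℝ) / (q : ℝ)) q * Real.sqrt ((N : ℝ) * (q : ℝ))
          * Real.log (E * (N : ℝ) / (q : ℝ)) ^ (3 / 2 : ℝ) := by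
  have hq' : (4 : ℝ) ≤ q := by exact_mod_cast hq
  have hR : (1 : ℝ) ≤ N / q := (one_le_div (by linarith)).2 (by exact_mod_cast hqN)
  have hN : 0 ≤ (N : ℝ) / Real.log N := div_nonneg N.cast_nonneg (Real.log_natCast_nonneg N)
  rw [← Real.sqrt_eq_rpow, mul_right_comm (MontgomeryVaughan.b₃ B E _ _), mul_div_assoc E]
  refine (MontgomeryVaughan.norm_S_le hB hf (by omega) hqN haq).trans ?_
  refine add_le_add (add_le_add ?_ ?_) ?_
  · exact mul_le_mul_of_nonneg_right (MontgomeryVaughan.le_b₁ hB hE) hN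
  · exact mul_le_mul_of_nonneg_right (MontgomeryVaughan.le_b₂ hE) (by positivity)
  · exact mul_le_mul_of_nonneg_right (MontgomeryVaughan.le_b₃_mul hE hR hq') (Real.sqrt_nonneg _)
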